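/- Let $K:[0,1]^2\to\mathbb R$ be a symmetric Lipschitz function with $|K|\le 1$, and let $T_K f(x)=\int_0^1 K(x,y)f(y)\,dy$ be its integral operator on $L^2[0,1]$. Let $\lambda_1(K)\ge\lambda_2(K)\ge\cdots\ge 0$ denote the positive eigenvalues of $T_K$ in decreasing order, repeated according to multiplicity and continued by zeros if there are only finitely many. Assume $\lambda_1(K)>\lambda_2(K)$, and let $\phi_1\in L^2[0,1]$ be an eigenfunction of $T_K$ for $\lambda_1(K)$ with $\|\phi_1\|_{L^2}=1$. Let $U_1,U_2,\dots$ be i.i.d. uniform on $[0,1]$, let $K_n$ be the random $n\times n$ matrix with entries $K(U_i,U_j)$ for $i\ne j$ and $0$ for $i=j$, and let $\lambda_1(K_n)$ be its largest eigenvalue. (1) If $\phi_1$ is not almost everywhere constant, then, as $n\to\infty$, $$\sqrt n\left(\frac{\lambda_1(K_n)}{n}-\lambda_1(K)\right)\xrightarrow{d} N\big(0,\ \lambda_1(K)^2\,\mathrm{Var}(\phi_1(U)^2)\big),\qquad U\sim\mathrm{Unif}[0,1].$$ (2) If $\phi_1$ is almost everywhere constant, then, as $n\to\infty$, $$\lambda_1(K_n)-(n-1)\lambda_1(K)\xrightarrow{d}\zeta_\infty:=\sum_{\lambda}\frac{\lambda_1(K)\,\lambda}{\lambda_1(K)-\lambda}\,(Z_\lambda^2-1)+\sum_{\lambda}\frac{\lambda^2}{\lambda_1(K)-\lambda},$$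 where both sums run over the nonzero eigenvalues $\lambda\ne\lambda_1(K)$ of $T_K$ (positive and negative), each repeated according to its multiplicity, and the $Z_\lambda$ are independent standard normal variables, one for each repetition. Here the first series converges unconditionally in $L^2$ and the second converges absolutely. -/

import Mathlib

open MeasureTheory ProbabilityTheory Filter Topology
open scoped unitInterval NNReal ENNReal

noncomputable section

namespace RandomKernel

/-- The real Hilbert space `L²[0,1]` for Lebesgue measure (the uniform law on `[0,1]`). -/
abbrev L2 : Type := Lp ℝ 2 (volume : Measure I)

theorem integrable_kernel_mul {K : I → I → ℝ} (hK : Continuous (Function.uncurry K))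
    (x : I) (f : L2) : Integrable (fun y => K x y * f y) := by
  have hKx : Continuous (K x) := hK.comp (Continuous.prodMk_right x)
  obtain ⟨C, hC⟩ := isCompact_univ.exists_bound_of_continuousOn hKx.continuousOn
  exact ((Lp.memLp f).integrable (by norm_num)).bdd_mul hKx.aestronglyMeasurable
    (ae_of_all _ fun y => hC y (Set.mem_univ y))

theorem memLp_kernel_integral {K : I → I → ℝ} (hK : Continuous (Function.uncurry K)) (f : L2) :
    MemLp (fun x => ∫ y, K x y * f y) 2 (volume : Measure I) := by
  obtain ⟨C, hC⟩ := isCompact_univ.exists_bound_of_continuousOn hK.continuousOn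
  have hf : Integrable (fun y => f y) (volume : Measure I) :=
    (Lp.memLp f).integrable (by norm_num)
  have hb : ∀ x y, ‖K x y * f y‖ ≤ C * ‖f y‖ := fun x y => by
    rw [norm_mul]
    exact mul_le_mul_of_nonneg_right (hC (x, y) (Set.mem_univ _)) (norm_nonneg _)
  have hcont : Continuous fun x => ∫ y, K x y * f y := by
    refine MeasureTheory.continuous_of_dominated (bound := fun y => C * ‖f y‖)
      (fun x => (integrable_kernel_mul hK x f).aestronglyMeasurable)
      (fun x => ae_of_all _ (hb x)) (hf.norm.const_mul C) (ae_of_all _ fun y => ?_)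
    exact (hK.comp (Continuous.prodMk_left y)).mul continuous_const
  obtain ⟨D, hD⟩ := isCompact_univ.exists_bound_of_continuousOn hcont.continuousOn
  exact MemLp.of_bound hcont.aestronglyMeasurable D (ae_of_all _ fun x => hD x (Set.mem_univ x))

/-- The integral operator `(T_K f)(x) = ∫ K(x, y) f(y) dy` on `L²[0,1]`. -/
def kernelOp (K : I → I → ℝ) (hK : Continuous (Function.uncurry K)) : Module.End ℝ L2 where
  toFun f := (memLp_kernel_integral hK f).toLp _
  map_add' f g := by
    rw [← MemLp.toLp_add]
    refine MemLp.toLp_congr _ _ (ae_of_all _ fun x => ?_)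
    simp only [Pi.add_apply]
    rw [← integral_add (integrable_kernel_mul hK x f) (integrable_kernel_mul hK x g)]
    refine integral_congr_ae ?_
    filter_upwards [Lp.coeFn_add f g] with y hy
    simp only [hy, Pi.add_apply, mul_add]
  map_smul' c f := by
    rw [RingHom.id_apply, ← MemLp.toLp_const_smul]
    refine MemLp.toLp_congr _ _ (ae_of_all _ fun x => ?_)
    simp only [Pi.smul_apply, smul_eq_mul]
    rw [← integral_const_mul]
    refine integral_congr_ae ?_
    filter_upwards [Lp.coeFn_smul c f] with y hy
    simp only [hy, Pi.smul_apply, smul_eq_mul]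
    ring

/-- For `j ≥ 1`, the `j`-th largest nonnegative eigenvalue `λ_j`, counted with multiplicity:
the supremum of the `t > 0` such that at least `j` eigenvalues (with multiplicity) are `≥ t`.
When there are fewer than `j` positive eigenvalues, the set is empty and the value is `0`, which
is the usual convention `λ_1 ≥ λ_2 ≥ ⋯ ≥ 0` for compact operators. -/
def posEigenvalue (T : Module.End ℝ L2) (j : ℕ) : ℝ :=
  sSup {t : ℝ | 0 < t ∧
    j ≤ Module.finrank ℝ (⨆ μ ∈ Set.Ici t, T.eigenspace μ : Submodule ℝ L2)}

/-- Index set of the nonzero eigenvalues different from `λ_1`, repeated according to multiplicity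
(the eigenvalue `0` contributes nothing to the sums below). -/
abbrev OtherEig (T : Module.End ℝ L2) : Type :=
  Σ μ : {μ : ℝ // T.HasEigenvalue μ ∧ μ ≠ 0 ∧ μ ≠ posEigenvalue T 1},
    Fin (Module.finrank ℝ (T.eigenspace (μ : ℝ)))

/-- The eigenvalue carried by an index. -/
def OtherEig.val {T : Module.End ℝ L2} (i : OtherEig T) : ℝ := i.1

/-- An element of `L²[0,1]` is almost everywhere constant. -/
def IsAEConst (φ : L2) : Prop := ∃ c : ℝ, ∀ᵐ x : I, φ x = c

/-- The kernel matrix: `K(u_i, u_j)` off the diagonal and `0` on the diagonal. -/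
def kernelMatrix (K : I → I → ℝ) {n : ℕ} (u : Fin n → I) : Matrix (Fin n) (Fin n) ℝ :=
  Matrix.of fun i j => if i = j then 0 else K (u i) (u j)

/-- The largest (real) eigenvalue of a matrix. -/
def maxEigenvalue {n : ℕ} (M : Matrix (Fin n) (Fin n) ℝ) : ℝ := sSup (spectrum ℝ M)

/-- The (possibly infinite) series `∑ X i` of random variables converges in `L²(P)` to `S`,
unconditionally, i.e. along the net of finite partial sums. -/
def HasL2Sum {Ω ι : Type*} [MeasurableSpace Ω] (P : Measure Ω) (X : ι → Ω → ℝ) (S : Ω → ℝ) :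
    Prop :=
  MemLp S 2 P ∧
    Tendsto (fun s : Finset ι => eLpNorm (fun ω => ∑ i ∈ s, X i ω - S ω) 2 P) atTop (𝓝 0)

end RandomKernel

end

/-!
The kernel expands in `L²` as `K = lam • φ ⊗ φ + ∑ k, val k • e k ⊗ e k`, where `lam` is the top
eigenvalue, every `val k` is at most some `m < lam`, and the eigenfunctions are continuous
(`EigenExpansion`). Such an expansion exists because the integral operator is symmetric and, by
Arzelà–Ascoli, compact (`isCompactOperator_kernelCLM`), and because a gap between its first two
positive eigenvalues makes the top one simple (`exists_eigenExpansion`).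

At a uniform sample `U 0, …, U (n - 1)`, the vectors `(φ (U i))` and `(e k (U i))` are almost
orthogonal with squared norm about `n`, so with high probability the quadratic form of the kernel
matrix is at most `n * m'`, with `m' < lam`, away from the direction `(φ (U i))`
(`EigenExpansion.whp_inner_kernelLin_le`). Under such a gap, the top eigenvalue lies above the
Rayleigh quotient of an approximate eigenvector by at most a quantity quadratic in the residual
(`IsTop.bounds`). Both limit theorems follow by choosing the approximate eigenvector and computing
its Rayleigh quotient.

With the vector `(φ (U i))` itself, Hoeffding's decomposition writes the Rayleigh quotient as
`lam * ∑ i, φ (U i) ^ 2` plus a degenerate `U`-statistic, which after division by `n` is bounded in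
probability, and the residual contributes only a bounded term as well. The central limit theorem for
`φ (U i) ^ 2` then gives the Gaussian limit (`EigenExpansion.tendstoInDistribution_of_general`).

If `φ` is constant, then `φ ^ 2 = 1` and this first-order term is deterministic, so the next order
decides. With `c k = val k / (lam - val k)` and `z k = n ^ (-1 / 2) * ∑ i, φ (U i) * e k (U i)`, the
vector `(φ (U i)) + ∑ k, c k * z k * n ^ (-1 / 2) • (e k (U i))` solves the eigenvalue equation up
to a smaller residual (`exists_approx_eigenvector`), and the top eigenvalue becomes
`lam * (n - 1) + ∑ k, (lam * c k * z k ^ 2 - val k)`. Since the `z k` are jointly asymptotically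
independent standard Gaussian, and `lam * c k - val k = val k ^ 2 / (lam - val k)`, this is the
stated limit. The computation is made for finitely many `k`. The error of the truncation is
controlled in mean square, uniformly in `n`, by the tail of the expansion of `K`
(`EigenExpansion.exists_truncation_bound`), which tends to zero, so the truncated limits can be
summed (`tendstoInDistribution_of_approx`, `exists_hasL2Sum`,
`EigenExpansion.tendstoInDistribution_of_sq_eq_one`).
-/

set_option linter.unusedSectionVars false

namespace RandomKernel

open scoped RealInnerProductSpace

/-! ### Second moments of sums over independent samples -/

section Moments

variable {Ω 𝓧 𝓨 ι : Type*} [MeasurableSpace Ω] [MeasurableSpace 𝓧] [MeasurableSpace 𝓨]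
  {P : Measure Ω} [IsProbabilityMeasure P] {μ : Measure 𝓧} [IsProbabilityMeasure μ]

theorem integral_eq_zero_of_indepFun {X : Ω → 𝓧} {Y : Ω → 𝓨} (hX : HasLaw X μ P)
    (hY : AEMeasurable Y P) (hXY : IndepFun X Y P) {F : 𝓧 × 𝓨 → ℝ} (hF : Measurable F) {C : ℝ}
    (hC : ∀ p, |F p| ≤ C) (h0 : ∀ y, ∫ x, F (x, y) ∂μ = 0) :
    ∫ ω, F (X ω, Y ω) ∂P = 0 := by
  have hYl : HasLaw Y (P.map Y) P := ⟨hY, rfl⟩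
  have : IsProbabilityMeasure (P.map Y) := Measure.isProbabilityMeasure_map hY
  have hl := hXY.hasLaw_prod hX hYl
  have hint : Integrable F (μ.prod (P.map Y)) :=
    Integrable.of_bound hF.aestronglyMeasurable C (ae_of_all _ hC)
  have := hl.integral_comp (f := F) hF.aestronglyMeasurable
  simp only [Function.comp_def] at this
  rw [this, integral_prod_symm _ hint]
  simp [h0]

theorem integral_pair {X Y : Ω → 𝓧} (hX : HasLaw X μ P) (hY : HasLaw Y μ P)
    (hXY : IndepFun X Y P) {F : 𝓧 → 𝓧 → ℝ} (hF : Measurable (Function.uncurry F)) {C : ℝ}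
    (hC : ∀ x y, |F x y| ≤ C) :
    ∫ ω, F (X ω) (Y ω) ∂P = ∫ x, ∫ y, F x y ∂μ ∂μ := by
  have hl := hXY.hasLaw_prod hX hY
  have hint : Integrable (Function.uncurry F) (μ.prod μ) :=
    Integrable.of_bound hF.aestronglyMeasurable C (ae_of_all _ fun p => hC p.1 p.2)
  have := hl.integral_comp (f := Function.uncurry F) hF.aestronglyMeasurable
  simp only [Function.comp_def, Function.uncurry_apply_pair] at this
  rw [this, integral_prod _ hint]
  simp

variable [Fintype ι] [DecidableEq ι] {U : ι → Ω → 𝓧}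

/-- A product of two kernel values has mean zero when one sample point occurs only once and the
kernel is centred in the corresponding variable. -/
theorem integral_mul_eq_zero (hU : ∀ i, HasLaw (U i) μ P) (hind : iIndepFun U P)
    {H G : 𝓧 → 𝓧 → ℝ} (hH : Measurable (Function.uncurry H)) (hG : Measurable (Function.uncurry G))
    {C D : ℝ} (hC : ∀ x y, |H x y| ≤ C) (hD : ∀ x y, |G x y| ≤ D)
    (h0 : ∀ y, ∫ x, H x y ∂μ = 0) {i j k l : ι} (hij : i ≠ j) (hik : i ≠ k) (hil : i ≠ l) :
    ∫ ω, H (U i ω) (U j ω) * G (U k ω) (U l ω) ∂P = 0 := by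
  have hm : ∀ i, AEMeasurable (U i) P := fun i => (hU i).aemeasurable
  let T : Finset ι := {j, k, l}
  have hdisj : Disjoint ({i} : Finset ι) T := by simp [T, hij, hik, hil]
  have h1 := hind.indepFun_finset₀ {i} T hdisj hm
  have h2 := h1.comp (φ := fun f => f ⟨i, by simp⟩) (ψ := id)
    (show Measurable fun f : ({i} : Finset ι) → 𝓧 => f ⟨i, by simp⟩ from measurable_pi_apply _)
    measurable_id
  have hj : j ∈ T := by simp [T]
  have hk : k ∈ T := by simp [T]
  have hl : l ∈ T := by simp [T]
  have hC0 : 0 ≤ C := by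
    obtain ⟨ω⟩ := P.nonempty_of_neZero
    exact (abs_nonneg _).trans (hC (U i ω) (U i ω))
  refine integral_eq_zero_of_indepFun (F := fun p : 𝓧 × (T → 𝓧) =>
    H p.1 (p.2 ⟨j, hj⟩) * G (p.2 ⟨k, hk⟩) (p.2 ⟨l, hl⟩)) (Y := fun ω (t : T) => U t ω)
    (C := C * D) (hU i) (by fun_prop) h2 ?_ ?_ ?_
  · refine Measurable.mul ?_ ?_
    · exact hH.comp (f := fun p : 𝓧 × (T → 𝓧) => (p.1, p.2 ⟨j, hj⟩)) (by fun_prop)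
    · exact hG.comp (f := fun p : 𝓧 × (T → 𝓧) => (p.2 ⟨k, hk⟩, p.2 ⟨l, hl⟩)) (by fun_prop)
  · intro p
    rw [abs_mul]
    exact mul_le_mul (hC _ _) (hD _ _) (abs_nonneg _) hC0
  · intro y
    simp [integral_mul_const, h0]

theorem aemeasurable_comp₂ (hU : ∀ i, HasLaw (U i) μ P) {H : 𝓧 → 𝓧 → ℝ}
    (hH : Measurable (Function.uncurry H)) (i j : ι) :
    AEMeasurable (fun ω => H (U i ω) (U j ω)) P :=
  hH.comp_aemeasurable ((hU i).aemeasurable.prodMk (hU j).aemeasurable)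

theorem integrable_comp₂_mul (hU : ∀ i, HasLaw (U i) μ P) {H G : 𝓧 → 𝓧 → ℝ}
    (hH : Measurable (Function.uncurry H)) (hG : Measurable (Function.uncurry G))
    {C D : ℝ} (hC : ∀ x y, |H x y| ≤ C) (hD : ∀ x y, |G x y| ≤ D) (i j k l : ι) :
    Integrable (fun ω => H (U i ω) (U j ω) * G (U k ω) (U l ω)) P := by
  refine Integrable.of_bound ((aemeasurable_comp₂ hU hH i j).mul
    (aemeasurable_comp₂ hU hG k l)).aestronglyMeasurable (C * D) (ae_of_all _ fun ω => ?_)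
  rw [Real.norm_eq_abs, abs_mul]
  exact mul_le_mul (hC _ _) (hD _ _) (abs_nonneg _)
    ((abs_nonneg _).trans (hC (U i ω) (U i ω)))

/-- The sum over one free index of a kernel centred in that index. -/
theorem integral_sq_row_sum_le (hU : ∀ i, HasLaw (U i) μ P) (hind : iIndepFun U P)
    {H : 𝓧 → 𝓧 → ℝ} (hH : Measurable (Function.uncurry H)) {C : ℝ} (hC : ∀ x y, |H x y| ≤ C)
    (h0 : ∀ x, ∫ y, H x y ∂μ = 0) (i : ι) :
    ∫ ω, (∑ j, if i = j then 0 else H (U i ω) (U j ω)) ^ 2 ∂P ≤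
      Fintype.card ι * ∫ x, ∫ y, H x y ^ 2 ∂μ ∂μ := by
  have hH' : Measurable (Function.uncurry fun x y => H y x) := hH.comp measurable_swap
  have hC' : ∀ x y, |H y x| ≤ C := fun x y => hC y x
  have key : ∀ j k, ∫ ω, (if i = j then 0 else H (U i ω) (U j ω)) *
      (if i = k then 0 else H (U i ω) (U k ω)) ∂P ≤
      if j = k then ∫ x, ∫ y, H x y ^ 2 ∂μ ∂μ else 0 := by
    intro j k
    have hnn : 0 ≤ ∫ x, ∫ y, H x y ^ 2 ∂μ ∂μ :=
      integral_nonneg fun x => integral_nonneg fun y => sq_nonneg _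
    by_cases hij : i = j
    · simp only [hij, if_true, zero_mul, integral_zero]; split_ifs <;> simp [hnn]
    by_cases hik : i = k
    · simp only [hik, if_true, mul_zero, integral_zero]; split_ifs <;> simp [hnn]
    simp only [hij, hik, if_false]
    split_ifs with hjk
    · subst hjk
      have := integral_pair (hU i) (hU j) (hind.indepFun hij) (F := fun x y => H x y ^ 2)
        (hH.pow_const 2) (C := C ^ 2) (fun x y => by
          rw [abs_pow]; exact pow_le_pow_left₀ (abs_nonneg _) (hC x y) 2)
      simp only [← pow_two, this, le_refl]
    · exact (integral_mul_eq_zero hU hind hH' hH hC' hC h0 (Ne.symm hij) (Ne.symm hij) hjk).le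
  have hint : ∀ j k, Integrable (fun ω => (if i = j then 0 else H (U i ω) (U j ω)) *
      (if i = k then 0 else H (U i ω) (U k ω))) P := by
    intro j k
    by_cases hij : i = j
    · simp [hij]
    by_cases hik : i = k
    · simp [hik]
    simpa only [hij, hik, if_false] using integrable_comp₂_mul hU hH hH hC hC i j i k
  simp only [pow_two (Finset.sum _ _), Finset.sum_mul_sum]
  rw [integral_finsetSum _ fun j _ => integrable_finsetSum _ fun k _ => hint j k]
  calc _ = ∑ j, ∑ k, ∫ ω, (if i = j then 0 else H (U i ω) (U j ω)) *
      (if i = k then 0 else H (U i ω) (U k ω)) ∂P :=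
        Finset.sum_congr rfl fun j _ => integral_finsetSum _ fun k _ => hint j k
    _ ≤ ∑ j : ι, ∑ k : ι, if j = k then ∫ x, ∫ y, H x y ^ 2 ∂μ ∂μ else 0 :=
        Finset.sum_le_sum fun j _ => Finset.sum_le_sum fun k _ => key j k
    _ = _ := by simp

/-- Second moment of a degenerate `U`-statistic: for a kernel centred in both variables only the
products over equal or transposed pairs of indices survive. -/
theorem integral_sq_offDiag_sum_le (hU : ∀ i, HasLaw (U i) μ P) (hind : iIndepFun U P)
    {H : 𝓧 → 𝓧 → ℝ} (hH : Measurable (Function.uncurry H)) {C : ℝ} (hC : ∀ x y, |H x y| ≤ C)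
    (h0 : ∀ x, ∫ y, H x y ∂μ = 0) (h0' : ∀ y, ∫ x, H x y ∂μ = 0) :
    ∫ ω, (∑ i, ∑ j, if i = j then 0 else H (U i ω) (U j ω)) ^ 2 ∂P ≤
      2 * (Fintype.card ι : ℝ) ^ 2 * ∫ x, ∫ y, H x y ^ 2 ∂μ ∂μ := by
  have hH' : Measurable (Function.uncurry fun x y => H y x) := hH.comp measurable_swap
  have hC' : ∀ x y, |H y x| ≤ C := fun x y => hC y x
  set h := ∫ x, ∫ y, H x y ^ 2 ∂μ ∂μ with hh
  have hnn : 0 ≤ h := integral_nonneg fun x => integral_nonneg fun y => sq_nonneg _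
  have hsq : ∀ i j, i ≠ j → ∫ ω, H (U i ω) (U j ω) * H (U i ω) (U j ω) ∂P = h := by
    intro i j hij
    have := integral_pair (hU i) (hU j) (hind.indepFun hij) (F := fun x y => H x y ^ 2)
      (hH.pow_const 2) (C := C ^ 2) (fun x y => by
        rw [abs_pow]; exact pow_le_pow_left₀ (abs_nonneg _) (hC x y) 2)
    simp only [← pow_two, this, hh]
  let Y : ι × ι → Ω → ℝ := fun p ω => if p.1 = p.2 then 0 else H (U p.1 ω) (U p.2 ω)
  have hYint : ∀ p q, Integrable (fun ω => Y p ω * Y q ω) P := by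
    intro p q
    simp only [Y]
    by_cases hp : p.1 = p.2
    · simp [hp]
    by_cases hq : q.1 = q.2
    · simp [hq]
    simpa only [hp, hq, if_false] using integrable_comp₂_mul hU hH hH hC hC p.1 p.2 q.1 q.2
  have key : ∀ p q, ∫ ω, Y p ω * Y q ω ∂P ≤
      (if p = q then h else 0) + if p.swap = q then h else 0 := by
    rintro ⟨i, j⟩ ⟨k, l⟩
    have hR : 0 ≤ (if (i, j) = (k, l) then h else 0) +
        if (i, j).swap = (k, l) then h else 0 := by
      split_ifs <;> simp [hnn]
    by_cases hij : i = j
    · simpa [Y, hij] using hR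
    by_cases hkl : k = l
    · simpa [Y, hkl] using hR
    simp only [Y, hij, hkl, if_false, Prod.swap_prod_mk, Prod.mk.injEq] at hR ⊢
    by_cases h1 : i = k ∧ j = l
    · obtain ⟨rfl, rfl⟩ := h1
      rw [hsq i j hij]
      simp [Ne.symm hij]
    by_cases h2 : j = k ∧ i = l
    · obtain ⟨rfl, rfl⟩ := h2
      have e1 := hsq i j hij
      have e2 := hsq j i (Ne.symm hij)
      have h3 : ∫ ω, H (U i ω) (U j ω) * H (U j ω) (U i ω) ∂P ≤
          ∫ ω, (H (U i ω) (U j ω) * H (U i ω) (U j ω) +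
            H (U j ω) (U i ω) * H (U j ω) (U i ω)) / 2 ∂P := by
        refine integral_mono (integrable_comp₂_mul hU hH hH hC hC _ _ _ _)
          (((integrable_comp₂_mul hU hH hH hC hC _ _ _ _).add
            (integrable_comp₂_mul hU hH hH hC hC _ _ _ _)).div_const 2) fun ω => ?_
        simp only
        nlinarith [sq_nonneg (H (U i ω) (U j ω) - H (U j ω) (U i ω))]
      rw [integral_div, integral_add (integrable_comp₂_mul hU hH hH hC hC _ _ _ _)
        (integrable_comp₂_mul hU hH hH hC hC _ _ _ _), e1, e2] at h3
      simp only [hij, Ne.symm hij, and_self, if_false, if_true]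
      linarith
    -- Some index of the first pair does not occur in the second one.
    have h0R : ∫ ω, H (U i ω) (U j ω) * H (U k ω) (U l ω) ∂P = 0 := by
      by_cases h3 : i = k ∨ i = l
      · have hjk : j ≠ k ∧ j ≠ l := by
          rcases h3 with rfl | rfl
          · exact ⟨Ne.symm hij, fun h => h1 ⟨rfl, h⟩⟩
          · exact ⟨fun h => h2 ⟨h, rfl⟩, Ne.symm hij⟩
        exact integral_mul_eq_zero hU hind hH' hH hC' hC h0 (Ne.symm hij) hjk.1 hjk.2
      · push Not at h3
        exact integral_mul_eq_zero hU hind hH hH hC hC h0' hij h3.1 h3.2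
    rw [h0R]
    exact hR
  have hsum : ∀ ω, (∑ i, ∑ j, if i = j then 0 else H (U i ω) (U j ω)) = ∑ p : ι × ι, Y p ω := by
    intro ω
    rw [Fintype.sum_prod_type]
  simp only [hsum, pow_two (Finset.sum _ _), Finset.sum_mul_sum]
  rw [integral_finsetSum _ fun j _ => integrable_finsetSum _ fun k _ => hYint j k]
  calc _ = ∑ p, ∑ q, ∫ ω, Y p ω * Y q ω ∂P :=
        Finset.sum_congr rfl fun j _ => integral_finsetSum _ fun k _ => hYint j k
    _ ≤ ∑ p : ι × ι, ∑ q : ι × ι, ((if p = q then h else 0) + if p.swap = q then h else 0) :=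
        Finset.sum_le_sum fun j _ => Finset.sum_le_sum fun k _ => key j k
    _ = _ := by
        simp [Finset.sum_add_distrib]
        ring

theorem integral_sq_sum (hU : ∀ i, HasLaw (U i) μ P) (hind : iIndepFun U P)
    {g : 𝓧 → ℝ} (hg : Measurable g) {C : ℝ} (hC : ∀ x, |g x| ≤ C) (h0 : ∫ x, g x ∂μ = 0) :
    ∫ ω, (∑ i, g (U i ω)) ^ 2 ∂P = Fintype.card ι * ∫ x, g x ^ 2 ∂μ := by
  have hint : ∀ j k, Integrable (fun ω => g (U j ω) * g (U k ω)) P := fun j k =>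
    integrable_comp₂_mul hU (H := fun x _ => g x) (G := fun x _ => g x) (hg.comp measurable_fst)
      (hg.comp measurable_fst) (fun x _ => hC x) (fun x _ => hC x) j j k k
  have key : ∀ j k, ∫ ω, g (U j ω) * g (U k ω) ∂P = if j = k then ∫ x, g x ^ 2 ∂μ else 0 := by
    intro j k
    split_ifs with hjk
    · subst hjk
      have := (hU j).integral_comp (f := fun x => g x ^ 2) (hg.pow_const 2).aestronglyMeasurable
      simpa [Function.comp_def, pow_two] using this
    · have h1 := (hind.indepFun hjk).comp hg hg
      have h2 := (hU j).integral_comp (f := g) hg.aestronglyMeasurable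
      have h3 := h1.integral_mul_eq_mul_integral
        (hg.comp_aemeasurable (hU j).aemeasurable).aestronglyMeasurable
        (hg.comp_aemeasurable (hU k).aemeasurable).aestronglyMeasurable
      rw [h2, h0, zero_mul] at h3
      simpa using h3
  simp only [pow_two (Finset.sum _ _), Finset.sum_mul_sum]
  rw [integral_finsetSum _ fun j _ => integrable_finsetSum _ fun k _ => hint j k]
  calc _ = ∑ j, ∑ k, ∫ ω, g (U j ω) * g (U k ω) ∂P :=
        Finset.sum_congr rfl fun j _ => integral_finsetSum _ fun k _ => hint j k
    _ = _ := by simp [key]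

end Moments

/-! ### Boundedness and convergence to zero in probability -/

section InProb

variable {Ω : Type*} [MeasurableSpace Ω] {P : Measure Ω} [IsProbabilityMeasure P]
  {X Y : ℕ → Ω → ℝ} {p q : ℕ → Ω → Prop}

/-- The events `p n` have probability tending to `1`. No measurability is required, the
exceptional sets being measured by the outer measure. -/
def WHP (P : Measure Ω) (p : ℕ → Ω → Prop) : Prop :=
  ∀ ε : ℝ, 0 < ε → ∀ᶠ n in atTop, P {ω | ¬ p n ω} ≤ ENNReal.ofReal ε

/-- `X n` is bounded in probability, that is, `X n = O_P(1)`. -/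
def BddInProb (P : Measure Ω) (X : ℕ → Ω → ℝ) : Prop :=
  ∀ ε : ℝ, 0 < ε → ∃ C : ℝ, ∀ᶠ n in atTop, P {ω | C < |X n ω|} ≤ ENNReal.ofReal ε

/-- `X n` tends to zero in probability, that is, `X n = o_P(1)`; one parameter serves for both the
size and the probability. -/
def NullInProb (P : Measure Ω) (X : ℕ → Ω → ℝ) : Prop :=
  ∀ ε : ℝ, 0 < ε → ∀ᶠ n in atTop, P {ω | ε ≤ |X n ω|} ≤ ENNReal.ofReal ε

theorem measure_le_add_of_imp {a b c : Ω → Prop} {x y : ℝ} (h : ∀ ω, a ω → b ω ∨ c ω)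
    (hx : 0 ≤ x) (hy : 0 ≤ y) (hb : P {ω | b ω} ≤ ENNReal.ofReal x)
    (hc : P {ω | c ω} ≤ ENNReal.ofReal y) : P {ω | a ω} ≤ ENNReal.ofReal (x + y) := by
  calc P {ω | a ω} ≤ P ({ω | b ω} ∪ {ω | c ω}) := measure_mono fun ω hω => h ω hω
    _ ≤ P {ω | b ω} + P {ω | c ω} := measure_union_le _ _
    _ ≤ ENNReal.ofReal x + ENNReal.ofReal y := add_le_add hb hc
    _ = _ := (ENNReal.ofReal_add hx hy).symm

theorem WHP.mono (hp : WHP P p) (h : ∀ n ω, p n ω → q n ω) : WHP P q := fun ε hε => by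
  filter_upwards [hp ε hε] with n hn
  exact (measure_mono fun ω (hω : ¬ q n ω) => show ¬ p n ω from fun h' => hω (h n ω h')).trans hn

theorem WHP.and (hp : WHP P p) (hq : WHP P q) : WHP P fun n ω => p n ω ∧ q n ω := fun ε hε => by
  filter_upwards [hp (ε / 2) (half_pos hε), hq (ε / 2) (half_pos hε)] with n h1 h2
  have := measure_le_add_of_imp (a := fun ω => ¬ (p n ω ∧ q n ω)) (fun ω hω => by tauto)
    (half_pos hε).le (half_pos hε).le h1 h2
  rwa [add_halves] at this

theorem WHP.of_eventually {r : ℕ → Prop} (h : ∀ᶠ n in atTop, r n) : WHP P fun n _ => r n :=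
  fun ε _ => by
    filter_upwards [h] with n hn
    simp [hn]

theorem NullInProb.whp_lt (hX : NullInProb P X) {ε : ℝ} (hε : 0 < ε) :
    WHP P fun n ω => |X n ω| < ε := fun δ hδ => by
  filter_upwards [hX (min ε δ) (lt_min hε hδ)] with n hn
  refine (measure_mono fun ω (hω : ¬ |X n ω| < ε) => ?_).trans
    (hn.trans (ENNReal.ofReal_le_ofReal (min_le_right _ _)))
  exact (min_le_left _ _).trans (not_lt.1 hω)

theorem nullInProb_iff_whp : NullInProb P X ↔ ∀ ε : ℝ, 0 < ε → WHP P fun n ω => |X n ω| < ε :=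
  ⟨fun h _ hε => h.whp_lt hε, fun h ε hε => by simpa only [not_lt] using h ε hε ε hε⟩

theorem NullInProb.mono_whp (hY : NullInProb P Y) (h : WHP P fun n ω => |X n ω| ≤ |Y n ω|) :
    NullInProb P X :=
  nullInProb_iff_whp.2 fun _ hε => (h.and (hY.whp_lt hε)).mono fun _ _ h => h.1.trans_lt h.2

theorem NullInProb.mono (hY : NullInProb P Y) (h : ∀ n ω, |X n ω| ≤ |Y n ω|) : NullInProb P X :=
  fun ε hε => by
    filter_upwards [hY ε hε] with n hn
    exact (measure_mono fun ω (hω : ε ≤ |X n ω|) => hω.trans (h n ω)).trans hn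

theorem NullInProb.add (hX : NullInProb P X) (hY : NullInProb P Y) :
    NullInProb P fun n ω => X n ω + Y n ω :=
  nullInProb_iff_whp.2 fun ε hε => ((hX.whp_lt (half_pos hε)).and (hY.whp_lt (half_pos hε))).mono
    fun n ω h => (abs_add_le _ _).trans_lt (by linarith [h.1, h.2])

theorem NullInProb.abs (hX : NullInProb P X) : NullInProb P fun n ω => |X n ω| :=
  hX.mono fun n ω => by simp

theorem NullInProb.of_tendsto {a : ℕ → ℝ} (ha : Tendsto a atTop (𝓝 0)) :
    NullInProb P fun n _ => a n := nullInProb_iff_whp.2 fun _ hε =>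
  WHP.of_eventually (((tendsto_zero_iff_abs_tendsto_zero a).1 ha).eventually_lt_const hε)

theorem NullInProb.zero : NullInProb P fun _ _ => 0 := .of_tendsto tendsto_const_nhds

theorem BddInProb.mono (hY : BddInProb P Y) (h : ∀ n ω, |X n ω| ≤ |Y n ω|) : BddInProb P X :=
  fun ε hε => by
    obtain ⟨C, hC⟩ := hY ε hε
    refine ⟨C, ?_⟩
    filter_upwards [hC] with n hn
    exact (measure_mono fun ω (hω : C < |X n ω|) => hω.trans_le (h n ω)).trans hn

theorem NullInProb.bdd (hX : NullInProb P X) : BddInProb P X := fun ε hε => by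
  refine ⟨ε, ?_⟩
  filter_upwards [hX ε hε] with n hn
  exact (measure_mono fun ω (hω : ε < |X n ω|) => hω.le).trans hn

theorem BddInProb.const (c : ℝ) : BddInProb P fun _ _ => c := fun ε _ =>
  ⟨|c|, Eventually.of_forall fun n => by simp⟩

theorem BddInProb.add (hX : BddInProb P X) (hY : BddInProb P Y) :
    BddInProb P fun n ω => X n ω + Y n ω := fun ε hε => by
  obtain ⟨C, hC⟩ := hX (ε / 2) (half_pos hε)
  obtain ⟨D, hD⟩ := hY (ε / 2) (half_pos hε)
  refine ⟨C + D, ?_⟩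
  filter_upwards [hC, hD] with n h1 h2
  have := measure_le_add_of_imp (a := fun ω => C + D < |X n ω + Y n ω|) (fun ω hω => by
    by_contra! h
    linarith [abs_add_le (X n ω) (Y n ω), h.1, h.2])
    (half_pos hε).le (half_pos hε).le h1 h2
  rwa [add_halves] at this

theorem BddInProb.mul (hX : BddInProb P X) (hY : BddInProb P Y) :
    BddInProb P fun n ω => X n ω * Y n ω := fun ε hε => by
  obtain ⟨C, hC⟩ := hX (ε / 2) (half_pos hε)
  obtain ⟨D, hD⟩ := hY (ε / 2) (half_pos hε)
  refine ⟨C * D, ?_⟩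
  filter_upwards [hC, hD] with n h1 h2
  have := measure_le_add_of_imp (a := fun ω => C * D < |X n ω * Y n ω|) (fun ω hω => by
    by_contra! h
    rw [abs_mul] at hω
    exact absurd (mul_le_mul h.1 h.2 (abs_nonneg _) ((abs_nonneg _).trans h.1)) (not_le.2 hω))
    (half_pos hε).le (half_pos hε).le h1 h2
  rwa [add_halves] at this

theorem NullInProb.mul_bdd (hX : NullInProb P X) (hY : BddInProb P Y) :
    NullInProb P fun n ω => X n ω * Y n ω := fun ε hε => by
  obtain ⟨D, hD⟩ := hY (ε / 2) (half_pos hε)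
  have hD' : 0 < |D| + 1 := by positivity
  filter_upwards [hD, hX.whp_lt (div_pos hε hD') (ε / 2) (half_pos hε)] with n h1 h2
  have := measure_le_add_of_imp (a := fun ω => ε ≤ |X n ω * Y n ω|) (fun ω hω => by
    by_contra! h
    obtain ⟨h3, h4⟩ := h
    rw [abs_mul] at hω
    have h5 : |Y n ω| ≤ |D| + 1 := by linarith [le_abs_self D]
    have h6 : |X n ω| * |Y n ω| ≤ |X n ω| * (|D| + 1) :=
      mul_le_mul_of_nonneg_left h5 (abs_nonneg _)
    rw [lt_div_iff₀ hD'] at h4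
    linarith)
    (half_pos hε).le (half_pos hε).le h1 h2
  rwa [add_halves] at this

theorem BddInProb.mul_null (hX : BddInProb P X) (hY : NullInProb P Y) :
    NullInProb P fun n ω => X n ω * Y n ω := by
  simpa only [mul_comm] using hY.mul_bdd hX

theorem NullInProb.const_mul (c : ℝ) (hX : NullInProb P X) : NullInProb P fun n ω => c * X n ω :=
  (BddInProb.const c).mul_null hX

theorem BddInProb.const_mul (c : ℝ) (hX : BddInProb P X) : BddInProb P fun n ω => c * X n ω :=
  (BddInProb.const c).mul hX

theorem BddInProb.neg (hX : BddInProb P X) : BddInProb P fun n ω => - X n ω :=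
  hX.mono fun n ω => by simp

theorem BddInProb.sub (hX : BddInProb P X) (hY : BddInProb P Y) :
    BddInProb P fun n ω => X n ω - Y n ω := by
  simpa only [sub_eq_add_neg] using hX.add hY.neg

theorem BddInProb.abs (hX : BddInProb P X) : BddInProb P fun n ω => |X n ω| :=
  hX.mono fun n ω => by simp

theorem BddInProb.pow_two (hX : BddInProb P X) : BddInProb P fun n ω => X n ω ^ 2 := by
  simpa only [_root_.pow_two] using hX.mul hX

theorem NullInProb.sum {κ : Type*} (s : Finset κ) {X : κ → ℕ → Ω → ℝ}
    (h : ∀ k ∈ s, NullInProb P (X k)) : NullInProb P fun n ω => ∑ k ∈ s, X k n ω := by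
  classical
  induction s using Finset.induction_on with
  | empty => simpa using NullInProb.zero
  | insert a s ha ih =>
    simp only [Finset.sum_insert ha]
    exact (h a (by simp)).add (ih fun k hk => h k (by simp [hk]))

theorem BddInProb.sum {κ : Type*} (s : Finset κ) {X : κ → ℕ → Ω → ℝ}
    (h : ∀ k ∈ s, BddInProb P (X k)) : BddInProb P fun n ω => ∑ k ∈ s, X k n ω := by
  classical
  induction s using Finset.induction_on with
  | empty => simpa using BddInProb.const 0
  | insert a s ha ih =>
    simp only [Finset.sum_insert ha]
    exact (h a (by simp)).add (ih fun k hk => h k (by simp [hk]))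

theorem measure_abs_ge_le {Z : Ω → ℝ} (hZ : Integrable (fun ω => Z ω ^ 2) P) {a ε : ℝ}
    (ha : ∫ ω, Z ω ^ 2 ∂P ≤ a) (hε : 0 < ε) :
    P {ω | ε ≤ |Z ω|} ≤ ENNReal.ofReal (a / ε ^ 2) := by
  have h := mul_meas_ge_le_integral_of_nonneg (μ := P) (f := fun ω => Z ω ^ 2)
    (ae_of_all _ fun ω => sq_nonneg _) hZ (ε ^ 2)
  have hset : {ω | ε ≤ |Z ω|} = {ω | ε ^ 2 ≤ Z ω ^ 2} := by
    ext ω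
    change ε ≤ |Z ω| ↔ ε ^ 2 ≤ Z ω ^ 2
    rw [sq_le_sq, abs_of_pos hε]
  rw [hset, ← ENNReal.ofReal_toReal (measure_ne_top P {ω | ε ^ 2 ≤ Z ω ^ 2})]
  refine ENNReal.ofReal_le_ofReal ?_
  rw [le_div_iff₀ (by positivity), mul_comm]
  exact h.trans ha

theorem BddInProb.of_integral_sq_le (hX : ∀ n, Integrable (fun ω => X n ω ^ 2) P) {a : ℝ}
    (ha : ∀ n, ∫ ω, X n ω ^ 2 ∂P ≤ a) : BddInProb P X := fun ε hε => by
  have ha0 : 0 ≤ a := (integral_nonneg fun ω => sq_nonneg _).trans (ha 0)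
  have hb : 0 < √((a + 1) / ε) := Real.sqrt_pos.2 (by positivity)
  refine ⟨√((a + 1) / ε), Eventually.of_forall fun n => ?_⟩
  refine (measure_mono fun ω (hω : _ < |X n ω|) => hω.le).trans
    ((measure_abs_ge_le (hX n) (ha n) hb).trans (ENNReal.ofReal_le_ofReal ?_))
  rw [Real.sq_sqrt (by positivity), div_le_iff₀ (by positivity)]
  field_simp
  linarith

/-- Convergence to zero in probability is convergence in measure. -/
theorem NullInProb.tendstoInMeasure (hX : NullInProb P X) : TendstoInMeasure P X atTop 0 := by
  rw [tendstoInMeasure_iff_norm]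
  intro ε hε
  rw [ENNReal.tendsto_nhds_zero]
  intro δ hδ
  by_cases htop : δ = ∞
  · simp [htop]
  filter_upwards [hX.whp_lt hε δ.toReal (ENNReal.toReal_pos hδ.ne' htop)] with n hn
  simpa [ENNReal.ofReal_toReal htop] using hn

end InProb

/-! ### The largest eigenvalue and approximate eigenvectors -/

section TopEigenvalue

variable {E : Type*} [NormedAddCommGroup E] [InnerProductSpace ℝ E]

/-- `Λ` is the maximum of the Rayleigh quotient of `A`. -/
def IsTop (A : E →ₗ[ℝ] E) (Λ : ℝ) : Prop :=
  (∀ w, ⟪w, A w⟫ ≤ Λ * ‖w‖ ^ 2) ∧ ∃ w, w ≠ 0 ∧ ⟪w, A w⟫ = Λ * ‖w‖ ^ 2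

/-- Two-sided bound for the top eigenvalue by the Rayleigh quotient `ρ` of an approximate
eigenvector `x`, when the quadratic form is at most `m < ρ` on the orthogonal complement of `x`.
The error is quadratic in the residual `A x - θ x`. -/
theorem IsTop.bounds {A : E →ₗ[ℝ] E} (hA : A.IsSymmetric) {Λ : ℝ} (h : IsTop A Λ) {x y : E}
    (hx : x ≠ 0) {θ ρ m : ℝ} (hy : A x = θ • x + y) (hρ : ρ = θ + ⟪x, y⟫ / ‖x‖ ^ 2)
    (hm : ∀ w, ⟪x, w⟫ = 0 → ⟪w, A w⟫ ≤ m * ‖w‖ ^ 2) (hmρ : m < ρ) :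
    ρ ≤ Λ ∧ Λ ≤ ρ + ‖y‖ ^ 2 / (‖x‖ ^ 2 * (ρ - m)) := by
  have hx2 : 0 < ‖x‖ ^ 2 := by positivity
  have hxAx : ⟪x, A x⟫ = ρ * ‖x‖ ^ 2 := by
    rw [hy, inner_add_right, inner_smul_right, real_inner_self_eq_norm_sq, hρ]
    field_simp
  refine ⟨?_, ?_⟩
  · have := h.1 x
    rw [hxAx] at this
    exact le_of_mul_le_mul_right this hx2
  -- Split a top eigenvector `v` into its component along `x` and the orthogonal component `w`.
  obtain ⟨v, hv0, hv⟩ := h.2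
  set a := ⟪x, v⟫ / ‖x‖ ^ 2 with ha
  set w := v - a • x with hw
  have hv' : v = a • x + w := by simp [hw]
  have hxw : ⟪x, w⟫ = 0 := by
    rw [hw, inner_sub_right, inner_smul_right, real_inner_self_eq_norm_sq, ha]
    field_simp
    simp
  have hwx : ⟪w, x⟫ = 0 := by rw [real_inner_comm, hxw]
  have hnorm : ‖v‖ ^ 2 = a ^ 2 * ‖x‖ ^ 2 + ‖w‖ ^ 2 := by
    rw [hv', ← real_inner_self_eq_norm_sq, inner_add_left, inner_add_right, inner_add_right,
      inner_smul_left, inner_smul_right, inner_smul_left, inner_smul_right, hxw, hwx,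
      real_inner_self_eq_norm_sq, real_inner_self_eq_norm_sq]
    simp only [conj_trivial]
    ring
  have hwAx : ⟪w, A x⟫ = ⟪w, y⟫ := by
    rw [hy, inner_add_right, inner_smul_right, hwx]; ring
  have hxAw : ⟪x, A w⟫ = ⟪w, y⟫ := by
    rw [← hA x w, real_inner_comm, hwAx]
  have hquad : ⟪v, A v⟫ = a ^ 2 * (ρ * ‖x‖ ^ 2) + 2 * a * ⟪w, y⟫ + ⟪w, A w⟫ := by
    rw [hv', map_add, map_smul, inner_add_left, inner_add_right, inner_add_right,
      inner_smul_left, inner_smul_right, inner_smul_left, inner_smul_right, hxAx, hwAx, hxAw]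
    simp only [conj_trivial]
    ring
  have hgap : 0 < ρ - m := sub_pos.2 hmρ
  -- The cross term is absorbed by the gap `ρ - m` available on `w`.
  have h1 : 2 * a * ⟪w, y⟫ ≤ a ^ 2 * ‖y‖ ^ 2 / (ρ - m) + (ρ - m) * ‖w‖ ^ 2 := by
    have h2 : 2 * a * ⟪w, y⟫ ≤ 2 * (|a| * ‖y‖) * ‖w‖ := by
      calc 2 * a * ⟪w, y⟫ ≤ |2 * a * ⟪w, y⟫| := le_abs_self _
        _ = 2 * |a| * |⟪w, y⟫| := by rw [abs_mul, abs_mul, abs_two]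
        _ ≤ 2 * |a| * (‖w‖ * ‖y‖) := by
            gcongr
            exact abs_real_inner_le_norm _ _
        _ = _ := by ring
    have h3 : 2 * (|a| * ‖y‖) * ‖w‖ ≤ (|a| * ‖y‖) ^ 2 / (ρ - m) + (ρ - m) * ‖w‖ ^ 2 := by
      rw [div_add' _ _ _ hgap.ne', le_div_iff₀ hgap]
      nlinarith [sq_nonneg (|a| * ‖y‖ - (ρ - m) * ‖w‖)]
    rw [mul_pow, sq_abs] at h3
    linarith
  have h4 : Λ * ‖v‖ ^ 2 ≤ (ρ + ‖y‖ ^ 2 / (‖x‖ ^ 2 * (ρ - m))) * ‖v‖ ^ 2 := by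
    rw [← hv, hquad, hnorm]
    have h5 := hm w hxw
    have h6 : (ρ + ‖y‖ ^ 2 / (‖x‖ ^ 2 * (ρ - m))) * (a ^ 2 * ‖x‖ ^ 2 + ‖w‖ ^ 2) =
        a ^ 2 * (ρ * ‖x‖ ^ 2) + a ^ 2 * ‖y‖ ^ 2 / (ρ - m) + ρ * ‖w‖ ^ 2 +
          ‖y‖ ^ 2 / (‖x‖ ^ 2 * (ρ - m)) * ‖w‖ ^ 2 := by
      field_simp
      ring
    have h7 : 0 ≤ ‖y‖ ^ 2 / (‖x‖ ^ 2 * (ρ - m)) * ‖w‖ ^ 2 := by positivity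
    rw [h6]
    linarith
  have hv2 : 0 < ‖v‖ ^ 2 := by positivity
  exact le_of_mul_le_mul_right h4 hv2

end TopEigenvalue

/-! ### The kernel matrix as an operator -/

section KernelMatrix

variable {n : ℕ}

/-- The kernel matrix as an operator on Euclidean space. -/
noncomputable def kernelLin (K : I → I → ℝ) (u : Fin n → I) :
    EuclideanSpace ℝ (Fin n) →ₗ[ℝ] EuclideanSpace ℝ (Fin n) :=
  Matrix.toEuclideanLin (kernelMatrix K u)

/-- The vector of values of a function at the sample points. -/
noncomputable def sampleVec (f : I → ℝ) (u : Fin n → I) : EuclideanSpace ℝ (Fin n) :=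
  WithLp.toLp 2 fun i => f (u i)

/-- Multiplication by the values of a function at the sample points. -/
noncomputable def diagLin (d : I → ℝ) (u : Fin n → I) :
    EuclideanSpace ℝ (Fin n) →ₗ[ℝ] EuclideanSpace ℝ (Fin n) :=
  Matrix.toEuclideanLin (Matrix.diagonal fun i => d (u i))

theorem kernelLin_apply (K : I → I → ℝ) (u : Fin n → I) (w : EuclideanSpace ℝ (Fin n)) (i : Fin n) :
    kernelLin K u w i = ∑ j, if i = j then 0 else K (u i) (u j) * w j := by
  simp [kernelLin, Matrix.toLpLin_apply, Matrix.mulVec, dotProduct, kernelMatrix, ite_mul]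

theorem diagLin_apply (d : I → ℝ) (u : Fin n → I) (w : EuclideanSpace ℝ (Fin n)) (i : Fin n) :
    diagLin d u w i = d (u i) * w i := by
  simp [diagLin, Matrix.toLpLin_apply, Matrix.mulVec_diagonal]

@[simp] theorem sampleVec_apply (f : I → ℝ) (u : Fin n → I) (i : Fin n) :
    sampleVec f u i = f (u i) := rfl

theorem inner_eq_sum (v w : EuclideanSpace ℝ (Fin n)) : ⟪v, w⟫ = ∑ i, v i * w i := by
  simp [PiLp.inner_apply, mul_comm]

theorem inner_kernelLin (K : I → I → ℝ) (u : Fin n → I) (v w : EuclideanSpace ℝ (Fin n)) :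
    ⟪v, kernelLin K u w⟫ = ∑ i, ∑ j, if i = j then 0 else K (u i) (u j) * v i * w j := by
  rw [inner_eq_sum]
  refine Finset.sum_congr rfl fun i _ => ?_
  rw [kernelLin_apply, Finset.mul_sum]
  refine Finset.sum_congr rfl fun j _ => ?_
  split_ifs <;> ring

theorem kernelMatrix_isHermitian {K : I → I → ℝ} (hK : ∀ x y, K x y = K y x) (u : Fin n → I) :
    (kernelMatrix K u).IsHermitian := by
  ext i j
  simp only [Matrix.conjTranspose_apply, kernelMatrix, Matrix.of_apply, star_trivial]
  by_cases h : i = j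
  · simp [h]
  · simp [h, Ne.symm h, hK (u j)]

theorem kernelLin_isSymmetric {K : I → I → ℝ} (hK : ∀ x y, K x y = K y x) (u : Fin n → I) :
    (kernelLin K u).IsSymmetric :=
  Matrix.isSymmetric_toEuclideanLin_iff.2 (kernelMatrix_isHermitian hK u)

/-- The supremum of the spectrum of a nonempty Hermitian matrix is the maximum of its Rayleigh
quotient. -/
theorem isTop_maxEigenvalue [NeZero n] {M : Matrix (Fin n) (Fin n) ℝ} (hM : M.IsHermitian) :
    IsTop (Matrix.toEuclideanLin M) (maxEigenvalue M) := by
  let b := hM.eigenvectorBasis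
  have hb : ∀ i, Matrix.toEuclideanLin M (b i) = hM.eigenvalues i • b i := fun i => by
    ext1
    simpa [Matrix.toLpLin_apply] using congrFun (hM.mulVec_eigenvectorBasis i) _
  have hmax : maxEigenvalue M = sSup (Set.range hM.eigenvalues) := by
    rw [maxEigenvalue, hM.spectrum_real_eq_range_eigenvalues]
  have hfin : (Set.range hM.eigenvalues).Finite := Set.finite_range _
  obtain ⟨i₀, hi₀⟩ : maxEigenvalue M ∈ Set.range hM.eigenvalues := by
    rw [hmax]
    exact (Set.range_nonempty _).csSup_mem hfin
  have hle : ∀ i, hM.eigenvalues i ≤ maxEigenvalue M := fun i => by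
    rw [hmax]
    exact le_csSup hfin.bddAbove ⟨i, rfl⟩
  have hsymm : (Matrix.toEuclideanLin M).IsSymmetric := Matrix.isSymmetric_toEuclideanLin_iff.2 hM
  refine ⟨fun w => ?_, b i₀, ?_, ?_⟩
  · rw [← b.sum_inner_mul_inner, ← b.sum_sq_norm_inner_right w, Finset.mul_sum]
    refine Finset.sum_le_sum fun i _ => ?_
    have : ⟪b i, Matrix.toEuclideanLin M w⟫ = hM.eigenvalues i * ⟪b i, w⟫ := by
      rw [← hsymm, hb, inner_smul_left]; simp
    rw [this, real_inner_comm, Real.norm_eq_abs, sq_abs]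
    nlinarith [hle i, sq_nonneg ⟪b i, w⟫]
  · exact b.orthonormal.ne_zero i₀
  · rw [hb, inner_smul_right, real_inner_self_eq_norm_sq, hi₀]

theorem maxEigenvalue_le_iff [NeZero n] {M : Matrix (Fin n) (Fin n) ℝ} (hM : M.IsHermitian)
    (c : ℝ) : maxEigenvalue M ≤ c ↔
      ∀ w : EuclideanSpace ℝ (Fin n), ⟪w, Matrix.toEuclideanLin M w⟫ ≤ c * ‖w‖ ^ 2 := by
  obtain ⟨h1, v, hv0, hv⟩ := isTop_maxEigenvalue hM
  refine ⟨fun h w => (h1 w).trans (by gcongr), fun h => ?_⟩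
  have h2 := h v
  rw [hv] at h2
  exact le_of_mul_le_mul_right h2 (by positivity)

theorem measurable_maxEigenvalue_kernelMatrix {K : I → I → ℝ}
    (hKm : Measurable (Function.uncurry K)) (hK : ∀ x y, K x y = K y x) (n : ℕ) :
    Measurable fun u : Fin n → I => maxEigenvalue (kernelMatrix K u) := by
  rcases Nat.eq_zero_or_pos n with rfl | hn
  · exact Subsingleton.measurable
  have : NeZero n := ⟨hn.ne'⟩
  refine measurable_of_Iic fun c => ?_
  have hmat : Measurable fun u : Fin n → I => (fun i j => kernelMatrix K u i j) := by
    refine measurable_pi_lambda _ fun i => measurable_pi_lambda _ fun j => ?_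
    by_cases h : i = j
    · simp [kernelMatrix, h]
    · simp only [kernelMatrix, Matrix.of_apply, h, if_false]
      exact hKm.comp (f := fun u : Fin n → I => (u i, u j)) (by fun_prop)
  -- The top eigenvalue is at most `c` on a closed set of matrices, cut out by linear conditions.
  let S : Set (Fin n → Fin n → ℝ) :=
    ⋂ w : EuclideanSpace ℝ (Fin n), {m | ∑ i, ∑ j, m i j * w i * w j ≤ c * ‖w‖ ^ 2}
  have hS : IsClosed S := isClosed_iInter fun w =>
    isClosed_le (by fun_prop) continuous_const
  convert! hmat hS.measurableSet using 1
  ext u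
  change maxEigenvalue (kernelMatrix K u) ≤ c ↔ (fun i j => kernelMatrix K u i j) ∈ S
  rw [maxEigenvalue_le_iff (kernelMatrix_isHermitian hK u), Set.mem_iInter]
  refine forall_congr' fun w => ?_
  change ⟪w, kernelLin K u w⟫ ≤ _ ↔ ∑ i, ∑ j, kernelMatrix K u i j * w i * w j ≤ c * ‖w‖ ^ 2
  rw [inner_kernelLin]
  simp [kernelMatrix, ite_mul]

theorem norm_sq_eq_sum (w : EuclideanSpace ℝ (Fin n)) : ‖w‖ ^ 2 = ∑ i, w i ^ 2 :=
  EuclideanSpace.real_norm_sq_eq w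

theorem norm_diagLin_le {d : I → ℝ} {C : ℝ} (hC : ∀ x, |d x| ≤ C) (u : Fin n → I)
    (w : EuclideanSpace ℝ (Fin n)) : ‖diagLin d u w‖ ≤ |C| * ‖w‖ := by
  refine (le_abs_self _).trans (abs_le_of_sq_le_sq ?_ (by positivity))
  rw [mul_pow, norm_sq_eq_sum, norm_sq_eq_sum, Finset.mul_sum]
  refine Finset.sum_le_sum fun i _ => ?_
  rw [diagLin_apply, mul_pow]
  exact mul_le_mul_of_nonneg_right
    (sq_le_sq.2 (by simpa using (hC (u i)).trans (le_abs_self C))) (sq_nonneg _)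

/-- The operator norm of a kernel matrix is at most its Frobenius norm. -/
theorem norm_kernelLin_sq_le (R : I → I → ℝ) (u : Fin n → I) (w : EuclideanSpace ℝ (Fin n)) :
    ‖kernelLin R u w‖ ^ 2 ≤
      (∑ i, ∑ j, if i = j then 0 else R (u i) (u j) ^ 2) * ‖w‖ ^ 2 := by
  rw [norm_sq_eq_sum, norm_sq_eq_sum w, Finset.sum_mul]
  refine Finset.sum_le_sum fun i _ => ?_
  rw [kernelLin_apply]
  have h1 := Finset.sum_mul_sq_le_sq_mul_sq Finset.univ
    (fun j => if i = j then 0 else R (u i) (u j)) (fun j => w j)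
  simpa [ite_mul, ite_pow] using h1

end KernelMatrix

/-! ### Statistics of the uniform sample -/

section Sample

variable {Ω : Type*} [MeasurableSpace Ω] {P : Measure Ω} [IsProbabilityMeasure P]
  {U : ℕ → Ω → I}

theorem exists_abs_le_of_continuous {Z : Type*} [TopologicalSpace Z] [CompactSpace Z] {f : Z → ℝ}
    (hf : Continuous f) : ∃ C, ∀ z, |f z| ≤ C := by
  obtain ⟨C, hC⟩ := isCompact_univ.exists_bound_of_continuousOn hf.continuousOn
  exact ⟨C, fun z => hC z (Set.mem_univ z)⟩

theorem integrable_continuous_sample (hU : ∀ i, HasLaw (U i) volume P) {n : ℕ}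
    {Ψ : (Fin n → I) → ℝ} (hΨ : Continuous Ψ) :
    Integrable (fun ω => Ψ fun i : Fin n => U i ω) P := by
  obtain ⟨C, hC⟩ := exists_abs_le_of_continuous hΨ
  refine Integrable.of_bound (hΨ.measurable.comp_aemeasurable ?_).aestronglyMeasurable C
    (ae_of_all _ fun ω => hC _)
  exact aemeasurable_pi_lambda _ fun i => (hU i).aemeasurable

theorem continuous_comp₂ {H : I → I → ℝ} (hH : Continuous (Function.uncurry H)) {n : ℕ}
    (i j : Fin n) : Continuous fun u : Fin n → I => H (u i) (u j) :=
  hH.comp (f := fun u : Fin n → I => (u i, u j)) (by fun_prop)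

theorem continuous_offDiag {H : I → I → ℝ} (hH : Continuous (Function.uncurry H)) {n : ℕ}
    (i j : Fin n) : Continuous fun u : Fin n → I => if i = j then 0 else H (u i) (u j) := by
  split_ifs
  · exact continuous_const
  · exact continuous_comp₂ hH i j

theorem bddInProb_sum_div_sqrt (hU : ∀ i, HasLaw (U i) volume P) (hind : iIndepFun U P)
    {g : I → ℝ} (hg : Continuous g) (h0 : ∫ x, g x = 0) :
    BddInProb P fun n ω => (∑ i : Fin n, g (U i ω)) / √(n : ℝ) := by
  obtain ⟨C, hC⟩ := exists_abs_le_of_continuous hg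
  refine BddInProb.of_integral_sq_le (a := ∫ x, g x ^ 2) (fun n => ?_) fun n => ?_
  · exact integrable_continuous_sample hU (n := n)
      (Ψ := fun u => ((∑ i, g (u i)) / √(n : ℝ)) ^ 2) (by fun_prop)
  · have := integral_sq_sum (U := fun i : Fin n => U i) (fun i => hU i)
      (hind.precomp Fin.val_injective) hg.measurable hC h0
    simp only [div_pow, Real.sq_sqrt (Nat.cast_nonneg n), integral_div, this, Fintype.card_fin]
    exact div_le_of_le_mul₀ (Nat.cast_nonneg _) (integral_nonneg fun x => sq_nonneg _)
      (mul_comm _ _).le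

theorem tendsto_inv_sqrt_natCast : Tendsto (fun n : ℕ => 1 / √(n : ℝ)) atTop (𝓝 0) :=
  tendsto_const_nhds.div_atTop (Real.tendsto_sqrt_atTop.comp tendsto_natCast_atTop_atTop)

theorem nullInProb_average (hU : ∀ i, HasLaw (U i) volume P) (hind : iIndepFun U P)
    {g : I → ℝ} (hg : Continuous g) :
    NullInProb P fun n ω => (∑ i : Fin n, g (U i ω)) / n - ∫ x, g x := by
  have hgi : Integrable g := by
    obtain ⟨C, hC⟩ := exists_abs_le_of_continuous hg
    exact Integrable.of_bound hg.aestronglyMeasurable C (ae_of_all _ hC)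
  have h1 := bddInProb_sum_div_sqrt hU hind (g := fun x => g x - ∫ y, g y) (by fun_prop)
    (by rw [integral_sub hgi (integrable_const _)]; simp)
  refine ((NullInProb.of_tendsto tendsto_inv_sqrt_natCast).mul_bdd h1).mono_whp
    (WHP.of_eventually ((eventually_gt_atTop 0).mono fun n hn => ?_) |>.mono
      (p := fun n _ => 0 < n) fun n ω hn => ?_)
  · exact hn
  · have hn' : (0 : ℝ) < n := by exact_mod_cast hn
    refine le_of_eq (congrArg _ ?_)
    rw [Finset.sum_sub_distrib, Finset.sum_const, Finset.card_univ, Fintype.card_fin, nsmul_eq_mul,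
      div_mul_div_comm, Real.mul_self_sqrt hn'.le]
    field_simp

/-- The normalised degenerate `U`-statistic of a continuous kernel. -/
theorem integral_sq_offDiag_div_le (hU : ∀ i, HasLaw (U i) volume P) (hind : iIndepFun U P)
    {H : I → I → ℝ} (hH : Continuous (Function.uncurry H)) (h0 : ∀ x, ∫ y, H x y = 0)
    (h0' : ∀ y, ∫ x, H x y = 0) (n : ℕ) :
    Integrable (fun ω => ((∑ i : Fin n, ∑ j : Fin n,
      if i = j then 0 else H (U i ω) (U j ω)) / n) ^ 2) P ∧
    ∫ ω, ((∑ i : Fin n, ∑ j : Fin n, if i = j then 0 else H (U i ω) (U j ω)) / n) ^ 2 ∂P ≤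
      2 * ∫ x, ∫ y, H x y ^ 2 := by
  obtain ⟨C, hC⟩ := exists_abs_le_of_continuous hH
  constructor
  · refine integrable_continuous_sample hU (n := n) (Ψ := fun u => ((∑ i, ∑ j,
      if i = j then 0 else H (u i) (u j)) / n) ^ 2) ?_
    exact ((continuous_finsetSum _ fun i _ => continuous_finsetSum _ fun j _ =>
      continuous_offDiag hH i j).div_const _).pow 2
  · have := integral_sq_offDiag_sum_le (U := fun i : Fin n => U i) (fun i => hU i)
      (hind.precomp Fin.val_injective) hH.measurable (fun x y => hC (x, y)) h0 h0'
    simp only [div_pow, integral_div]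
    refine div_le_of_le_mul₀ (by positivity) ?_ (this.trans_eq ?_)
    · exact mul_nonneg (by norm_num)
        (integral_nonneg fun x => integral_nonneg fun y => sq_nonneg _)
    · simp only [Fintype.card_fin]
      ring

theorem bddInProb_offDiag_div (hU : ∀ i, HasLaw (U i) volume P) (hind : iIndepFun U P)
    {H : I → I → ℝ} (hH : Continuous (Function.uncurry H)) (h0 : ∀ x, ∫ y, H x y = 0)
    (h0' : ∀ y, ∫ x, H x y = 0) :
    BddInProb P fun n ω => (∑ i : Fin n, ∑ j : Fin n,
      if i = j then 0 else H (U i ω) (U j ω)) / n :=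
  BddInProb.of_integral_sq_le (fun n => (integral_sq_offDiag_div_le hU hind hH h0 h0' n).1)
    fun n => (integral_sq_offDiag_div_le hU hind hH h0 h0' n).2

/-- Row sums of a kernel centred in the second variable, in mean square over the rows. -/
theorem integral_rowSum_sq_le (hU : ∀ i, HasLaw (U i) volume P) (hind : iIndepFun U P)
    {H : I → I → ℝ} (hH : Continuous (Function.uncurry H)) (h0 : ∀ x, ∫ y, H x y = 0) (n : ℕ) :
    Integrable (fun ω => (√(∑ i : Fin n, (∑ j : Fin n,
      if i = j then 0 else H (U i ω) (U j ω)) ^ 2) / n) ^ 2) P ∧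
    ∫ ω, (√(∑ i : Fin n, (∑ j : Fin n,
      if i = j then 0 else H (U i ω) (U j ω)) ^ 2) / n) ^ 2 ∂P ≤ ∫ x, ∫ y, H x y ^ 2 := by
  obtain ⟨C, hC⟩ := exists_abs_le_of_continuous hH
  have hrow : ∀ i : Fin n, Continuous fun u : Fin n → I => (∑ j : Fin n,
      if i = j then 0 else H (u i) (u j)) ^ 2 := fun i =>
    (continuous_finsetSum _ fun j _ => continuous_offDiag hH i j).pow 2
  have hsq : ∀ ω, (√(∑ i : Fin n, (∑ j : Fin n,
      if i = j then 0 else H (U i ω) (U j ω)) ^ 2) / n) ^ 2 = (∑ i : Fin n, (∑ j : Fin n,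
      if i = j then 0 else H (U i ω) (U j ω)) ^ 2) / (n : ℝ) ^ 2 := fun ω => by
    rw [div_pow, Real.sq_sqrt (Finset.sum_nonneg fun i _ => sq_nonneg _)]
  simp only [hsq]
  constructor
  · refine integrable_continuous_sample hU (n := n) (Ψ := fun u => (∑ i : Fin n, (∑ j : Fin n,
      if i = j then 0 else H (u i) (u j)) ^ 2) / (n : ℝ) ^ 2) ?_
    exact (continuous_finsetSum _ fun i _ => hrow i).div_const _
  · have h1 := fun i : Fin n => integral_sq_row_sum_le (U := fun i : Fin n => U i) (fun i => hU i)
      (hind.precomp Fin.val_injective) hH.measurable (fun x y => hC (x, y)) h0 i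
    rw [integral_div, integral_finsetSum _ fun i _ => integrable_continuous_sample hU (hrow i)]
    refine div_le_of_le_mul₀ (by positivity)
      (integral_nonneg fun x => integral_nonneg fun y => sq_nonneg _)
      ((Finset.sum_le_sum fun i _ => h1 i).trans_eq ?_)
    simp only [Fintype.card_fin, Finset.sum_const, Finset.card_univ, nsmul_eq_mul]
    ring

/-- The normalised Frobenius norm of a kernel matrix. -/
theorem integral_frobenius_sq_le (hU : ∀ i, HasLaw (U i) volume P) (hind : iIndepFun U P)
    {H : I → I → ℝ} (hH : Continuous (Function.uncurry H)) (n : ℕ) :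
    Integrable (fun ω => (√(∑ i : Fin n, ∑ j : Fin n,
      if i = j then 0 else H (U i ω) (U j ω) ^ 2) / n) ^ 2) P ∧
    ∫ ω, (√(∑ i : Fin n, ∑ j : Fin n,
      if i = j then 0 else H (U i ω) (U j ω) ^ 2) / n) ^ 2 ∂P ≤ ∫ x, ∫ y, H x y ^ 2 := by
  obtain ⟨C, hC⟩ := exists_abs_le_of_continuous hH
  have hH2 : Continuous (Function.uncurry fun x y => H x y ^ 2) := hH.pow 2
  have hnn : 0 ≤ ∫ x, ∫ y, H x y ^ 2 :=
    integral_nonneg fun x => integral_nonneg fun y => sq_nonneg _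
  have hsq : ∀ ω, (√(∑ i : Fin n, ∑ j : Fin n,
      if i = j then 0 else H (U i ω) (U j ω) ^ 2) / n) ^ 2 = (∑ i : Fin n, ∑ j : Fin n,
      if i = j then 0 else H (U i ω) (U j ω) ^ 2) / (n : ℝ) ^ 2 := fun ω => by
    rw [div_pow, Real.sq_sqrt (Finset.sum_nonneg fun i _ => Finset.sum_nonneg fun j _ => by
      split_ifs <;> positivity)]
  simp only [hsq]
  constructor
  · refine integrable_continuous_sample hU (n := n) (Ψ := fun u => (∑ i : Fin n, ∑ j : Fin n,
      if i = j then 0 else H (u i) (u j) ^ 2) / (n : ℝ) ^ 2) ?_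
    exact (continuous_finsetSum _ fun i _ => continuous_finsetSum _ fun j _ =>
      continuous_offDiag hH2 i j).div_const _
  · have hint : ∀ i j : Fin n, Integrable (fun ω =>
        if i = j then 0 else H (U i ω) (U j ω) ^ 2) P := fun i j =>
      integrable_continuous_sample hU (continuous_offDiag hH2 i j)
    have h1 : ∀ i j : Fin n, ∫ ω, (if i = j then 0 else H (U i ω) (U j ω) ^ 2) ∂P ≤
        ∫ x, ∫ y, H x y ^ 2 := by
      intro i j
      split_ifs with hij
      · simpa using hnn
      · obtain ⟨D, hD⟩ := exists_abs_le_of_continuous hH2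
        exact (integral_pair (hU i) (hU j)
          (hind.indepFun fun h => hij (Fin.ext h)) hH2.measurable fun x y => hD (x, y)).le
    rw [integral_div, integral_finsetSum _ fun i _ => integrable_finsetSum _ fun j _ => hint i j]
    refine div_le_of_le_mul₀ (by positivity) hnn ?_
    calc _ = ∑ i : Fin n, ∑ j : Fin n, ∫ ω, (if i = j then 0 else H (U i ω) (U j ω) ^ 2) ∂P :=
          Finset.sum_congr rfl fun i _ => integral_finsetSum _ fun j _ => hint i j
      _ ≤ ∑ i : Fin n, ∑ j : Fin n, ∫ x, ∫ y, H x y ^ 2 :=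
          Finset.sum_le_sum fun i _ => Finset.sum_le_sum fun j _ => h1 i j
      _ = _ := by
          simp only [Finset.sum_const, Finset.card_univ, nsmul_eq_mul, Fintype.card_fin]
          ring

theorem norm_kernelLin_sampleVec {n : ℕ} (R : I → I → ℝ) (f : I → ℝ) (u : Fin n → I) :
    ‖kernelLin R u (sampleVec f u)‖ = √(∑ i, (∑ j,
      if i = j then 0 else R (u i) (u j) * f (u j)) ^ 2) := by
  rw [← Real.sqrt_sq (norm_nonneg _), norm_sq_eq_sum]
  simp only [kernelLin_apply, sampleVec_apply]

theorem norm_sampleVec_sq {n : ℕ} (f : I → ℝ) (u : Fin n → I) :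
    ‖sampleVec f u‖ ^ 2 = ∑ i, f (u i) ^ 2 := by
  rw [norm_sq_eq_sum]; rfl

theorem inner_sampleVec {n : ℕ} (f g : I → ℝ) (u : Fin n → I) :
    ⟪sampleVec f u, sampleVec g u⟫ = ∑ i, f (u i) * g (u i) := by
  rw [inner_eq_sum]; rfl

end Sample

/-! ### Eigenfunction expansions and the spectral gap of the kernel matrix -/

section Expansion

variable {ι : Type*}

/-- The kernel minus the part of its eigenfunction expansion carried by `φ` and by `F`. -/
def remainder (K : I → I → ℝ) (lam : ℝ) (φ : I → ℝ) (val : ι → ℝ) (e : ι → I → ℝ) (F : Finset ι)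
    (x y : I) : ℝ :=
  K x y - lam * (φ x * φ y) - ∑ k ∈ F, val k * (e k x * e k y)

/-- `K` has the continuous orthonormal eigenfunctions `φ`, with eigenvalue `lam > 0`, and `e k`,
with eigenvalues `val k` that stay below `lam` by a positive amount, and the corresponding
expansion converges to `K` in mean square. The eigenvalue equations hold everywhere and not only
almost everywhere, so that they can be used at the sample points. -/
structure EigenExpansion (K : I → I → ℝ) (lam : ℝ) (φ : I → ℝ) (val : ι → ℝ) (e : ι → I → ℝ) :
    Prop where
  continuous_kernel : Continuous (Function.uncurry K)
  symm : ∀ x y, K x y = K y x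
  continuous_phi : Continuous φ
  continuous_eig : ∀ k, Continuous (e k)
  lam_pos : 0 < lam
  gap : ∃ m, 0 ≤ m ∧ m < lam ∧ ∀ k, val k ≤ m
  integral_phi : ∀ x, ∫ y, K x y * φ y = lam * φ x
  integral_eig : ∀ k x, ∫ y, K x y * e k y = val k * e k x
  integral_phi_sq : ∫ x, φ x ^ 2 = 1
  integral_phi_mul : ∀ k, ∫ x, φ x * e k x = 0
  integral_mul : ∀ k l, k ≠ l → ∫ x, e k x * e l x = 0
  integral_sq : ∀ k, ∫ x, e k x ^ 2 = 1
  tendsto_remainder :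
    Tendsto (fun F => ∫ x, ∫ y, remainder K lam φ val e F x y ^ 2) atTop (𝓝 0)

theorem integrable_of_continuous {f : I → ℝ} (hf : Continuous f) : Integrable f := by
  obtain ⟨C, hC⟩ := exists_abs_le_of_continuous hf
  exact Integrable.of_bound hf.aestronglyMeasurable C (ae_of_all _ hC)

/-- An almost orthogonal family satisfies an approximate Bessel inequality. -/
theorem sum_inner_sq_le {E : Type*} [NormedAddCommGroup E] [InnerProductSpace ℝ E] [DecidableEq ι]
    (F : Finset ι) (v : ι → E) (w : E) {N : ℝ} (hN : 0 < N) :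
    ∑ k ∈ F, ⟪v k, w⟫ ^ 2 ≤
      N * (1 + ∑ k ∈ F, ∑ l ∈ F, |⟪v k, v l⟫ / N - if k = l then 1 else 0|) * ‖w‖ ^ 2 := by
  set c : ι → ℝ := fun k => ⟪v k, w⟫ with hc
  set Q := ∑ k ∈ F, c k ^ 2 with hQ
  set D := ∑ k ∈ F, ∑ l ∈ F, |⟪v k, v l⟫ / N - if k = l then 1 else 0| with hD
  have hQ0 : 0 ≤ Q := Finset.sum_nonneg fun k _ => sq_nonneg _
  have hck : ∀ k ∈ F, c k ^ 2 ≤ Q := fun k hk =>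
    Finset.single_le_sum (f := fun k => c k ^ 2) (fun k _ => sq_nonneg _) hk
  have h1 : Q = ⟪∑ k ∈ F, c k • v k, w⟫ := by
    rw [sum_inner]
    refine Finset.sum_congr rfl fun k _ => ?_
    rw [inner_smul_left, pow_two]
    rfl
  have h2 : ‖∑ k ∈ F, c k • v k‖ ^ 2 ≤ N * (1 + D) * Q := by
    have h3 : ‖∑ k ∈ F, c k • v k‖ ^ 2 = N * (Q + ∑ k ∈ F, ∑ l ∈ F,
        c k * c l * (⟪v k, v l⟫ / N - if k = l then 1 else 0)) := by
      have h4 : Q = ∑ k ∈ F, ∑ l ∈ F, c k * c l * (if k = l then 1 else 0) := by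
        simp [hQ, pow_two]
      rw [← real_inner_self_eq_norm_sq, sum_inner]
      simp only [inner_sum, inner_smul_left, inner_smul_right, conj_trivial]
      rw [h4, ← Finset.sum_add_distrib, Finset.mul_sum]
      refine Finset.sum_congr rfl fun k _ => ?_
      rw [← Finset.sum_add_distrib, Finset.mul_sum]
      refine Finset.sum_congr rfl fun l _ => ?_
      field_simp
      ring
    rw [h3, mul_assoc]
    refine mul_le_mul_of_nonneg_left ?_ hN.le
    rw [add_mul, one_mul, hD, Finset.sum_mul]
    refine add_le_add le_rfl (Finset.sum_le_sum fun k hk => ?_)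
    rw [Finset.sum_mul]
    refine Finset.sum_le_sum fun l hl => (le_abs_self _).trans ?_
    rw [abs_mul, mul_comm]
    refine mul_le_mul_of_nonneg_left ?_ (abs_nonneg _)
    rw [abs_mul]
    nlinarith [hck k hk, hck l hl, sq_nonneg (|c k| - |c l|), sq_abs (c k), sq_abs (c l)]
  have h5 : Q ^ 2 ≤ N * (1 + D) * Q * ‖w‖ ^ 2 := by
    calc Q ^ 2 ≤ (‖∑ k ∈ F, c k • v k‖ * ‖w‖) ^ 2 := by
          refine pow_le_pow_left₀ hQ0 ?_ 2
          conv_lhs => rw [h1]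
          exact real_inner_le_norm _ _
      _ ≤ _ := by
          rw [mul_pow]
          exact mul_le_mul_of_nonneg_right h2 (sq_nonneg _)
  rcases hQ0.eq_or_lt with h | h
  · rw [← h]
    have : 0 ≤ D := Finset.sum_nonneg fun k _ => Finset.sum_nonneg fun l _ => abs_nonneg _
    positivity
  · exact le_of_mul_le_mul_right (by linarith) h

variable {n : ℕ}

theorem sum_offDiag_rankOne (f g : I → ℝ) (u : Fin n → I) (w : EuclideanSpace ℝ (Fin n))
    (i : Fin n) : ∑ j, (if i = j then 0 else f (u i) * g (u j) * w j) =
      ⟪sampleVec g u, w⟫ * f (u i) - f (u i) * g (u i) * w i := by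
  rw [inner_eq_sum, Finset.sum_mul, eq_sub_iff_add_eq]
  have : f (u i) * g (u i) * w i = ∑ j, if i = j then f (u i) * g (u j) * w j else 0 := by simp
  rw [this, ← Finset.sum_add_distrib]
  refine Finset.sum_congr rfl fun j _ => ?_
  rw [sampleVec_apply]
  split_ifs <;> ring

/-- The values on the diagonal of the finite part of the expansion. -/
def diagPart (lam : ℝ) (φ : I → ℝ) (val : ι → ℝ) (e : ι → I → ℝ) (F : Finset ι) (x : I) : ℝ :=
  lam * (φ x * φ x) + ∑ k ∈ F, val k * (e k x * e k x)

/-- A kernel matrix as a finite combination of rank-one operators, corrected on the diagonal, plus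
the kernel matrix of the remainder. -/
theorem kernelLin_eq (K : I → I → ℝ) (lam : ℝ) (φ : I → ℝ) (val : ι → ℝ) (e : ι → I → ℝ)
    (F : Finset ι) (u : Fin n → I) (w : EuclideanSpace ℝ (Fin n)) :
    kernelLin K u w = (lam * ⟪sampleVec φ u, w⟫) • sampleVec φ u +
      ∑ k ∈ F, (val k * ⟪sampleVec (e k) u, w⟫) • sampleVec (e k) u -
      diagLin (diagPart lam φ val e F) u w + kernelLin (remainder K lam φ val e F) u w := by
  ext i
  have h1 : ∀ j, (if i = j then 0 else K (u i) (u j) * w j) =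
      lam * (if i = j then 0 else φ (u i) * φ (u j) * w j) +
      ∑ k ∈ F, val k * (if i = j then 0 else e k (u i) * e k (u j) * w j) +
      if i = j then 0 else remainder K lam φ val e F (u i) (u j) * w j := by
    intro j
    split_ifs
    · simp
    · have : ∑ k ∈ F, val k * (e k (u i) * e k (u j) * w j) =
          (∑ k ∈ F, val k * (e k (u i) * e k (u j))) * w j := by
        rw [Finset.sum_mul]
        exact Finset.sum_congr rfl fun k _ => by ring
      rw [this, remainder]
      ring
  simp only [PiLp.add_apply, PiLp.sub_apply, PiLp.smul_apply, smul_eq_mul, WithLp.ofLp_sum,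
    Finset.sum_apply, kernelLin_apply, diagLin_apply, sampleVec_apply, WithLp.ofLp_smul,
    Pi.smul_apply]
  rw [Finset.sum_congr rfl fun j _ => h1 j, Finset.sum_add_distrib, Finset.sum_add_distrib,
    ← Finset.mul_sum, sum_offDiag_rankOne, Finset.sum_comm]
  simp only [← Finset.mul_sum, sum_offDiag_rankOne, diagPart]
  simp only [mul_sub, Finset.sum_sub_distrib, add_mul, Finset.sum_mul, ← mul_assoc]
  ring

namespace EigenExpansion

variable {K : I → I → ℝ} {lam : ℝ} {φ : I → ℝ} {val : ι → ℝ} {e : ι → I → ℝ}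

theorem continuous_remainder (h : EigenExpansion K lam φ val e) (F : Finset ι) :
    Continuous (Function.uncurry (remainder K lam φ val e F)) := by
  have h1 := h.continuous_kernel
  have h2 := h.continuous_phi
  have h3 := h.continuous_eig
  refine (h1.sub ?_).sub (continuous_finsetSum _ fun k _ => ?_)
  · exact continuous_const.mul ((h2.comp continuous_fst).mul (h2.comp continuous_snd))
  · exact continuous_const.mul (((h3 k).comp continuous_fst).mul ((h3 k).comp continuous_snd))

theorem continuous_diagPart (h : EigenExpansion K lam φ val e) (F : Finset ι) :
    Continuous (diagPart lam φ val e F) := by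
  have h2 := h.continuous_phi
  have h3 := h.continuous_eig
  unfold diagPart
  fun_prop

theorem remainder_symm (h : EigenExpansion K lam φ val e) (F : Finset ι) (x y : I) :
    remainder K lam φ val e F x y = remainder K lam φ val e F y x := by
  simp only [remainder, h.symm x y]
  congr 1
  · ring
  · exact Finset.sum_congr rfl fun k _ => by ring

/-- The remainder annihilates `φ` and the eigenfunctions that have been removed. -/
theorem integral_remainder_mul (h : EigenExpansion K lam φ val e) (F : Finset ι) {g : I → ℝ}
    (hg : Continuous g) (x : I) : ∫ y, remainder K lam φ val e F x y * g y =
      (∫ y, K x y * g y) - lam * φ x * (∫ y, φ y * g y) -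
        ∑ k ∈ F, val k * e k x * ∫ y, e k y * g y := by
  have hK : Continuous (K x) := h.continuous_kernel.comp (Continuous.prodMk_right x)
  have h2 := h.continuous_phi
  have h3 := h.continuous_eig
  have : ∀ y, remainder K lam φ val e F x y * g y = K x y * g y - lam * φ x * (φ y * g y) -
      ∑ k ∈ F, val k * e k x * (e k y * g y) := fun y => by
    rw [remainder, sub_mul, sub_mul, Finset.sum_mul]
    congr 1
    · ring
    · exact Finset.sum_congr rfl fun k _ => by ring
  simp only [this]
  rw [integral_sub, integral_sub, integral_finsetSum]
  · simp only [integral_const_mul]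
  all_goals first
    | exact integrable_of_continuous (by fun_prop)
    | exact fun k _ => integrable_of_continuous (by fun_prop)

theorem integral_remainder_phi (h : EigenExpansion K lam φ val e) (F : Finset ι) (x : I) :
    ∫ y, remainder K lam φ val e F x y * φ y = 0 := by
  rw [h.integral_remainder_mul F h.continuous_phi, h.integral_phi]
  have h1 : ∫ y, φ y * φ y = 1 := by simpa only [pow_two] using h.integral_phi_sq
  have h2 : ∀ k, ∫ y, e k y * φ y = 0 := fun k => by
    simpa only [mul_comm] using h.integral_phi_mul k
  simp [h1, h2]

theorem integral_remainder_eig (h : EigenExpansion K lam φ val e) (F : Finset ι) {k : ι}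
    (hk : k ∈ F) (x : I) : ∫ y, remainder K lam φ val e F x y * e k y = 0 := by
  classical
  rw [h.integral_remainder_mul F (h.continuous_eig k), h.integral_eig, h.integral_phi_mul,
    Finset.sum_eq_single_of_mem k hk fun l _ hl => by rw [h.integral_mul l k hl, mul_zero]]
  have h1 : ∫ y, e k y * e k y = 1 := by simpa only [pow_two] using h.integral_sq k
  simp [h1]

theorem integral_eig_mul [DecidableEq ι] (h : EigenExpansion K lam φ val e) (k l : ι) :
    ∫ x, e k x * e l x = if k = l then 1 else 0 := by
  split_ifs with hkl
  · subst hkl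
    simpa only [pow_two] using h.integral_sq k
  · exact h.integral_mul k l hkl

/-- The quadratic form of the kernel matrix, bounded by its `φ`-component plus a multiple of the
identity, in terms of the Gram matrix of the eigenvectors and of the Frobenius norm of the
remainder. -/
theorem inner_kernelLin_le [DecidableEq ι] (F : Finset ι)
    {m : ℝ} (hm0 : 0 ≤ m) (hm : ∀ k, val k ≤ m) {C : ℝ} (hC : ∀ x, |diagPart lam φ val e F x| ≤ C)
    (hn : 0 < n) (u : Fin n → I) (w : EuclideanSpace ℝ (Fin n)) :
    ⟪w, kernelLin K u w⟫ ≤ lam * ⟪sampleVec φ u, w⟫ ^ 2 +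
      n * (m * (1 + ∑ k ∈ F, ∑ l ∈ F, |⟪sampleVec (e k) u, sampleVec (e l) u⟫ / n -
        if k = l then 1 else 0|) + |C| / n +
        √(∑ i, ∑ j, if i = j then 0 else remainder K lam φ val e F (u i) (u j) ^ 2) / n) *
        ‖w‖ ^ 2 := by
  have hn' : (0 : ℝ) < n := by exact_mod_cast hn
  set f := √(∑ i, ∑ j, if i = j then 0 else remainder K lam φ val e F (u i) (u j) ^ 2) with hf
  have hb := sum_inner_sq_le F (fun k => sampleVec (e k) u) w hn'
  have h1 : ∑ k ∈ F, val k * ⟪sampleVec (e k) u, w⟫ ^ 2 ≤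
      m * ∑ k ∈ F, ⟪sampleVec (e k) u, w⟫ ^ 2 := by
    rw [Finset.mul_sum]
    exact Finset.sum_le_sum fun k _ => mul_le_mul_of_nonneg_right (hm k) (sq_nonneg _)
  have h2 : -⟪w, diagLin (diagPart lam φ val e F) u w⟫ ≤ |C| * ‖w‖ ^ 2 := by
    refine (neg_le_abs _).trans ((abs_real_inner_le_norm _ _).trans ?_)
    have := norm_diagLin_le hC u w
    nlinarith [norm_nonneg w]
  have h3 : ⟪w, kernelLin (remainder K lam φ val e F) u w⟫ ≤ f * ‖w‖ ^ 2 := by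
    refine (real_inner_le_norm _ _).trans ?_
    have h4 := norm_kernelLin_sq_le (remainder K lam φ val e F) u w
    have h5 : ‖kernelLin (remainder K lam φ val e F) u w‖ ≤ f * ‖w‖ := by
      refine (le_abs_self _).trans (abs_le_of_sq_le_sq ?_ (by positivity))
      rw [mul_pow, hf, Real.sq_sqrt (Finset.sum_nonneg fun i _ => Finset.sum_nonneg fun j _ => by
        split_ifs <;> positivity)]
      exact h4
    nlinarith [norm_nonneg w]
  have h6 : ⟪w, kernelLin K u w⟫ = lam * ⟪sampleVec φ u, w⟫ ^ 2 +
      ∑ k ∈ F, val k * ⟪sampleVec (e k) u, w⟫ ^ 2 -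
      ⟪w, diagLin (diagPart lam φ val e F) u w⟫ +
      ⟪w, kernelLin (remainder K lam φ val e F) u w⟫ := by
    rw [kernelLin_eq K lam φ val e F u w, inner_add_right, inner_sub_right, inner_add_right,
      inner_smul_right, inner_sum, real_inner_comm]
    congr 3
    · ring
    · refine Finset.sum_congr rfl fun k _ => ?_
      rw [inner_smul_right, real_inner_comm]
      ring
  rw [h6]
  set G := ∑ k ∈ F, ∑ l ∈ F, |⟪sampleVec (e k) u, sampleVec (e l) u⟫ / n -
    if k = l then 1 else 0| with hG
  have h7 : (n : ℝ) * (m * (1 + G) + |C| / n + f / n) * ‖w‖ ^ 2 =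
      m * (n * (1 + G) * ‖w‖ ^ 2) + |C| * ‖w‖ ^ 2 + f * ‖w‖ ^ 2 := by
    field_simp
  rw [h7]
  have := mul_le_mul_of_nonneg_left hb hm0
  linarith

variable {Ω : Type*} [MeasurableSpace Ω] {P : Measure Ω} [IsProbabilityMeasure P]
  {U : ℕ → Ω → I}

theorem nullInProb_gram [DecidableEq ι] (h : EigenExpansion K lam φ val e)
    (hU : ∀ i, HasLaw (U i) volume P) (hind : iIndepFun U P) (k l : ι) :
    NullInProb P fun n ω => ⟪sampleVec (e k) fun i : Fin n => U i ω,
      sampleVec (e l) fun i : Fin n => U i ω⟫ / n - if k = l then 1 else 0 := by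
  have := nullInProb_average hU hind ((h.continuous_eig k).mul (h.continuous_eig l))
  simpa only [inner_sampleVec, Pi.mul_apply, h.integral_eig_mul k l] using this

/-- With high probability the kernel matrix, outside the direction of `φ`, is bounded by `n * m`
with a constant `m < lam`. -/
theorem whp_inner_kernelLin_le (h : EigenExpansion K lam φ val e)
    (hU : ∀ i, HasLaw (U i) volume P) (hind : iIndepFun U P) :
    ∃ m, 0 ≤ m ∧ m < lam ∧ WHP P fun n ω => ∀ w : EuclideanSpace ℝ (Fin n),
      ⟪w, kernelLin K (fun i => U i ω) w⟫ ≤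
        lam * ⟪sampleVec φ fun i => U i ω, w⟫ ^ 2 + n * m * ‖w‖ ^ 2 := by
  classical
  obtain ⟨m, hm0, hmlam, hm⟩ := h.gap
  -- One `η` each for the Gram error, the diagonal and the Frobenius norm of the remainder; the
  -- fourth keeps the bound strictly below `lam`.
  set η := (lam - m) / 4 with hη
  have hη0 : 0 < η := by rw [hη]; linarith
  refine ⟨m + 3 * η, by positivity, by rw [hη]; linarith, fun ε hε => ?_⟩
  have hδ : 0 < ε / 2 * η ^ 2 := by positivity
  obtain ⟨F, hF⟩ := (h.tendsto_remainder.eventually (gt_mem_nhds hδ)).exists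
  obtain ⟨C, hC⟩ := exists_abs_le_of_continuous (h.continuous_diagPart F)
  have hg : NullInProb P fun n ω => m * ∑ k ∈ F, ∑ l ∈ F,
      |⟪sampleVec (e k) fun i : Fin n => U i ω, sampleVec (e l) fun i : Fin n => U i ω⟫ / n -
        if k = l then 1 else 0| :=
    (NullInProb.sum F fun k _ => NullInProb.sum F fun l _ =>
      (h.nullInProb_gram hU hind k l).abs).const_mul m
  have hd : NullInProb P fun (n : ℕ) (_ : Ω) => |C| / (n : ℝ) :=
    .of_tendsto (tendsto_const_nhds.div_atTop tendsto_natCast_atTop_atTop)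
  filter_upwards [((hg.whp_lt hη0).and (hd.whp_lt hη0)) (ε / 2) (half_pos hε),
    eventually_gt_atTop 0] with n hn1 hn0
  have hfrob := integral_frobenius_sq_le hU hind (h.continuous_remainder F) n
  have hn2 := measure_abs_ge_le hfrob.1 (hfrob.2.trans hF.le) hη0
  rw [mul_div_cancel_right₀ _ (by positivity : η ^ 2 ≠ 0)] at hn2
  have hfin := measure_le_add_of_imp (a := fun ω => ¬ ∀ w : EuclideanSpace ℝ (Fin n),
      ⟪w, kernelLin K (fun i => U i ω) w⟫ ≤
        lam * ⟪sampleVec φ fun i => U i ω, w⟫ ^ 2 + n * (m + 3 * η) * ‖w‖ ^ 2) (fun ω hω => by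
    by_contra! hcon
    obtain ⟨⟨h1, h2⟩, h3⟩ := hcon
    refine hω fun w => (inner_kernelLin_le F hm0 hm hC hn0 _ w).trans ?_
    have h1' := lt_of_abs_lt h1
    have h2' := lt_of_abs_lt h2
    have h3' := lt_of_abs_lt h3
    refine add_le_add le_rfl (mul_le_mul_of_nonneg_right
      (mul_le_mul_of_nonneg_left ?_ (Nat.cast_nonneg n)) (sq_nonneg ‖w‖))
    rw [mul_add, mul_one]
    linarith) (half_pos hε).le (half_pos hε).le hn1 hn2
  rwa [add_halves] at hfin

end EigenExpansion

end Expansion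

/-! ### Gaussian fluctuations for a general eigenfunction -/

/-- The fluctuation of the top eigenvalue at fixed sample points: `p` is the normalised square norm
of the sampled eigenfunction, `G` a centred quadratic statistic, and `Y` the normalised residual. -/
theorem abs_maxEigenvalue_sub_le {n : ℕ} [NeZero n] {K : I → I → ℝ} (hsymm : ∀ x y, K x y = K y x)
    {φ : I → ℝ} {lam m c : ℝ} (hlam : 0 < lam) (hc0 : 0 < c) (hmc : lam = m + 2 * c)
    {u : Fin n → I} {p d G Y e₁ : ℝ} (hp : ∑ i, φ (u i) ^ 2 = n * p) (hp2 : 1 / 2 < p)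
    (hdp : d = √(n : ℝ) * (p - 1))
    (hG : n * G = ∑ i, ∑ j, if i = j then 0 else
      (K (u i) (u j) * φ (u i) * φ (u j) - lam * φ (u i) ^ 2 - lam * φ (u j) ^ 2 + lam))
    (hY : ‖kernelLin K u (sampleVec φ u) - (((n : ℝ) - 1) * lam) • sampleVec φ u‖ = n * Y)
    (he₁ : e₁ = lam * (1 / √(n : ℝ)) + 2 * (1 / √(n : ℝ) * |G|) +
      2 * lam * (|d| * |p - 1|) + 2 * lam * (1 / (n : ℝ) * |d|))
    (he : 1 / √(n : ℝ) * (e₁ + lam * |d|) < c)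
    (hf : ∀ w : EuclideanSpace ℝ (Fin n), ⟪w, kernelLin K u w⟫ ≤
      lam * ⟪sampleVec φ u, w⟫ ^ 2 + n * m * ‖w‖ ^ 2) :
    |√(n : ℝ) * (maxEigenvalue (kernelMatrix K u) / n - lam) - lam * d| ≤
      e₁ + 2 / c * (1 / √(n : ℝ) * Y ^ 2) := by
  have hn : 0 < n := NeZero.pos n
  have hn' : (0 : ℝ) < n := by exact_mod_cast hn
  have hp0 : 0 < p := by linarith
  set s := √(n : ℝ) with hs
  have hs0 : 0 < s := Real.sqrt_pos.2 hn'
  have hss : s * s = n := Real.mul_self_sqrt hn'.le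
  set x := sampleVec φ u with hx
  set y := kernelLin K u x - (((n : ℝ) - 1) * lam) • x with hy
  have hxn : ‖x‖ ^ 2 = n * p := by
    rw [norm_sampleVec_sq, hp]
  have hx0 : x ≠ 0 := by
    intro h0
    rw [h0] at hxn
    have : (0 : ℝ) < n * p := mul_pos hn' hp0
    simp at hxn
    rcases hxn with h | h
    · exact hn.ne' h
    · linarith
  have hinner : ⟪x, y⟫ = n * G + lam * (n - 1) * n * (p - 1) := by
    -- Hoeffding decomposition of the quadratic form, with the diagonal left out.
    have h3 : ∀ i j : Fin n, (if i = j then 0 else K (u i) (u j) * x i * x j) =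
        (if i = j then 0 else (K (u i) (u j) * φ (u i) * φ (u j) - lam * φ (u i) ^ 2 -
          lam * φ (u j) ^ 2 + lam)) + (lam * φ (u i) ^ 2 + lam * φ (u j) ^ 2 - lam) -
        if i = j then lam * φ (u i) ^ 2 + lam * φ (u j) ^ 2 - lam else 0 := fun i j => by
      split_ifs
      · ring
      · simp only [hx, sampleVec_apply]
        ring
    rw [hy, inner_sub_right, inner_smul_right, real_inner_self_eq_norm_sq, hxn, inner_kernelLin]
    simp only [h3, Finset.sum_sub_distrib, Finset.sum_add_distrib, ← hG, Finset.sum_const,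
      Finset.card_univ, Fintype.card_fin, nsmul_eq_mul, ← Finset.mul_sum, hp, Finset.sum_ite_eq,
      Finset.mem_univ, if_true]
    ring
  -- The Rayleigh quotient of `x`.
  set ρ := ((n : ℝ) - 1) * lam + ⟪x, y⟫ / ‖x‖ ^ 2 with hρ
  have hpne : p ≠ 0 := hp0.ne'
  have hsne : s ≠ 0 := hs0.ne'
  have hρn : s * (ρ / n - lam) - lam * d = -(lam * (1 / s)) + 1 / s * G / p -
      lam * (d * (p - 1)) / p - lam * (1 / n * d) / p := by
    rw [hρ, hinner, hxn, hdp, ← hss]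
    field_simp
    ring
  have hinv : ∀ t : ℝ, |t / p| ≤ 2 * |t| := fun t => by
    rw [abs_div, abs_of_pos hp0, div_le_iff₀ hp0]
    nlinarith [abs_nonneg t]
  have hE1 : |s * (ρ / n - lam) - lam * d| ≤ e₁ := by
    have t1 := hinv (1 / s * G)
    have t2 := hinv (lam * (d * (p - 1)))
    have t3 := hinv (lam * (1 / n * d))
    simp only [abs_mul, abs_of_pos hlam, abs_of_pos (one_div_pos.2 hs0),
      abs_of_pos (one_div_pos.2 hn')] at t1 t2 t3
    have t4 : |-(lam * (1 / s))| = lam * (1 / s) := by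
      rw [abs_neg, abs_of_pos (by positivity)]
    rw [hρn, he₁]
    refine (abs_sub _ _).trans (add_le_add ((abs_sub _ _).trans (add_le_add
      ((abs_add_le _ _).trans (add_le_add t4.le t1)) (t2.trans_eq ?_))) (t3.trans_eq ?_)) <;> ring
  have hρ1 : |ρ / n - lam| < c := by
    have h6 : |ρ / n - lam| = 1 / s * |s * (ρ / n - lam)| := by
      rw [abs_mul, abs_of_pos hs0]
      field_simp
    refine lt_of_le_of_lt ?_ he
    rw [h6]
    refine mul_le_mul_of_nonneg_left ?_ (one_div_pos.2 hs0).le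
    have h7 : s * (ρ / n - lam) = (s * (ρ / n - lam) - lam * d) + lam * d := by ring
    rw [h7]
    refine (abs_add_le _ _).trans (add_le_add hE1 ?_)
    rw [abs_mul, abs_of_pos hlam]
  have hρ2 : n * c ≤ ρ - n * m := by
    have h8 := (abs_lt.1 hρ1).1
    have h9 : lam - c ≤ ρ / n := by linarith
    rw [le_div_iff₀ hn'] at h9
    rw [hmc] at h9
    linarith
  have hnc : 0 < (n : ℝ) * c := mul_pos hn' hc0
  have htop := isTop_maxEigenvalue (kernelMatrix_isHermitian hsymm u)
  obtain ⟨hlow, hup⟩ := IsTop.bounds (kernelLin_isSymmetric hsymm u) htop hx0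
    (y := y) (θ := ((n : ℝ) - 1) * lam) (ρ := ρ) (m := n * m) (by simp [hy]) hρ
    (fun w hw => by
      have := hf w
      rw [hw] at this
      simpa using this) (by linarith)
  set Λ := maxEigenvalue (kernelMatrix K u) with hΛ
  have hE2 : Λ - ρ ≤ n * (2 / c * (1 / n * Y ^ 2)) := by
    have h11 : ‖y‖ ^ 2 / (‖x‖ ^ 2 * (ρ - n * m)) ≤ ‖y‖ ^ 2 / (n * (1 / 2) * (n * c)) := by
      rw [hxn]
      gcongr
    have h12 : ‖y‖ ^ 2 / (n * (1 / 2) * (n * c)) = n * (2 / c * (1 / n * Y ^ 2)) := by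
      rw [hY]
      field_simp
    linarith
  have h13 : s * (Λ / n - lam) - lam * d =
      (s * (ρ / n - lam) - lam * d) + s * ((Λ - ρ) / n) := by ring
  rw [h13]
  refine (abs_add_le _ _).trans (add_le_add hE1 ?_)
  rw [abs_of_nonneg (mul_nonneg hs0.le (div_nonneg (sub_nonneg.2 hlow) hn'.le))]
  calc s * ((Λ - ρ) / n) ≤ s * (n * (2 / c * (1 / n * Y ^ 2)) / n) := by gcongr
    _ = 2 / c * (1 / s * Y ^ 2) := by
        rw [← hss]
        field_simp

namespace EigenExpansion

variable {ι : Type*} {K : I → I → ℝ} {lam : ℝ} {φ : I → ℝ} {val : ι → ℝ} {e : ι → I → ℝ}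

/-- The kernel `K x y * φ x * φ y` minus its projections onto functions of one variable is
centred. -/
theorem integral_centred_form (h : EigenExpansion K lam φ val e) (x : I) :
    ∫ y, (K x y * φ x * φ y - lam * φ x ^ 2 - lam * φ y ^ 2 + lam) = 0 := by
  have hK : Continuous (K x) := h.continuous_kernel.comp (Continuous.prodMk_right x)
  have h2 := h.continuous_phi
  have h1 : ∀ y, K x y * φ x * φ y - lam * φ x ^ 2 - lam * φ y ^ 2 + lam =
      φ x * (K x y * φ y) - lam * φ y ^ 2 + (lam - lam * φ x ^ 2) := fun y => by ring
  simp only [h1]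
  rw [integral_add (integrable_of_continuous (by fun_prop))
    (integrable_of_continuous (by fun_prop)),
    integral_sub (integrable_of_continuous (by fun_prop))
    (integrable_of_continuous (by fun_prop)), integral_const_mul, integral_const_mul,
    h.integral_phi, h.integral_phi_sq]
  simp
  ring

variable {Ω : Type*} [MeasurableSpace Ω] {P : Measure Ω} [IsProbabilityMeasure P]
  {U : ℕ → Ω → I}

theorem bddInProb_norm_residual (h : EigenExpansion K lam φ val e)
    (hU : ∀ i, HasLaw (U i) volume P) (hind : iIndepFun U P) :
    BddInProb P fun n ω => ‖kernelLin K (fun i : Fin n => U i ω) (sampleVec φ fun i => U i ω) -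
      (((n : ℝ) - 1) * lam) • sampleVec φ (fun i : Fin n => U i ω)‖ / n := by
  have h2 := h.continuous_phi
  have hH : Continuous (Function.uncurry fun x y => K x y * φ y - lam * φ x) :=
    (h.continuous_kernel.mul (h2.comp continuous_snd)).sub
      (continuous_const.mul (h2.comp continuous_fst))
  have h0 : ∀ x, ∫ y, (K x y * φ y - lam * φ x) = 0 := fun x => by
    have hK : Continuous (K x) := h.continuous_kernel.comp (Continuous.prodMk_right x)
    rw [integral_sub (integrable_of_continuous (by fun_prop)) (integrable_const _), h.integral_phi]
    simp
  have key := BddInProb.of_integral_sq_le (P := P)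
    (fun n => (integral_rowSum_sq_le hU hind hH h0 n).1)
    fun n => (integral_rowSum_sq_le hU hind hH h0 n).2
  refine key.mono fun n ω => le_of_eq (congrArg (fun t => |t / (n : ℝ)|) ?_)
  rw [← Real.sqrt_sq (norm_nonneg _), norm_sq_eq_sum]
  congr 1
  refine Finset.sum_congr rfl fun i _ => congrArg (· ^ 2) ?_
  have h3 : ∀ j : Fin n, (if i = j then 0 else K (U i ω) (U j ω) * φ (U j ω) - lam * φ (U i ω)) =
      (if i = j then 0 else K (U i ω) (U j ω) * φ (U j ω)) - lam * φ (U i ω) +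
        if i = j then lam * φ (U i ω) else 0 := fun j => by split_ifs <;> ring
  simp only [h3, PiLp.sub_apply, PiLp.smul_apply, kernelLin_apply, sampleVec_apply, smul_eq_mul,
    Finset.sum_add_distrib, Finset.sum_sub_distrib, Finset.sum_const, Finset.card_univ,
    Fintype.card_fin, nsmul_eq_mul, Finset.sum_ite_eq, Finset.mem_univ, if_true]
  ring

/-- To first order the top eigenvalue is an average of independent variables. -/
theorem nullInProb_maxEigenvalue_sub (h : EigenExpansion K lam φ val e)
    (hU : ∀ i, HasLaw (U i) volume P) (hind : iIndepFun U P) :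
    NullInProb P fun n ω =>
      √(n : ℝ) * (maxEigenvalue (kernelMatrix K fun i : Fin n => U i ω) / n - lam) -
        lam * ((∑ i : Fin n, (φ (U i ω) ^ 2 - 1)) / √(n : ℝ)) := by
  have h2 := h.continuous_phi
  have hlam := h.lam_pos
  obtain ⟨m, hm0, hmlam, hform⟩ := h.whp_inner_kernelLin_le hU hind
  set c := (lam - m) / 2 with hc
  have hc0 : 0 < c := by rw [hc]; linarith
  set d : ℕ → Ω → ℝ := fun n ω => (∑ i : Fin n, (φ (U i ω) ^ 2 - 1)) / √(n : ℝ) with hd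
  set p : ℕ → Ω → ℝ := fun n ω => (∑ i : Fin n, φ (U i ω) ^ 2) / n with hp
  set H : I → I → ℝ := fun x y => K x y * φ x * φ y - lam * φ x ^ 2 - lam * φ y ^ 2 + lam with hH
  set G : ℕ → Ω → ℝ := fun n ω =>
    (∑ i : Fin n, ∑ j : Fin n, if i = j then 0 else H (U i ω) (U j ω)) / n with hG
  set Y : ℕ → Ω → ℝ := fun n ω =>
    ‖kernelLin K (fun i : Fin n => U i ω) (sampleVec φ fun i => U i ω) -
      (((n : ℝ) - 1) * lam) • sampleVec φ (fun i : Fin n => U i ω)‖ / n with hY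
  have bd : BddInProb P d := bddInProb_sum_div_sqrt hU hind
    (g := fun x => φ x ^ 2 - 1) (by fun_prop) (by
    rw [integral_sub (integrable_of_continuous (by fun_prop)) (integrable_const _),
      h.integral_phi_sq]
    simp)
  have np : NullInProb P fun n ω => p n ω - 1 := by
    simpa only [hp, Pi.pow_apply, h.integral_phi_sq] using nullInProb_average hU hind (h2.pow 2)
  have hHcont : Continuous (Function.uncurry H) := by
    have hK := h.continuous_kernel
    have h3 : Continuous fun q : I × I => φ q.1 := h2.comp continuous_fst
    have h4 : Continuous fun q : I × I => φ q.2 := h2.comp continuous_snd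
    exact ((((hK.mul h3).mul h4).sub (continuous_const.mul (h3.pow 2))).sub
      (continuous_const.mul (h4.pow 2))).add continuous_const
  have bG : BddInProb P G := by
    refine bddInProb_offDiag_div hU hind hHcont h.integral_centred_form fun y => ?_
    rw [← h.integral_centred_form y]
    refine integral_congr_ae (ae_of_all _ fun x => ?_)
    simp only [hH, h.symm x y]
    ring
  have bY : BddInProb P Y := h.bddInProb_norm_residual hU hind
  have ns : NullInProb P fun (n : ℕ) (_ : Ω) => 1 / √(n : ℝ) := .of_tendsto tendsto_inv_sqrt_natCast
  have ni : NullInProb P fun (n : ℕ) (_ : Ω) => 1 / (n : ℝ) :=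
    .of_tendsto (tendsto_const_nhds.div_atTop tendsto_natCast_atTop_atTop)
  -- Bound for the distance of the Rayleigh quotient of `φ` from its linearisation.
  set e₁ : ℕ → Ω → ℝ := fun n ω => lam * (1 / √(n : ℝ)) + 2 * (1 / √(n : ℝ) * |G n ω|) +
    2 * lam * (|d n ω| * |p n ω - 1|) + 2 * lam * (1 / (n : ℝ) * |d n ω|) with he₁
  have ne₁ : NullInProb P e₁ :=
    (((ns.const_mul lam).add ((ns.mul_bdd bG.abs).const_mul 2)).add
      ((bd.abs.mul_null np.abs).const_mul (2 * lam))).add ((ni.mul_bdd bd.abs).const_mul (2 * lam))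
  set e₂ : ℕ → Ω → ℝ := fun n ω => 1 / √(n : ℝ) * (e₁ n ω + lam * |d n ω|) with he₂
  have ne₂ : NullInProb P e₂ := ns.mul_bdd (ne₁.bdd.add (bd.abs.const_mul lam))
  set e₃ : ℕ → Ω → ℝ := fun n ω => e₁ n ω + 2 / c * (1 / √(n : ℝ) * Y n ω ^ 2) with he₃
  have ne₃ : NullInProb P e₃ := ne₁.add ((ns.mul_bdd bY.pow_two).const_mul (2 / c))
  refine ne₃.mono_whp ((((hform.and (np.whp_lt (half_pos one_pos))).and (ne₂.whp_lt hc0)).and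
    (WHP.of_eventually (eventually_gt_atTop 0))).mono fun n ω hω => ?_)
  obtain ⟨⟨⟨hf, hpn⟩, he⟩, hn⟩ := hω
  have : NeZero n := ⟨hn.ne'⟩
  have hn' : (n : ℝ) ≠ 0 := by exact_mod_cast hn.ne'
  have hp1 : ∑ i : Fin n, φ (U i ω) ^ 2 = n * p n ω := (mul_div_cancel₀ _ hn').symm
  refine (abs_maxEigenvalue_sub_le h.symm hlam hc0 (by rw [hc]; ring) (p := p n ω) (d := d n ω)
    (G := G n ω) (Y := Y n ω) hp1 (by linarith [(abs_lt.1 hpn).1]) ?_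
    (mul_div_cancel₀ _ hn') (mul_div_cancel₀ _ hn').symm rfl (lt_of_abs_lt he)
    hf).trans (le_abs_self _)
  have hs : (√(n : ℝ)) ≠ 0 := (Real.sqrt_pos.2 (by positivity)).ne'
  simp only [hd, Finset.sum_sub_distrib, hp1, Finset.sum_const, Finset.card_univ,
    Fintype.card_fin, nsmul_eq_mul, mul_one]
  rw [div_eq_iff hs]
  linear_combination (-(p n ω - 1)) * Real.mul_self_sqrt (Nat.cast_nonneg n)

/-- The central limit theorem for the top eigenvalue. If `φ ^ 2` is constant then the limit is the
Dirac mass at zero. -/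
theorem tendstoInDistribution_of_general (h : EigenExpansion K lam φ val e)
    (hU : ∀ i, HasLaw (U i) volume P) (hind : iIndepFun U P) :
    TendstoInDistribution (fun (n : ℕ) ω =>
      √(n : ℝ) * (maxEigenvalue (kernelMatrix K fun i : Fin n => U i ω) / n - lam)) atTop
      (id : ℝ → ℝ) (fun _ => P)
      (gaussianReal 0 (lam ^ 2 * Var[fun x : I => φ x ^ 2; volume]).toNNReal) := by
  have h2 := h.continuous_phi
  have hmeas : Measurable fun x => lam * φ x ^ 2 := by fun_prop
  obtain ⟨C, hC⟩ := exists_abs_le_of_continuous (f := fun x => lam * φ x ^ 2) (by fun_prop)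
  set X : ℕ → Ω → ℝ := fun i ω => lam * φ (U i ω) ^ 2 with hX
  have hvar : Var[X 0; P] = lam ^ 2 * Var[fun x : I => φ x ^ 2; volume] := by
    have h3 := variance_map (μ := P) (X := fun x => lam * φ x ^ 2) (Y := U 0)
      hmeas.aemeasurable (hU 0).aemeasurable
    rw [(hU 0).map_eq, variance_const_mul] at h3
    exact h3.symm
  have hmean : P[X 0] = lam := by
    have := (hU 0).integral_comp (f := fun x => lam * φ x ^ 2) hmeas.aestronglyMeasurable
    rw [integral_const_mul, h.integral_phi_sq, mul_one] at this
    exact this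
  have hclt := tendstoInDistribution_inv_sqrt_mul_sum_sub (P := P) (X := X) (Y := (id : ℝ → ℝ))
    (P' := gaussianReal 0 (lam ^ 2 * Var[fun x : I => φ x ^ 2; volume]).toNNReal)
    (by rw [hvar]; exact HasLaw.id)
    (MemLp.of_bound (hmeas.comp_aemeasurable (hU 0).aemeasurable).aestronglyMeasurable C
      (ae_of_all _ fun ω => hC _))
    (hind.comp (fun _ x => lam * φ x ^ 2) fun _ => hmeas)
    (fun i => (IdentDistrib.mk (hU i).aemeasurable (hU 0).aemeasurable
      (by rw [(hU i).map_eq, (hU 0).map_eq])).comp hmeas)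
  refine tendstoInDistribution_of_tendstoInMeasure_sub _ _ hclt
    (NullInProb.tendstoInMeasure ?_) fun n => ?_
  · refine (h.nullInProb_maxEigenvalue_sub hU hind).mono fun n ω => le_of_eq (congrArg _ ?_)
    simp only [Pi.sub_apply, hmean]
    congr 1
    rw [Finset.sum_range fun k => X k ω, Finset.sum_sub_distrib]
    simp only [hX, ← Finset.mul_sum, Finset.sum_const, Finset.card_univ, Fintype.card_fin,
      nsmul_eq_mul, mul_one]
    ring
  · have := (measurable_maxEigenvalue_kernelMatrix h.continuous_kernel.measurable h.symm
      n).comp_aemeasurable (aemeasurable_pi_lambda (fun ω (i : Fin n) => U i ω)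
        fun i => (hU i).aemeasurable)
    exact ((this.div_const _).sub_const _).const_mul _

end EigenExpansion

/-! ### Second-order perturbation of the top eigenvalue -/

section Perturbation

variable {E : Type*} [NormedAddCommGroup E] [InnerProductSpace ℝ E] {ι : Type*} [DecidableEq ι]

/-- Corrected approximate eigenvector. The operator is `lam • (v ⊗ v - 1) + ∑ val k • f k ⊗ f k`
up to the errors `D` (diagonal) and `R` (remainder). The correction `s` solves the perturbation
equation to first order, and `y` is the residual; its inner product with `v + s` is computed up to
an explicit error. -/
theorem exists_approx_eigenvector {F : Finset ι} {v : E} {f : ι → E} {A D R : E →ₗ[ℝ] E}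
    {val c z b κ : ι → ℝ} {ε : ι → ι → ℝ} {lam N s₀ B C a γ : ℝ} (hlam : 0 < lam) (hs₀ : 0 < s₀)
    (hN : N = s₀ * s₀) (hB : 0 ≤ B) (hC : 0 ≤ C)
    (hval : ∀ k, val k < lam) (hc : ∀ k, c k = val k / (lam - val k))
    (hA : ∀ w, A w = (lam * ⟪v, w⟫) • v + ∑ k ∈ F, (val k * ⟪f k, w⟫) • f k - lam • w - D w + R w)
    (hv : ‖v‖ ^ 2 = N) (hz : ∀ k, ⟪v, f k⟫ = s₀ * z k)
    (hε : ∀ k l, ⟪f k, f l⟫ = N * ((if k = l then 1 else 0) + ε k l))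
    (hf : ∀ k ∈ F, ‖f k‖ ≤ B * s₀) (hD : ∀ w, ‖D w‖ ≤ C * ‖w‖)
    (hvD : ⟪v, D v⟫ = N * ∑ k ∈ F, val k * (1 + ε k k)) (hR : R.IsSymmetric)
    (hRf : ∀ k, ‖R (f k)‖ = N * b k) (hRv : ‖R v‖ = N * a) (hvR : ⟪v, R v⟫ = N * γ)
    (hfR : ∀ k, ⟪f k, R v⟫ = N * κ k) {h : ι → ℝ} (hh : ∀ k, h k = ∑ l ∈ F, c l * z l * ε k l)
    {q S η : ℝ} (hq : q = ∑ k ∈ F, c k * z k ^ 2) (hS : S = B * ∑ k ∈ F, |c k| * |z k|)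
    (hη : η = B * (∑ k ∈ F, |val k| * |h k|) + C * (s₀ + S) / N +
      (∑ k ∈ F, |c k| * |z k| * |b k|) / s₀) :
    ∃ s y : E, A (v + s) = (lam * (N - 1) + lam * q) • (v + s) + y ∧ ‖s‖ ≤ S ∧ ⟪v, s⟫ = q ∧
      ‖y‖ ≤ N * (a + (η + lam * |q| * S / N)) ∧
      |⟪v + s, y⟫ / N - (γ - ∑ k ∈ F, val k)| ≤ (∑ k ∈ F, |val k| * |h k| * |z k|) +
        (∑ k ∈ F, |val k| * |ε k k|) + C * S / s₀ + 2 * ((∑ k ∈ F, |c k| * |z k| * |κ k|) / s₀) +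
        S * η + lam * |q| * (|q| + S ^ 2) / N := by
  have hN0 : 0 < N := by rw [hN]; positivity
  have hNne : N ≠ 0 := hN0.ne'
  have hsne : s₀ ≠ 0 := hs₀.ne'
  have hvn : ‖v‖ = s₀ := by
    rw [← Real.sqrt_sq (norm_nonneg v), hv, hN, Real.sqrt_mul_self hs₀.le]
  -- First-order perturbation coefficients `val k * ⟪f k, v⟫ / (N * (lam - val k))`.
  set t : ι → ℝ := fun k => c k * z k / s₀ with ht
  set s := ∑ k ∈ F, t k • f k with hs
  have hS0 : 0 ≤ S := by
    rw [hS]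
    exact mul_nonneg hB (Finset.sum_nonneg fun k _ => by positivity)
  have hsS : ‖s‖ ≤ S := by
    rw [hS, Finset.mul_sum]
    refine norm_sum_le_of_le _ fun k hk => ?_
    rw [norm_smul, Real.norm_eq_abs, ht, abs_div, abs_mul, abs_of_pos hs₀]
    calc |c k| * |z k| / s₀ * ‖f k‖ ≤ |c k| * |z k| / s₀ * (B * s₀) := by gcongr; exact hf k hk
      _ = B * (|c k| * |z k|) := by field_simp
  have hvs : ⟪v, s⟫ = q := by
    rw [hs, inner_sum, hq]
    refine Finset.sum_congr rfl fun k _ => ?_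
    rw [inner_smul_right, hz, ht]
    field_simp
  have hfs : ∀ k ∈ F, ⟪f k, s⟫ = s₀ * (c k * z k) + s₀ * h k := fun k hk => by
    have h1 : ∀ l, ⟪f k, t l • f l⟫ = s₀ * (if k = l then c l * z l else 0) +
        s₀ * (c l * z l * ε k l) := fun l => by
      rw [inner_smul_right, hε, ht, hN]
      field_simp
      split_ifs <;> ring
    rw [hs, inner_sum, Finset.sum_congr rfl fun l _ => h1 l, Finset.sum_add_distrib,
      ← Finset.mul_sum, ← Finset.mul_sum, ← hh, Finset.sum_ite_eq, if_pos hk]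
  -- The `f k`-component of `A (v + s)` is proportional to `val k * (1 + c k)`, that of `lam • s` to
  -- `lam * c k`, with the same factor; this identity matches them.
  have hcv : ∀ k, val k * (1 + c k) = lam * c k := fun k => by
    have := sub_pos.2 (hval k)
    rw [hc]
    field_simp
    ring
  set E' := ∑ k ∈ F, (val k * (s₀ * h k)) • f k - D (v + s) + R s with hE'
  -- The terms of order one in the eigenvalue equation cancel by the choice of the coefficients.
  have heq : A (v + s) = (lam * (N - 1) + lam * q) • (v + s) + (R v + E' - (lam * q) • s) := by
    have h1 : ∑ k ∈ F, (val k * ⟪f k, v + s⟫) • f k =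
        ∑ k ∈ F, (val k * (s₀ * h k)) • f k + (lam * N) • s := by
      rw [hs, Finset.smul_sum, ← Finset.sum_add_distrib, ← hs]
      refine Finset.sum_congr rfl fun k hk => ?_
      rw [smul_smul, ← add_smul, inner_add_right, hfs k hk, real_inner_comm, hz]
      congr 1
      rw [ht, hN]
      field_simp
      linear_combination z k * hcv k
    rw [hA, h1, inner_add_right, hvs, real_inner_self_eq_norm_sq, hv, map_add R, hE']
    module
  have hRs : ‖R s‖ ≤ N * ((∑ k ∈ F, |c k| * |z k| * |b k|) / s₀) := by
    rw [hs, map_sum, Finset.sum_div, Finset.mul_sum]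
    refine norm_sum_le_of_le _ fun k _ => le_of_eq ?_
    have hb : 0 ≤ b k := by
      have := norm_nonneg (R (f k))
      rw [hRf] at this
      exact nonneg_of_mul_nonneg_right this hN0
    rw [map_smul, norm_smul, hRf, Real.norm_eq_abs, ht, abs_div, abs_mul, abs_of_pos hs₀,
      abs_of_nonneg hb]
    field_simp
  have hE'n : ‖E'‖ ≤ N * η := by
    have h1 : ‖∑ k ∈ F, (val k * (s₀ * h k)) • f k‖ ≤ N * (B * ∑ k ∈ F, |val k| * |h k|) := by
      rw [Finset.mul_sum, Finset.mul_sum]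
      refine norm_sum_le_of_le _ fun k hk => ?_
      rw [norm_smul, Real.norm_eq_abs, abs_mul, abs_mul, abs_of_pos hs₀]
      calc |val k| * (s₀ * |h k|) * ‖f k‖ ≤ |val k| * (s₀ * |h k|) * (B * s₀) := by
            gcongr; exact hf k hk
        _ = _ := by rw [hN]; ring
    have h2 : ‖D (v + s)‖ ≤ N * (C * (s₀ + S) / N) := by
      refine (hD _).trans ?_
      rw [mul_div_cancel₀ _ hNne]
      refine mul_le_mul_of_nonneg_left ((norm_add_le _ _).trans ?_) hC
      rw [hvn]
      linarith
    rw [hη, mul_add, mul_add]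
    exact (norm_add_le _ _).trans (add_le_add ((norm_sub_le _ _).trans (add_le_add h1 h2)) hRs)
  refine ⟨s, R v + E' - (lam * q) • s, heq, hsS, hvs, ?_, ?_⟩
  · have h1 : ‖(lam * q) • s‖ ≤ lam * |q| * S := by
      rw [norm_smul, Real.norm_eq_abs, abs_mul, abs_of_pos hlam]
      gcongr
    calc _ ≤ ‖R v‖ + ‖E'‖ + ‖(lam * q) • s‖ :=
          (norm_sub_le _ _).trans (by gcongr; exact norm_add_le _ _)
      _ ≤ N * a + N * η + lam * |q| * S := by rw [hRv]; gcongr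
      _ = _ := by field_simp; ring
  · have hsR : ⟪s, R v⟫ = N * ((∑ k ∈ F, c k * z k * κ k) / s₀) := by
      rw [hs, sum_inner, Finset.sum_div, Finset.mul_sum]
      refine Finset.sum_congr rfl fun k _ => ?_
      rw [inner_smul_left, hfR, ht]
      simp only [conj_trivial]
      field_simp
    have hvE : ⟪v, E'⟫ = N * (∑ k ∈ F, val k * h k * z k) -
        (N * ∑ k ∈ F, val k * (1 + ε k k)) - ⟪v, D s⟫ + ⟪s, R v⟫ := by
      rw [hE', inner_add_right, inner_sub_right, inner_sum, map_add, inner_add_right, hvD,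
        ← hR v s, real_inner_comm s (R v)]
      have : ∀ k ∈ F, ⟪v, (val k * (s₀ * h k)) • f k⟫ = N * (val k * h k * z k) := fun k _ => by
        rw [inner_smul_right, hz, hN]
        ring
      rw [Finset.sum_congr rfl this, ← Finset.mul_sum]
      ring
    clear_value E'
    have hid : ⟪v + s, R v + E' - (lam * q) • s⟫ / N - (γ - ∑ k ∈ F, val k) =
        (∑ k ∈ F, val k * h k * z k) - (∑ k ∈ F, val k * ε k k) - ⟪v, D s⟫ / N +
        2 * ((∑ k ∈ F, c k * z k * κ k) / s₀) + ⟪s, E'⟫ / N -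
        lam * q * (q + ‖s‖ ^ 2) / N := by
      rw [inner_add_left, inner_sub_right, inner_sub_right, inner_add_right, inner_add_right,
        inner_smul_right, inner_smul_right, hvE, hvR, hvs, real_inner_self_eq_norm_sq, hsR]
      simp only [mul_add, mul_one, Finset.sum_add_distrib]
      field_simp
      ring
    rw [hid]
    have h1 : |∑ k ∈ F, val k * h k * z k| ≤ ∑ k ∈ F, |val k| * |h k| * |z k| :=
      (Finset.abs_sum_le_sum_abs _ _).trans_eq (by simp only [abs_mul])
    have h2 : |∑ k ∈ F, val k * ε k k| ≤ ∑ k ∈ F, |val k| * |ε k k| :=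
      (Finset.abs_sum_le_sum_abs _ _).trans_eq (by simp only [abs_mul])
    have h3 : |⟪v, D s⟫ / N| ≤ C * S / s₀ := by
      rw [abs_div, abs_of_pos hN0, div_le_iff₀ hN0]
      calc |⟪v, D s⟫| ≤ ‖v‖ * ‖D s‖ := abs_real_inner_le_norm _ _
        _ ≤ s₀ * (C * S) := by
            rw [hvn]
            gcongr
            exact (hD s).trans (by gcongr)
        _ = _ := by rw [hN]; field_simp
    have h4 : |2 * ((∑ k ∈ F, c k * z k * κ k) / s₀)| ≤
        2 * ((∑ k ∈ F, |c k| * |z k| * |κ k|) / s₀) := by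
      rw [abs_mul, abs_div, abs_of_pos hs₀, abs_two]
      gcongr
      exact (Finset.abs_sum_le_sum_abs _ _).trans_eq (by simp only [abs_mul])
    have h5 : |⟪s, E'⟫ / N| ≤ S * η := by
      rw [abs_div, abs_of_pos hN0, div_le_iff₀ hN0]
      calc |⟪s, E'⟫| ≤ ‖s‖ * ‖E'‖ := abs_real_inner_le_norm _ _
        _ ≤ S * (N * η) := by gcongr
        _ = _ := by ring
    have h6 : |lam * q * (q + ‖s‖ ^ 2) / N| ≤ lam * |q| * (|q| + S ^ 2) / N := by
      rw [abs_div, abs_of_pos hN0, abs_mul, abs_mul, abs_of_pos hlam]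
      gcongr
      refine (abs_add_le _ _).trans ?_
      rw [abs_of_nonneg (sq_nonneg ‖s‖)]
      gcongr
    refine (abs_sub _ _).trans (add_le_add ((abs_add_le _ _).trans (add_le_add
      ((abs_add_le _ _).trans (add_le_add ((abs_sub _ _).trans (add_le_add
      ((abs_sub _ _).trans (add_le_add h1 h2)) h3)) h4)) h5)) h6)

/-- The top eigenvalue from an approximate eigenvector `v + s` whose residual `y` has norm at most
`N * r` and satisfies `⟪v + s, y⟫ ≈ N * g`. -/
theorem abs_top_sub_le {A : E →ₗ[ℝ] E} (hA : A.IsSymmetric) {Λ : ℝ} (hΛ : IsTop A Λ) {v s y : E}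
    {lam m c N q S r g η : ℝ} (hlam : 0 < lam) (hc : 0 < c) (hmc : lam = m + 2 * c) (hN : 0 < N)
    (hv : ‖v‖ ^ 2 = N) (hy : A (v + s) = (lam * (N - 1) + lam * q) • (v + s) + y) (hs : ‖s‖ ≤ S)
    (hvs : ⟪v, s⟫ = q) (hyr : ‖y‖ ≤ N * r) (hg : |⟪v + s, y⟫ / N - g| ≤ η)
    (hform : ∀ w, ⟪w, A w⟫ ≤ lam * ⟪v, w⟫ ^ 2 + N * m * ‖w‖ ^ 2)
    (hq : (2 * |q|) / N < 1 / 2)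
    (hbig : (lam + lam * |q| + |g| + (η + 2 * (|g| + η) * (2 * |q| + S ^ 2) / N) +
      lam * S ^ 2) / N < c) :
    |Λ - lam * (N - 1) - (lam * q + g)| ≤
      (η + 2 * (|g| + η) * (2 * |q| + S ^ 2) / N) + 2 / c * r ^ 2 := by
  have hS0 : 0 ≤ S := (norm_nonneg _).trans hs
  have hs2 : ‖s‖ ^ 2 ≤ S ^ 2 := pow_le_pow_left₀ (norm_nonneg _) hs 2
  set x := v + s with hx
  have hxn : ‖x‖ ^ 2 = N + 2 * q + ‖s‖ ^ 2 := by rw [hx, norm_add_sq_real, hv, hvs]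
  have hx2 : N / 2 ≤ ‖x‖ ^ 2 := by
    rw [div_lt_iff₀ hN] at hq
    have := neg_abs_le q
    have := sq_nonneg ‖s‖
    linarith
  have hxpos : 0 < ‖x‖ ^ 2 := by linarith
  have hx0 : x ≠ 0 := by
    rintro h0
    simp [h0] at hxpos
  -- `W` replaces `‖x‖ ^ 2` by `N` in the correction to the Rayleigh quotient.
  set W := ⟪x, y⟫ / N with hW
  set δ := 2 * (|g| + η) * (2 * |q| + S ^ 2) / N with hδ
  have hWabs : |W| ≤ |g| + η := by
    have : W = g + (W - g) := by ring
    rw [this]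
    exact (abs_add_le _ _).trans (by gcongr)
  have hT : |⟪x, y⟫ / ‖x‖ ^ 2 - W| ≤ δ := by
    have h1 : ⟪x, y⟫ / ‖x‖ ^ 2 - W = -(W * (2 * q + ‖s‖ ^ 2) / ‖x‖ ^ 2) := by
      have : ⟪x, y⟫ = N * W := by rw [hW]; field_simp
      rw [this]
      field_simp
      rw [hxn]
      ring
    rw [h1, abs_neg, abs_div, abs_mul, abs_of_pos hxpos]
    have h2 : |2 * q + ‖s‖ ^ 2| ≤ 2 * |q| + S ^ 2 := by
      refine (abs_add_le _ _).trans ?_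
      rw [abs_mul, abs_two, abs_of_nonneg (sq_nonneg ‖s‖)]
      gcongr
    calc |W| * |2 * q + ‖s‖ ^ 2| / ‖x‖ ^ 2 ≤ (|g| + η) * (2 * |q| + S ^ 2) / (N / 2) := by
          have : 0 ≤ |g| + η := (abs_nonneg _).trans hWabs
          gcongr
      _ = δ := by rw [hδ]; field_simp
  set ρ := lam * (N - 1) + lam * q + ⟪x, y⟫ / ‖x‖ ^ 2 with hρ
  have hρd : |ρ - lam * (N - 1) - (lam * q + g)| ≤ η + δ := by
    have : ρ - lam * (N - 1) - (lam * q + g) = (W - g) + (⟪x, y⟫ / ‖x‖ ^ 2 - W) := by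
      rw [hρ]; ring
    rw [this]
    exact (abs_add_le _ _).trans (add_le_add hg hT)
  have hgapρ : N * c ≤ ρ - (N * m + lam * S ^ 2) := by
    rw [div_lt_iff₀ hN] at hbig
    have h1 := (abs_le.1 hρd).1
    have h2 : lam * q ≥ -(lam * |q|) := by nlinarith [neg_abs_le q]
    have h3 := neg_abs_le g
    have h4 : lam * N = m * N + 2 * c * N := by rw [hmc]; ring
    nlinarith
  have hNc : 0 < N * c := mul_pos hN hc
  -- If `w` is orthogonal to `v + s` then `⟪v, w⟫ = -⟪s, w⟫`, which costs only `lam * S ^ 2`.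
  obtain ⟨hlow, hup⟩ := hΛ.bounds hA hx0 hy hρ (m := N * m + lam * S ^ 2) (fun w hw => by
    have h1 : ⟪v, w⟫ = -⟪s, w⟫ := by
      rw [hx, inner_add_left] at hw
      linarith
    have h2 : ⟪v, w⟫ ^ 2 ≤ S ^ 2 * ‖w‖ ^ 2 := by
      rw [h1, neg_sq, ← sq_abs, ← mul_pow]
      exact pow_le_pow_left₀ (abs_nonneg _)
        ((abs_real_inner_le_norm _ _).trans (by gcongr)) 2
    have h3 := mul_le_mul_of_nonneg_left h2 hlam.le
    linarith [hform w]) (by linarith)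
  have hfin : ‖y‖ ^ 2 / (‖x‖ ^ 2 * (ρ - (N * m + lam * S ^ 2))) ≤ 2 / c * r ^ 2 := by
    calc _ ≤ (N * r) ^ 2 / (N / 2 * (N * c)) := by gcongr
      _ = _ := by field_simp
  have h7 : Λ - lam * (N - 1) - (lam * q + g) =
      (ρ - lam * (N - 1) - (lam * q + g)) + (Λ - ρ) := by ring
  rw [h7]
  refine (abs_add_le _ _).trans (add_le_add hρd ?_)
  rw [abs_of_nonneg (sub_nonneg.2 hlow)]
  linarith

end Perturbation

/-! ### Truncation of the expansion when the top eigenfunction is constant -/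

namespace EigenExpansion

variable {ι : Type*} {K : I → I → ℝ} {lam : ℝ} {φ : I → ℝ} {val : ι → ℝ} {e : ι → I → ℝ}

theorem kernelLin_eq_of_sq_eq_one (hφ : ∀ x, φ x ^ 2 = 1) (F : Finset ι) {n : ℕ}
    (u : Fin n → I) (w : EuclideanSpace ℝ (Fin n)) :
    kernelLin K u w = (lam * ⟪sampleVec φ u, w⟫) • sampleVec φ u +
      ∑ k ∈ F, (val k * ⟪sampleVec (e k) u, w⟫) • sampleVec (e k) u - lam • w -
      diagLin (fun x => ∑ k ∈ F, val k * (e k x * e k x)) u w +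
      kernelLin (remainder K lam φ val e F) u w := by
  rw [kernelLin_eq K lam φ val e F u w]
  have : diagLin (diagPart lam φ val e F) u w = lam • w +
      diagLin (fun x => ∑ k ∈ F, val k * (e k x * e k x)) u w := by
    ext i
    simp only [PiLp.add_apply, PiLp.smul_apply, diagLin_apply, smul_eq_mul, diagPart,
      ← pow_two, hφ]
    ring
  rw [this]
  module

theorem inner_diagLin_sampleVec [DecidableEq ι] (hφ : ∀ x, φ x ^ 2 = 1) (F : Finset ι) {n : ℕ}
    (hn : 0 < n) (u : Fin n → I) :
    ⟪sampleVec φ u, diagLin (fun x => ∑ k ∈ F, val k * (e k x * e k x)) u (sampleVec φ u)⟫ =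
      n * ∑ k ∈ F, val k *
        (1 + (⟪sampleVec (e k) u, sampleVec (e k) u⟫ / n - if k = k then 1 else 0)) := by
  have hn' : (n : ℝ) ≠ 0 := by exact_mod_cast hn.ne'
  simp only [if_true, add_sub_cancel, inner_eq_sum, diagLin_apply, sampleVec_apply]
  have h1 : ∀ i, φ (u i) * ((∑ k ∈ F, val k * (e k (u i) * e k (u i))) * φ (u i)) =
      ∑ k ∈ F, val k * (e k (u i) * e k (u i)) := fun i => by
    linear_combination (∑ k ∈ F, val k * (e k (u i) * e k (u i))) * hφ (u i)
  simp only [h1]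
  rw [Finset.sum_comm, Finset.mul_sum]
  refine Finset.sum_congr rfl fun k _ => ?_
  rw [← Finset.mul_sum]
  field_simp

variable {Ω : Type*} [MeasurableSpace Ω] {P : Measure Ω} [IsProbabilityMeasure P]
  {U : ℕ → Ω → I}

/-- The normalised sum of `φ * e k` over the sample. -/
noncomputable def scoreSum (U : ℕ → Ω → I) (φ : I → ℝ) (e : ι → I → ℝ) (k : ι) (n : ℕ) (ω : Ω) :
    ℝ :=
  (∑ i : Fin n, φ (U i ω) * e k (U i ω)) / √(n : ℝ)

/-- The quadratic statistic that carries the limit law of the truncated expansion. -/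
noncomputable def truncStat (U : ℕ → Ω → I) (lam : ℝ) (φ : I → ℝ) (val : ι → ℝ) (e : ι → I → ℝ)
    (F : Finset ι) (n : ℕ) (ω : Ω) : ℝ :=
  ∑ k ∈ F, (lam * (val k / (lam - val k)) * scoreSum U φ e k n ω ^ 2 - val k)

theorem remainder_mul_comp_continuous (h : EigenExpansion K lam φ val e) (F : Finset ι)
    {f g : I → ℝ} (hf : Continuous f) (hg : Continuous g) :
    Continuous (Function.uncurry fun x y => remainder K lam φ val e F x y * f x * g y) :=
  ((h.continuous_remainder F).mul (hf.comp continuous_fst)).mul (hg.comp continuous_snd)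

theorem bddInProb_inner_remainder (h : EigenExpansion K lam φ val e)
    (hU : ∀ i, HasLaw (U i) volume P) (hind : iIndepFun U P) {F : Finset ι} {k : ι} (hk : k ∈ F) :
    BddInProb P fun n ω => ⟪sampleVec (e k) fun i : Fin n => U i ω,
      kernelLin (remainder K lam φ val e F) (fun i : Fin n => U i ω)
        (sampleVec φ fun i : Fin n => U i ω)⟫ / n := by
  have key := bddInProb_offDiag_div hU hind
    (h.remainder_mul_comp_continuous F (h.continuous_eig k) h.continuous_phi)
    (fun x => by
      have := h.integral_remainder_phi F x
      have h1 : ∀ y, remainder K lam φ val e F x y * e k x * φ y =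
          e k x * (remainder K lam φ val e F x y * φ y) := fun y => by ring
      simp only [h1, integral_const_mul, this, mul_zero])
    (fun y => by
      have := h.integral_remainder_eig F hk y
      have h1 : ∀ x, remainder K lam φ val e F x y * e k x * φ y =
          φ y * (remainder K lam φ val e F y x * e k x) := fun x => by
        rw [h.remainder_symm F x y]; ring
      simp only [h1, integral_const_mul, this, mul_zero])
  simpa only [inner_kernelLin, sampleVec_apply] using key

theorem integral_sq_inner_remainder_le (h : EigenExpansion K lam φ val e)
    (hφ : ∀ x, φ x ^ 2 = 1) (hU : ∀ i, HasLaw (U i) volume P) (hind : iIndepFun U P)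
    (F : Finset ι) (n : ℕ) :
    Integrable (fun ω => (⟪sampleVec φ fun i : Fin n => U i ω,
      kernelLin (remainder K lam φ val e F) (fun i : Fin n => U i ω)
        (sampleVec φ fun i : Fin n => U i ω)⟫ / n) ^ 2) P ∧
    ∫ ω, (⟪sampleVec φ fun i : Fin n => U i ω,
      kernelLin (remainder K lam φ val e F) (fun i : Fin n => U i ω)
        (sampleVec φ fun i : Fin n => U i ω)⟫ / n) ^ 2 ∂P ≤
      2 * ∫ x, ∫ y, remainder K lam φ val e F x y ^ 2 := by
  have key := integral_sq_offDiag_div_le hU hind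
    (h.remainder_mul_comp_continuous F h.continuous_phi h.continuous_phi)
    (fun x => by
      have := h.integral_remainder_phi F x
      have h1 : ∀ y, remainder K lam φ val e F x y * φ x * φ y =
          φ x * (remainder K lam φ val e F x y * φ y) := fun y => by ring
      simp only [h1, integral_const_mul, this, mul_zero])
    (fun y => by
      have := h.integral_remainder_phi F y
      have h1 : ∀ x, remainder K lam φ val e F x y * φ x * φ y =
          φ y * (remainder K lam φ val e F y x * φ x) := fun x => by
        rw [h.remainder_symm F x y]; ring
      simp only [h1, integral_const_mul, this, mul_zero]) n
  have h2 : ∀ x y, (remainder K lam φ val e F x y * φ x * φ y) ^ 2 =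
      remainder K lam φ val e F x y ^ 2 := fun x y => by
    rw [mul_pow, mul_pow, hφ, hφ]; ring
  simpa only [inner_kernelLin, sampleVec_apply, h2] using key

theorem integral_sq_norm_remainder_le (h : EigenExpansion K lam φ val e)
    (hU : ∀ i, HasLaw (U i) volume P) (hind : iIndepFun U P) (F : Finset ι) {g : I → ℝ}
    (hg : Continuous g) (h0 : ∀ x, ∫ y, remainder K lam φ val e F x y * g y = 0) (n : ℕ) :
    Integrable (fun ω => (‖kernelLin (remainder K lam φ val e F) (fun i : Fin n => U i ω)
        (sampleVec g fun i : Fin n => U i ω)‖ / n) ^ 2) P ∧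
    ∫ ω, (‖kernelLin (remainder K lam φ val e F) (fun i : Fin n => U i ω)
        (sampleVec g fun i : Fin n => U i ω)‖ / n) ^ 2 ∂P ≤
      ∫ x, ∫ y, (remainder K lam φ val e F x y * g y) ^ 2 := by
  have hcont : Continuous (Function.uncurry fun x y => remainder K lam φ val e F x y * g y) :=
    (h.continuous_remainder F).mul (hg.comp continuous_snd)
  simpa only [norm_kernelLin_sampleVec] using integral_rowSum_sq_le hU hind hcont h0 n

theorem bddInProb_scoreSum (h : EigenExpansion K lam φ val e)
    (hU : ∀ i, HasLaw (U i) volume P) (hind : iIndepFun U P) (k : ι) :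
    BddInProb P fun n ω => scoreSum U φ e k n ω :=
  bddInProb_sum_div_sqrt hU hind (g := fun x => φ x * e k x)
    (h.continuous_phi.mul (h.continuous_eig k)) (h.integral_phi_mul k)

/-- The top eigenvalue of the kernel matrix differs from its truncated second-order expansion by a
negligible term and by two terms `γ` and `a` whose second moments are controlled by the
mean-square remainder of the expansion, with a constant `C` that is the same for all
truncations. -/
theorem exists_truncation_bound (h : EigenExpansion K lam φ val e) (hφ : ∀ x, φ x ^ 2 = 1)
    (hU : ∀ i, HasLaw (U i) volume P) (hind : iIndepFun U P) :
    ∃ C : ℝ, 0 < C ∧ ∀ F : Finset ι, ∃ γ a η : ℕ → Ω → ℝ,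
      (∀ n, Integrable (fun ω => γ n ω ^ 2) P ∧
        ∫ ω, γ n ω ^ 2 ∂P ≤ 2 * ∫ x, ∫ y, remainder K lam φ val e F x y ^ 2) ∧
      (∀ n, Integrable (fun ω => a n ω ^ 2) P ∧
        ∫ ω, a n ω ^ 2 ∂P ≤ ∫ x, ∫ y, remainder K lam φ val e F x y ^ 2) ∧
      NullInProb P η ∧ WHP P fun n ω =>
        |maxEigenvalue (kernelMatrix K fun i : Fin n => U i ω) - lam * (n - 1) -
          truncStat U lam φ val e F n ω| ≤ |γ n ω| + C * a n ω ^ 2 + η n ω := by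
  classical
  have hlam := h.lam_pos
  obtain ⟨m, hm0, hmlam, hform⟩ := h.whp_inner_kernelLin_le hU hind
  obtain ⟨m', hm'0, hm'lam, hval'⟩ := h.gap
  have hval : ∀ k, val k < lam := fun k => (hval' k).trans_lt hm'lam
  set δ := (lam - m) / 2 with hδ
  have hδ0 : 0 < δ := by rw [hδ]; linarith
  -- The factor `2 / δ` comes from the eigenvalue bound; the last one from
  -- `(a + η₄) ^ 2 ≤ 2 * a ^ 2 + 2 * η₄ ^ 2`.
  refine ⟨2 / δ * 2, by positivity, fun F => ?_⟩
  set c : ι → ℝ := fun k => val k / (lam - val k) with hc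
  set u : (n : ℕ) → Ω → Fin n → I := fun n ω i => U i ω with hu
  set R := remainder K lam φ val e F with hR
  set z : ι → ℕ → Ω → ℝ := fun k n ω => scoreSum U φ e k n ω with hz
  set ε : ι → ι → ℕ → Ω → ℝ := fun k l n ω =>
    ⟪sampleVec (e k) (u n ω), sampleVec (e l) (u n ω)⟫ / n - if k = l then 1 else 0 with hε
  set b : ι → ℕ → Ω → ℝ := fun k n ω =>
    ‖kernelLin R (u n ω) (sampleVec (e k) (u n ω))‖ / n with hb
  set κ : ι → ℕ → Ω → ℝ := fun k n ω =>
    ⟪sampleVec (e k) (u n ω), kernelLin R (u n ω) (sampleVec φ (u n ω))⟫ / n with hκ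
  set γ : ℕ → Ω → ℝ := fun n ω =>
    ⟪sampleVec φ (u n ω), kernelLin R (u n ω) (sampleVec φ (u n ω))⟫ / n with hγ
  set a : ℕ → Ω → ℝ := fun n ω => ‖kernelLin R (u n ω) (sampleVec φ (u n ω))‖ / n with ha
  have hdc : Continuous fun x => ∑ k ∈ F, val k * (e k x * e k x) := by
    have := h.continuous_eig
    fun_prop
  obtain ⟨C₀, hC₀⟩ := exists_abs_le_of_continuous hdc
  choose M hM using fun k => exists_abs_le_of_continuous (h.continuous_eig k)
  set B := ∑ k ∈ F, |M k| with hB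
  have hB0 : 0 ≤ B := Finset.sum_nonneg fun k _ => abs_nonneg _
  -- Stochastic orders of the ingredients.
  have oz : ∀ k, BddInProb P (z k) := fun k => h.bddInProb_scoreSum hU hind k
  have oε : ∀ k l, NullInProb P (ε k l) := fun k l => h.nullInProb_gram hU hind k l
  have ob : ∀ k ∈ F, BddInProb P (b k) := fun k hk => BddInProb.of_integral_sq_le
    (fun n => (h.integral_sq_norm_remainder_le hU hind F (h.continuous_eig k)
      (h.integral_remainder_eig F hk) n).1)
    fun n => (h.integral_sq_norm_remainder_le hU hind F (h.continuous_eig k)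
      (h.integral_remainder_eig F hk) n).2
  have oκ : ∀ k ∈ F, BddInProb P (κ k) := fun k hk => h.bddInProb_inner_remainder hU hind hk
  have hγ2 := h.integral_sq_inner_remainder_le hφ hU hind F
  have oγ : BddInProb P γ := BddInProb.of_integral_sq_le (fun n => (hγ2 n).1) fun n => (hγ2 n).2
  have ha2 : ∀ n, Integrable (fun ω => a n ω ^ 2) P ∧
      ∫ ω, a n ω ^ 2 ∂P ≤ ∫ x, ∫ y, R x y ^ 2 := fun n => by
    have h1 := h.integral_sq_norm_remainder_le hU hind F h.continuous_phi
      (h.integral_remainder_phi F) n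
    have h2 : ∀ x y, (remainder K lam φ val e F x y * φ y) ^ 2 = R x y ^ 2 := fun x y => by
      rw [mul_pow, hφ, mul_one]
    simpa only [h2] using h1
  have ns : NullInProb P fun (n : ℕ) (_ : Ω) => 1 / √(n : ℝ) := .of_tendsto tendsto_inv_sqrt_natCast
  have ni : NullInProb P fun (n : ℕ) (_ : Ω) => 1 / (n : ℝ) :=
    .of_tendsto (tendsto_const_nhds.div_atTop tendsto_natCast_atTop_atTop)
  set hh : ι → ℕ → Ω → ℝ := fun k n ω => ∑ l ∈ F, c l * z l n ω * ε k l n ω with hhh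
  have oh : ∀ k, NullInProb P (hh k) := fun k => NullInProb.sum F fun l _ =>
    ((oz l).const_mul (c l)).mul_null (oε k l)
  set q : ℕ → Ω → ℝ := fun n ω => ∑ k ∈ F, c k * z k n ω ^ 2 with hq
  have oq : BddInProb P q := BddInProb.sum F fun k _ => (oz k).pow_two.const_mul (c k)
  set S : ℕ → Ω → ℝ := fun n ω => B * ∑ k ∈ F, |c k| * |z k n ω| with hS
  have oS : BddInProb P S :=
    (BddInProb.sum F fun k _ => (oz k).abs.const_mul |c k|).const_mul B
  set η : ℕ → Ω → ℝ := fun n ω => B * (∑ k ∈ F, |val k| * |hh k n ω|) +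
    |C₀| * (√(n : ℝ) + S n ω) / n + (∑ k ∈ F, |c k| * |z k n ω| * |b k n ω|) / √(n : ℝ) with hη
  have oη : NullInProb P η := by
    refine (NullInProb.add ?_ ?_).add ?_
    · exact (NullInProb.sum F fun k _ => (oh k).abs.const_mul |val k|).const_mul B
    · have h1 : NullInProb P fun n ω => |C₀| * (1 / √(n : ℝ) + 1 / (n : ℝ) * S n ω) :=
        (ns.add (ni.mul_bdd oS)).const_mul |C₀|
      refine h1.mono fun n ω => le_of_eq (congrArg _ ?_)
      rw [mul_div_assoc, add_div, Real.sqrt_div_self']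
      ring
    · have h1 := ns.mul_bdd (BddInProb.sum F fun k hk =>
        ((oz k).abs.const_mul |c k|).mul (ob k hk).abs)
      refine h1.mono fun n ω => le_of_eq (congrArg _ ?_)
      ring
  set η₄ : ℕ → Ω → ℝ := fun n ω => η n ω + lam * |q n ω| * S n ω / n with hη₄
  have oη₄ : NullInProb P η₄ := by
    refine oη.add (NullInProb.mono (ni.mul_bdd ((oq.abs.const_mul lam).mul oS))
      fun n ω => le_of_eq (congrArg _ ?_))
    ring
  set η₂ : ℕ → Ω → ℝ := fun n ω => (∑ k ∈ F, |val k| * |hh k n ω| * |z k n ω|) +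
        (∑ k ∈ F, |val k| * |ε k k n ω|) + |C₀| * S n ω / √(n : ℝ) +
        2 * ((∑ k ∈ F, |c k| * |z k n ω| * |κ k n ω|) / √(n : ℝ)) +
        S n ω * η n ω + lam * |q n ω| * (|q n ω| + S n ω ^ 2) / n with hη₂
  have oη₂ : NullInProb P η₂ := by
    refine (((((NullInProb.sum F fun k _ => ((oh k).abs.const_mul |val k|).mul_bdd
      (oz k).abs).add (NullInProb.sum F fun k _ => (oε k k).abs.const_mul |val k|)).add ?_).add
      (NullInProb.const_mul 2 ?_)).add (oS.mul_null oη)).add ?_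
    · refine (ns.mul_bdd (oS.const_mul |C₀|)).mono fun n ω => le_of_eq (congrArg _ ?_)
      ring
    · refine (ns.mul_bdd (BddInProb.sum F fun k hk =>
        ((oz k).abs.const_mul |c k|).mul (oκ k hk).abs)).mono fun n ω => le_of_eq (congrArg _ ?_)
      ring
    · refine (ni.mul_bdd ((oq.abs.const_mul lam).mul (oq.abs.add oS.pow_two))).mono
        fun n ω => le_of_eq (congrArg _ ?_)
      ring
  set g : ℕ → Ω → ℝ := fun n ω => γ n ω - ∑ k ∈ F, val k with hg
  have og : BddInProb P g := oγ.sub (BddInProb.const _)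
  set η₃ : ℕ → Ω → ℝ := fun n ω =>
    η₂ n ω + 2 * (|g n ω| + η₂ n ω) * (2 * |q n ω| + S n ω ^ 2) / n with hη₃
  have oη₃ : NullInProb P η₃ := by
    refine oη₂.add ((ni.mul_bdd (((og.abs.add oη₂.bdd).const_mul 2).mul
      ((oq.abs.const_mul 2).add oS.pow_two))).mono fun n ω => le_of_eq (congrArg _ ?_))
    ring
  have o1 : NullInProb P fun n ω => (2 * |q n ω|) / n :=
    (ni.mul_bdd (oq.abs.const_mul 2)).mono fun n ω => le_of_eq (congrArg _ (by ring))
  have o2 : NullInProb P fun n ω =>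
      (lam + lam * |q n ω| + |g n ω| + η₃ n ω + lam * S n ω ^ 2) / n :=
    (ni.mul_bdd (((((BddInProb.const lam).add (oq.abs.const_mul lam)).add og.abs).add
      oη₃.bdd).add (oS.pow_two.const_mul lam))).mono fun n ω => le_of_eq (congrArg _ (by ring))
  refine ⟨γ, a, fun n ω => η₃ n ω + 2 / δ * (2 * η₄ n ω ^ 2), hγ2, ha2,
    oη₃.add ((NullInProb.const_mul 2 (X := fun n ω => η₄ n ω ^ 2)
      (by simpa only [pow_two] using oη₄.mul_bdd oη₄.bdd)).const_mul (2 / δ)), ?_⟩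
  refine (((hform.and (o1.whp_lt (half_pos one_pos))).and (o2.whp_lt hδ0)).and
    (WHP.of_eventually (eventually_gt_atTop 0))).mono fun n ω hω => ?_
  obtain ⟨⟨⟨hf, h1⟩, h2⟩, hn⟩ := hω
  have hn' : (0 : ℝ) < n := by exact_mod_cast hn
  have hnz : NeZero n := ⟨hn.ne'⟩
  have hs0 : 0 < √(n : ℝ) := Real.sqrt_pos.2 hn'
  have hss : (n : ℝ) = √(n : ℝ) * √(n : ℝ) := (Real.mul_self_sqrt hn'.le).symm
  have hv : ‖sampleVec φ (u n ω)‖ ^ 2 = n := by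
    rw [norm_sampleVec_sq]
    simp [hφ]
  obtain ⟨s, y, hy, hs, hvs, hyr, hgy⟩ := exists_approx_eigenvector (F := F)
    (v := sampleVec φ (u n ω)) (f := fun k => sampleVec (e k) (u n ω))
    (A := kernelLin K (u n ω))
    (D := diagLin (fun x => ∑ k ∈ F, val k * (e k x * e k x)) (u n ω))
    (R := kernelLin R (u n ω)) (val := val) (c := c) (z := fun k => z k n ω)
    (b := fun k => b k n ω) (κ := fun k => κ k n ω) (ε := fun k l => ε k l n ω) (lam := lam)
    (N := n) (s₀ := √(n : ℝ)) (B := B) (C := |C₀|) (a := a n ω) (γ := γ n ω) hlam hs0 hss hB0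
    (abs_nonneg _) hval (fun _ => rfl)
    (fun w => kernelLin_eq_of_sq_eq_one hφ F (u n ω) w) hv
    (fun k => by
      rw [inner_sampleVec]
      simp only [hz, scoreSum]
      field_simp
      rfl)
    (fun k l => by
      simp only [hε, add_sub_cancel]
      field_simp)
    (fun k hk => by
      refine (le_abs_self _).trans (abs_le_of_sq_le_sq ?_ (by positivity))
      rw [norm_sampleVec_sq, mul_pow, Real.sq_sqrt hn'.le]
      have h3 : |M k| ≤ B := Finset.single_le_sum (f := fun k => |M k|)
        (fun k _ => abs_nonneg _) hk
      have h4 : ∀ i : Fin n, e k (u n ω i) ^ 2 ≤ B ^ 2 := fun i => by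
        rw [← sq_abs (e k _)]
        exact pow_le_pow_left₀ (abs_nonneg _)
          ((hM k _).trans ((le_abs_self _).trans h3)) 2
      refine (Finset.sum_le_sum fun i _ => h4 i).trans_eq ?_
      simp
      ring)
    (fun w => norm_diagLin_le hC₀ _ w)
    (inner_diagLin_sampleVec hφ F hn (u n ω))
    (kernelLin_isSymmetric (h.remainder_symm F) _)
    (fun k => (mul_div_cancel₀ _ hn'.ne').symm) (mul_div_cancel₀ _ hn'.ne').symm
    (mul_div_cancel₀ _ hn'.ne').symm (fun k => (mul_div_cancel₀ _ hn'.ne').symm)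
    (h := fun k => hh k n ω) (fun k => rfl) (q := q n ω) (S := S n ω) (η := η n ω) rfl rfl rfl
  have hfin := abs_top_sub_le (kernelLin_isSymmetric h.symm (u n ω))
    (isTop_maxEigenvalue (kernelMatrix_isHermitian h.symm (u n ω))) (m := m) (c := δ)
    (r := a n ω + η₄ n ω) (g := g n ω) (η := η₂ n ω) hlam hδ0
    (by rw [hδ]; ring) hn' hv hy hs hvs hyr hgy hf (lt_of_abs_lt h1) (lt_of_abs_lt h2)
  have hX : lam * q n ω + g n ω = truncStat U lam φ val e F n ω + γ n ω := by
    simp only [hq, hg, truncStat, Finset.sum_sub_distrib, Finset.mul_sum, ← mul_assoc]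
    ring
  rw [hX] at hfin
  have h5 : maxEigenvalue (kernelMatrix K (u n ω)) - lam * (n - 1) - truncStat U lam φ val e F n ω =
      (maxEigenvalue (kernelMatrix K (u n ω)) - lam * (n - 1) -
        (truncStat U lam φ val e F n ω + γ n ω)) + γ n ω := by ring
  have h6 : 2 / δ * (a n ω + η₄ n ω) ^ 2 ≤ 2 / δ * (2 * a n ω ^ 2 + 2 * η₄ n ω ^ 2) := by
    refine mul_le_mul_of_nonneg_left ?_ (by positivity)
    nlinarith [sq_nonneg (a n ω - η₄ n ω)]
  change |maxEigenvalue (kernelMatrix K (u n ω)) - lam * (n - 1) -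
    truncStat U lam φ val e F n ω| ≤ _
  rw [h5]
  refine (abs_add_le _ _).trans ((add_le_add_left hfin _).trans ?_)
  simp only [hη₃]
  linarith

end EigenExpansion

/-! ### Weak convergence: linear projections and approximation -/

section WeakLimits

variable {Ω Ω' : Type*} [MeasurableSpace Ω] [MeasurableSpace Ω'] {P : Measure Ω}
  [IsProbabilityMeasure P] {P' : Measure Ω'} [IsProbabilityMeasure P']

/-- A linear combination of independent standard Gaussian variables is Gaussian. -/
theorem hasLaw_sum_mul_gaussian {κ : Type*} {Z : κ → Ω' → ℝ}
    (hZ : ∀ i, HasLaw (Z i) (gaussianReal 0 1) P') (hind : iIndepFun Z P') (F : Finset κ)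
    (t : κ → ℝ) :
    HasLaw (fun ω => ∑ k ∈ F, t k * Z k ω) (gaussianReal 0 (∑ k ∈ F, t k ^ 2).toNNReal) P' := by
  have hm : ∀ k, AEMeasurable (fun ω => t k * Z k ω) P' := fun k =>
    (hZ k).aemeasurable.const_mul _
  refine ⟨Finset.aemeasurable_fun_sum _ fun k _ => hm k, ?_⟩
  have : IsProbabilityMeasure (P'.map fun ω => ∑ k ∈ F, t k * Z k ω) :=
    Measure.isProbabilityMeasure_map (Finset.aemeasurable_fun_sum _ fun k _ => hm k)
  refine Measure.ext_of_charFun (funext fun s => ?_)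
  have hind' : iIndepFun (fun k ω => t k * Z k ω) P' :=
    hind.comp (fun k x => t k * x) fun k => measurable_const_mul _
  have h0 : 0 ≤ ∑ k ∈ F, t k ^ 2 := Finset.sum_nonneg fun k _ => sq_nonneg _
  rw [(hind'.restrict F).charFun_map_fun_finsetSum_eq_prod fun k _ => hm k]
  simp only [Finset.prod_apply, charFun_map_mul_comp (hZ _).aemeasurable, (hZ _).map_eq,
    charFun_gaussianReal, ← Complex.exp_sum]
  congr 1
  simp only [Complex.ofReal_zero, mul_zero, zero_mul, zero_sub, Real.coe_toNNReal _ h0,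
    Complex.ofReal_sum, Finset.sum_mul, Finset.sum_div, ← Finset.sum_neg_distrib]
  refine Finset.sum_congr rfl fun k _ => ?_
  push_cast
  ring

theorem charFun_map_toLp {κ : Type*} [Fintype κ] {V : Ω → κ → ℝ} (hV : AEMeasurable V P)
    (t : EuclideanSpace ℝ κ) :
    charFun (P.map fun ω => WithLp.toLp 2 (V ω)) t =
      charFun (P.map fun ω => ∑ k, t k * V ω k) 1 := by
  rw [charFun_apply, charFun_apply, integral_map, integral_map]
  · simp [PiLp.inner_apply]
  · fun_prop
  · exact Measurable.aestronglyMeasurable (by fun_prop)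
  · exact (WithLp.measurable_toLp 2 _).comp_aemeasurable hV
  · exact Measurable.aestronglyMeasurable (by fun_prop)

/-- The **Cramér–Wold device**: random vectors converge in distribution as soon as all their
linear projections do. -/
theorem tendstoInDistribution_of_forall_sum {κ : Type*} [Fintype κ] {X : ℕ → Ω → κ → ℝ}
    {Y : Ω' → κ → ℝ} (hX : ∀ n, AEMeasurable (X n) P) (hY : AEMeasurable Y P')
    (h : ∀ t : κ → ℝ, TendstoInDistribution (fun n ω => ∑ k, t k * X n ω k) atTop
      (fun ω => ∑ k, t k * Y ω k) (fun _ => P) P') :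
    TendstoInDistribution (fun n ω => WithLp.toLp 2 (X n ω)) atTop
      (fun ω => WithLp.toLp 2 (Y ω)) (fun _ => P) P' where
  forall_aemeasurable n := (WithLp.measurable_toLp 2 _).comp_aemeasurable (hX n)
  aemeasurable_limit := (WithLp.measurable_toLp 2 _).comp_aemeasurable hY
  tendsto := by
    refine ProbabilityMeasure.tendsto_iff_tendsto_charFun.2 fun t => ?_
    have h1 := ProbabilityMeasure.tendsto_iff_tendsto_charFun.1 (h t).tendsto 1
    simp only [ProbabilityMeasure.coe_mk] at h1 ⊢
    rw [charFun_map_toLp hY]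
    refine h1.congr fun n => ?_
    rw [charFun_map_toLp (hX n)]

/-- A bounded Lipschitz function has nearby expectations at random variables that are close in
probability. -/
theorem abs_integral_comp_sub_le {X Y : Ω → ℝ} (hX : AEMeasurable X P) (hY : AEMeasurable Y P)
    {F : ℝ → ℝ} {M : ℝ} {L : ℝ≥0} (hM : ∀ x y, dist (F x) (F y) ≤ M) (hL : LipschitzWith L F)
    {ε : ℝ} (hε : 0 < ε) (hXY : P {ω | ε ≤ |Y ω - X ω|} ≤ ENNReal.ofReal ε) :
    |∫ x, F x ∂(P.map Y) - ∫ x, F x ∂(P.map X)| ≤ (L + M) * ε := by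
  have hF := hL.continuous
  have hM0 : 0 ≤ M := dist_nonneg.trans (hM 0 0)
  have hint : ∀ {V : Ω → ℝ}, AEMeasurable V P → Integrable (fun ω => F (V ω)) P := fun {V} hV =>
    Integrable.of_bound (hF.measurable.comp_aemeasurable hV).aestronglyMeasurable (|F 0| + M)
      (ae_of_all _ fun ω => by
        have := (abs_sub_abs_le_abs_sub (F (V ω)) (F 0)).trans (hM (V ω) 0)
        rw [Real.norm_eq_abs]
        linarith)
  rw [integral_map hY hF.aestronglyMeasurable, integral_map hX hF.aestronglyMeasurable,
    ← integral_sub (hint hY) (hint hX)]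
  have hs : NullMeasurableSet {ω | ε ≤ |Y ω - X ω|} P :=
    nullMeasurableSet_le aemeasurable_const (hY.sub hX).abs
  have hi : Integrable ({ω | ε ≤ |Y ω - X ω|}.indicator fun _ => M) P :=
    (integrable_const M).indicator₀ hs
  calc |∫ ω, (F (Y ω) - F (X ω)) ∂P|
      ≤ ∫ ω, |F (Y ω) - F (X ω)| ∂P := abs_integral_le_integral_abs
    _ ≤ ∫ ω, (L * ε + {ω | ε ≤ |Y ω - X ω|}.indicator (fun _ => M) ω) ∂P := by
        refine integral_mono ((hint hY).sub (hint hX)).abs ((integrable_const _).add hi) fun ω => ?_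
        by_cases hω : ε ≤ |Y ω - X ω|
        · have h1 := hM (Y ω) (X ω)
          rw [Real.dist_eq] at h1
          have : 0 ≤ L * ε := by positivity
          simp only [Set.indicator, Set.mem_ofPred_eq, hω, if_true]
          linarith
        · have h1 := hL.dist_le_mul (Y ω) (X ω)
          rw [Real.dist_eq, Real.dist_eq] at h1
          simp only [Set.indicator, Set.mem_ofPred_eq, hω, if_false, add_zero]
          exact h1.trans (mul_le_mul_of_nonneg_left (not_le.1 hω).le L.2)
    _ = L * ε + M * P.real {ω | ε ≤ |Y ω - X ω|} := by
        rw [integral_add (integrable_const _) hi, integral_indicator₀ hs, setIntegral_const]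
        simp [mul_comm]
    _ ≤ (L + M) * ε := by
        have : P.real {ω | ε ≤ |Y ω - X ω|} ≤ ε := ENNReal.toReal_le_of_le_ofReal hε.le hXY
        nlinarith

/-- Random variables that can be approximated in probability, up to an arbitrary precision, by
sequences converging in distribution to approximations of `Y`, converge in distribution to `Y`. -/
theorem tendstoInDistribution_of_approx {W : ℕ → Ω → ℝ} {Y : Ω' → ℝ}
    (hW : ∀ n, AEMeasurable (W n) P) (hY : AEMeasurable Y P')
    (h : ∀ ε : ℝ, 0 < ε → ∃ (X : ℕ → Ω → ℝ) (X' : Ω' → ℝ),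
      TendstoInDistribution X atTop X' (fun _ => P) P' ∧
      (∀ᶠ n in atTop, P {ω | ε ≤ |W n ω - X n ω|} ≤ ENNReal.ofReal ε) ∧
      P' {ω | ε ≤ |Y ω - X' ω|} ≤ ENNReal.ofReal ε) :
    TendstoInDistribution W atTop Y (fun _ => P) P' := by
  refine ⟨hW, hY, tendsto_iff_forall_lipschitz_integral_tendsto.2 ?_⟩
  rintro F ⟨M, hM⟩ ⟨L, hL⟩
  rw [Metric.tendsto_atTop']
  intro δ hδ
  have hM0 : 0 ≤ M := dist_nonneg.trans (hM 0 0)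
  have hA : 0 < (L : ℝ) + M + 1 := by positivity
  -- With this `ε`, each of the two replacements costs at most `δ / 3`.
  set ε : ℝ := δ / 3 / (L + M + 1) with hε
  have hε0 : 0 < ε := by positivity
  have hεδ : (L + M) * ε ≤ δ / 3 := by
    have : (L + M + 1) * ε = δ / 3 := by rw [hε]; field_simp
    nlinarith
  obtain ⟨X, X', hXX', hWX, hYX⟩ := h ε hε0
  have hlim := tendsto_iff_forall_lipschitz_integral_tendsto.1 hXX'.tendsto
  have h1 := (Metric.tendsto_nhds.1 (hlim F ⟨M, hM⟩ ⟨L, hL⟩)) (δ / 3) (by positivity)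
  obtain ⟨N, hN⟩ := eventually_atTop.1 (h1.and hWX)
  refine ⟨N, fun n hn => ?_⟩
  obtain ⟨h2, h3⟩ := hN n hn.le
  have h4 := abs_integral_comp_sub_le (hXX'.forall_aemeasurable n) (hW n) hM hL hε0 h3
  have h5 := abs_integral_comp_sub_le hXX'.aemeasurable_limit hY hM hL hε0 hYX
  simp only [ProbabilityMeasure.coe_mk, Real.dist_eq] at h2 ⊢
  rw [abs_lt] at h2 ⊢
  rw [abs_le] at h4 h5
  constructor <;> linarith

end WeakLimits

/-! ### Orthogonal series of random variables -/

section OrthogonalSeries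

variable {Ω' : Type*} [MeasurableSpace Ω'] {P' : Measure Ω'}

/-- An orthogonal series with summable second moments converges unconditionally in `L²`. -/
theorem exists_hasL2Sum {κ : Type*} {X : κ → Ω' → ℝ} (hX : ∀ i, MemLp (X i) 2 P')
    (horth : ∀ i j, i ≠ j → ∫ ω, X i ω * X j ω ∂P' = 0)
    (hsum : Summable fun i => ∫ ω, X i ω ^ 2 ∂P') : ∃ S, HasL2Sum P' X S := by
  set f : κ → Lp ℝ 2 P' := fun i => (hX i).toLp (X i) with hf
  have hinner : ∀ i j, inner ℝ (f i) (f j) = ∫ ω, X i ω * X j ω ∂P' := fun i j => by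
    rw [L2.inner_def]
    refine integral_congr_ae ?_
    filter_upwards [(hX i).coeFn_toLp, (hX j).coeFn_toLp] with ω h1 h2
    simp only [hf, h1, h2, RCLike.inner_apply, conj_trivial]
    ring
  have hV : OrthogonalFamily ℝ (fun i => (ℝ ∙ f i : Submodule ℝ (Lp ℝ 2 P')))
      fun i => (ℝ ∙ f i).subtypeₗᵢ := by
    refine OrthogonalFamily.of_pairwise fun i j hij => ?_
    rw [Function.onFun, Submodule.isOrtho_span]
    rintro _ rfl _ rfl
    rw [hinner, horth i j hij]
  have hs : Summable f := by
    have := (hV.summable_iff_norm_sq_summable fun i => ⟨f i, Submodule.mem_span_singleton_self _⟩).2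
      (by
        refine hsum.congr fun i => ?_
        rw [Submodule.coe_norm, ← real_inner_self_eq_norm_sq, hinner]
        simp only [pow_two])
    exact this
  obtain ⟨S, hS⟩ := hs
  refine ⟨S, Lp.memLp S, ?_⟩
  have := (Lp.tendsto_Lp_iff_tendsto_eLpNorm' _ _).1 hS
  refine this.congr fun s => eLpNorm_congr_ae ?_
  have h1 : ∀ᵐ ω ∂P', ∀ i ∈ s, f i ω = X i ω :=
    (Finset.eventually_all s).2 fun i _ => (hX i).coeFn_toLp
  filter_upwards [h1, Lp.coeFn_finsetSum s f] with ω h2 h3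
  simp only [Pi.sub_apply, h3, Finset.sum_apply]
  rw [Finset.sum_congr rfl h2]

theorem exists_hasL2Sum_sq_sub_one [IsProbabilityMeasure P'] {κ : Type*} {Z : κ → Ω' → ℝ}
    (hZ : ∀ i, HasLaw (Z i) (gaussianReal 0 1) P') (hind : iIndepFun Z P') {a : κ → ℝ}
    (ha : Summable fun i => a i ^ 2) :
    ∃ S, HasL2Sum P' (fun i ω => a i * (Z i ω ^ 2 - 1)) S := by
  have h2 : MemLp (fun x : ℝ => x ^ 2) 2 (gaussianReal 0 1) := by
    rw [memLp_two_iff_integrable_sq (by fun_prop)]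
    refine (MemLp.integrable_norm_pow (p := 4)
      (memLp_id_gaussianReal' (μ := 0) (v := 1) 4 (by norm_num)) (by norm_num)).congr
        (ae_of_all _ fun x => ?_)
    simp only [id, Real.norm_eq_abs, (by decide : Even 4).pow_abs]
    ring
  have hg : MemLp (fun x : ℝ => x ^ 2 - 1) 2 (gaussianReal 0 1) := h2.sub (memLp_const 1)
  have hg0 : ∫ x, (x ^ 2 - 1) ∂(gaussianReal 0 1) = 0 := by
    have hv := variance_fun_id_gaussianReal (μ := 0) (v := 1)
    rw [variance_eq_integral (by fun_prop)] at hv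
    simp only [integral_id_gaussianReal, sub_zero] at hv
    rw [integral_sub (h2.integrable (by norm_num)) (integrable_const 1), hv]
    simp
  have hmeas : Measurable fun x : ℝ => x ^ 2 - 1 := by fun_prop
  have hL : ∀ i, MemLp (fun ω => Z i ω ^ 2 - 1) 2 P' := fun i => by
    rw [← (hZ i).map_eq] at hg
    exact hg.comp_of_map (hZ i).aemeasurable
  refine exists_hasL2Sum (fun i => (hL i).const_mul _) (fun i j hij => ?_) ?_
  · have h1 : IndepFun (fun ω => Z i ω ^ 2 - 1) (fun ω => Z j ω ^ 2 - 1) P' :=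
      (hind.indepFun hij).comp hmeas hmeas
    have h3 := h1.integral_fun_mul_eq_mul_integral (hL i).1 (hL j).1
    have h4 : ∫ ω, (Z i ω ^ 2 - 1) ∂P' = 0 := by
      rw [← hg0]
      exact (hZ i).integral_comp (f := fun x : ℝ => x ^ 2 - 1) hmeas.aestronglyMeasurable
    rw [h4, zero_mul] at h3
    have h5 : ∀ ω, a i * (Z i ω ^ 2 - 1) * (a j * (Z j ω ^ 2 - 1)) =
        a i * a j * ((Z i ω ^ 2 - 1) * (Z j ω ^ 2 - 1)) := fun ω => by ring
    simp only [h5, integral_const_mul, h3, mul_zero]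
  · refine (ha.mul_right (∫ x, (x ^ 2 - 1) ^ 2 ∂(gaussianReal 0 1))).congr fun i => ?_
    simp only [mul_pow, integral_const_mul]
    congr 1
    exact ((hZ i).integral_comp (f := fun x : ℝ => (x ^ 2 - 1) ^ 2)
      (hmeas.pow_const 2).aestronglyMeasurable).symm

end OrthogonalSeries

/-! ### The limit law when the top eigenfunction is constant -/

namespace EigenExpansion

variable {ι : Type*} {K : I → I → ℝ} {lam : ℝ} {φ : I → ℝ} {val : ι → ℝ} {e : ι → I → ℝ}
  {Ω Ω' : Type*} [MeasurableSpace Ω] [MeasurableSpace Ω'] {P : Measure Ω}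
  [IsProbabilityMeasure P] {P' : Measure Ω'} [IsProbabilityMeasure P'] {U : ℕ → Ω → I}
  {Z : ι → Ω' → ℝ}

theorem summable_sq_div (h : EigenExpansion K lam φ val e) (hval : Summable fun i => val i ^ 2) :
    Summable fun i => val i ^ 2 / (lam - val i) := by
  obtain ⟨m, hm0, hmlam, hm⟩ := h.gap
  refine (hval.div_const (lam - m)).of_nonneg_of_le (fun i => ?_) fun i => ?_
  · exact div_nonneg (sq_nonneg _) (by linarith [hm i])
  · exact div_le_div_of_nonneg_left (sq_nonneg _) (by linarith) (by linarith [hm i])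

theorem summable_coeff_sq (h : EigenExpansion K lam φ val e)
    (hval : Summable fun i => val i ^ 2) :
    Summable fun i => (lam * val i / (lam - val i)) ^ 2 := by
  obtain ⟨m, hm0, hmlam, hm⟩ := h.gap
  refine (hval.mul_left ((lam / (lam - m)) ^ 2)).of_nonneg_of_le (fun i => sq_nonneg _) fun i => ?_
  rw [mul_div_right_comm, mul_pow]
  refine mul_le_mul_of_nonneg_right (pow_le_pow_left₀ ?_ ?_ 2) (sq_nonneg _)
  · exact div_nonneg h.lam_pos.le (by linarith [hm i])
  · exact div_le_div_of_nonneg_left h.lam_pos.le (by linarith) (by linarith [hm i])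

theorem aemeasurable_comp {g : I → ℝ} (hg : Continuous g) (hU : ∀ i, HasLaw (U i) volume P)
    (i : ℕ) : AEMeasurable (fun ω => g (U i ω)) P :=
  hg.measurable.comp_aemeasurable (hU i).aemeasurable

theorem aemeasurable_scoreSum (h : EigenExpansion K lam φ val e)
    (hU : ∀ i, HasLaw (U i) volume P) (k : ι) (n : ℕ) :
    AEMeasurable (fun ω => scoreSum U φ e k n ω) P :=
  (Finset.aemeasurable_fun_sum Finset.univ fun (i : Fin n) _ => aemeasurable_comp
    (g := fun x => φ x * e k x) (h.continuous_phi.mul (h.continuous_eig k)) hU i).div_const _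

theorem integral_sum_eig_sq (h : EigenExpansion K lam φ val e) (hφ : ∀ x, φ x ^ 2 = 1)
    (F : Finset ι) (t : ι → ℝ) :
    ∫ x, (φ x * ∑ k ∈ F, t k * e k x) ^ 2 = ∑ k ∈ F, t k ^ 2 := by
  classical
  have h1 : ∀ x, (φ x * ∑ k ∈ F, t k * e k x) ^ 2 =
      ∑ k ∈ F, ∑ l ∈ F, t k * t l * (e k x * e l x) := fun x => by
    rw [mul_pow, hφ, one_mul, pow_two, Finset.sum_mul_sum]
    exact Finset.sum_congr rfl fun k _ => Finset.sum_congr rfl fun l _ => by ring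
  have hi : ∀ k l, Integrable (fun x => t k * t l * (e k x * e l x)) := fun k l =>
    (integrable_of_continuous ((h.continuous_eig k).mul (h.continuous_eig l))).const_mul _
  simp only [h1]
  rw [integral_finsetSum _ fun k _ => integrable_finsetSum _ fun l _ => hi k l]
  refine Finset.sum_congr rfl fun k hk => ?_
  rw [integral_finsetSum _ fun l _ => hi k l, Finset.sum_eq_single_of_mem k hk]
  · rw [integral_const_mul]
    simp only [← pow_two, h.integral_sq, mul_one]
  · intro l _ hlk
    rw [integral_const_mul, h.integral_mul k l hlk.symm, mul_zero]

/-- The central limit theorem for linear combinations of the scores. The coefficients are the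
coordinates of one function of the sample points in an orthonormal system, which gives the
variance. -/
theorem tendstoInDistribution_sum_scoreSum (h : EigenExpansion K lam φ val e)
    (hφ : ∀ x, φ x ^ 2 = 1) (hU : ∀ i, HasLaw (U i) volume P) (hind : iIndepFun U P)
    (hZ : ∀ i, HasLaw (Z i) (gaussianReal 0 1) P') (hZind : iIndepFun Z P') (F : Finset ι)
    (t : ι → ℝ) :
    TendstoInDistribution (fun n ω => ∑ k ∈ F, t k * scoreSum U φ e k n ω) atTop
      (fun ω => ∑ k ∈ F, t k * Z k ω) (fun _ => P) P' := by
  set g : I → ℝ := fun x => φ x * ∑ k ∈ F, t k * e k x with hg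
  have hgc : Continuous g := h.continuous_phi.mul
    (continuous_finsetSum _ fun k _ => continuous_const.mul (h.continuous_eig k))
  obtain ⟨C, hC⟩ := exists_abs_le_of_continuous hgc
  have hg0 : ∫ x, g x = 0 := by
    have h1 : ∀ x, g x = ∑ k ∈ F, t k * (φ x * e k x) := fun x => by
      simp only [hg, Finset.mul_sum]
      exact Finset.sum_congr rfl fun k _ => by ring
    simp only [h1]
    rw [integral_finsetSum _ fun k _ => (integrable_of_continuous (f := fun x => φ x * e k x)
      (h.continuous_phi.mul (h.continuous_eig k))).const_mul _]
    simp only [integral_const_mul, h.integral_phi_mul, mul_zero, Finset.sum_const_zero]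
  have hmean : ∫ ω, g (U 0 ω) ∂P = 0 := by
    rw [← hg0]
    exact (hU 0).integral_comp (f := g) hgc.measurable.aestronglyMeasurable
  have hvar : Var[fun ω => g (U 0 ω); P] = ∑ k ∈ F, t k ^ 2 := by
    rw [variance_eq_integral (aemeasurable_comp hgc hU 0), hmean, ← h.integral_sum_eig_sq hφ F t]
    simp only [sub_zero]
    exact (hU 0).integral_comp (f := fun x => g x ^ 2)
      (hgc.pow 2).measurable.aestronglyMeasurable
  have hclt := tendstoInDistribution_inv_sqrt_mul_sum_sub (P := P)
    (X := fun i ω => g (U i ω)) (P' := P') (Y := fun ω => ∑ k ∈ F, t k * Z k ω)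
    (by rw [hvar]; exact hasLaw_sum_mul_gaussian hZ hZind F t)
    (MemLp.of_bound (aemeasurable_comp hgc hU 0).aestronglyMeasurable C
      (ae_of_all _ fun ω => hC _))
    (hind.comp (fun _ => g) fun _ => hgc.measurable)
    (fun i => (IdentDistrib.mk (hU i).aemeasurable (hU 0).aemeasurable
      (by rw [(hU i).map_eq, (hU 0).map_eq])).comp hgc.measurable)
  convert! hclt using 3 with n ω
  rw [hmean, mul_zero, sub_zero, Finset.sum_range fun k => g (U k ω)]
  simp only [scoreSum, hg, Finset.mul_sum, ← mul_div_assoc, ← Finset.sum_div]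
  rw [Finset.sum_comm, div_eq_inv_mul, Finset.mul_sum]
  refine Finset.sum_congr rfl fun i _ => ?_
  rw [Finset.mul_sum]
  exact Finset.sum_congr rfl fun k _ => by ring

theorem tendstoInDistribution_truncStat (h : EigenExpansion K lam φ val e)
    (hφ : ∀ x, φ x ^ 2 = 1) (hU : ∀ i, HasLaw (U i) volume P) (hind : iIndepFun U P)
    (hZ : ∀ i, HasLaw (Z i) (gaussianReal 0 1) P') (hZind : iIndepFun Z P') (F : Finset ι) :
    TendstoInDistribution (fun n ω => truncStat U lam φ val e F n ω) atTop
      (fun ω => ∑ k ∈ F, (lam * (val k / (lam - val k)) * Z k ω ^ 2 - val k))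
      (fun _ => P) P' := by
  have h1 := tendstoInDistribution_of_forall_sum (P := P) (P' := P')
    (X := fun n ω (k : F) => scoreSum U φ e k n ω) (Y := fun ω (k : F) => Z k ω)
    (fun n => aemeasurable_pi_lambda _ fun k => h.aemeasurable_scoreSum hU k n)
    (aemeasurable_pi_lambda _ fun k => (hZ k).aemeasurable) fun t => by
      classical
      have := h.tendstoInDistribution_sum_scoreSum hφ hU hind hZ hZind F
        (fun k => if hk : k ∈ F then t ⟨k, hk⟩ else 0)
      simpa only [← Finset.sum_coe_sort F, Finset.coe_mem, dite_true] using this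
  have h2 := h1.continuous_comp (g := fun v : EuclideanSpace ℝ F =>
    ∑ k : F, (lam * (val k / (lam - val k)) * v k ^ 2 - val k)) (by fun_prop)
  have h3 : ∀ g : ι → ℝ, ∑ k ∈ F, g k = ∑ k : F, g k := fun g => (Finset.sum_coe_sort F g).symm
  simp only [truncStat, h3]
  exact h2

/-- If `φ` is constant then the top eigenvalue has a weighted chi-square limit law. -/
theorem tendstoInDistribution_of_sq_eq_one (h : EigenExpansion K lam φ val e)
    (hval : Summable fun i => val i ^ 2) (hφ : ∀ x, φ x ^ 2 = 1)
    (hU : ∀ i, HasLaw (U i) volume P) (hind : iIndepFun U P)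
    (hZ : ∀ i, HasLaw (Z i) (gaussianReal 0 1) P') (hZind : iIndepFun Z P') :
    ∃ S : Ω' → ℝ,
      HasL2Sum P' (fun i ω => lam * val i / (lam - val i) * (Z i ω ^ 2 - 1)) S ∧
      TendstoInDistribution (fun (n : ℕ) ω =>
          maxEigenvalue (kernelMatrix K fun i : Fin n => U i ω) - ((n : ℝ) - 1) * lam) atTop
        (fun ω => S ω + ∑' i, val i ^ 2 / (lam - val i)) (fun _ => P) P' := by
  classical
  obtain ⟨S, hS⟩ := exists_hasL2Sum_sq_sub_one hZ hZind (h.summable_coeff_sq hval)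
  refine ⟨S, hS, ?_⟩
  have hSm : AEMeasurable S P' := hS.1.1.aemeasurable
  refine tendstoInDistribution_of_approx (fun n => ?_) (hSm.add_const _) fun ε hε => ?_
  · exact ((measurable_maxEigenvalue_kernelMatrix h.continuous_kernel.measurable h.symm
      n).comp_aemeasurable (aemeasurable_pi_lambda (fun ω (i : Fin n) => U i ω)
        fun i => (hU i).aemeasurable)).sub_const _
  obtain ⟨m, hm0, hmlam, hm⟩ := h.gap
  obtain ⟨C, hC, hbound⟩ := h.exists_truncation_bound hφ hU hind
  set δ : Finset ι → ℝ := fun F => ∫ x, ∫ y, remainder K lam φ val e F x y ^ 2 with hδ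
  have hδlim : Tendsto δ atTop (𝓝 0) := h.tendsto_remainder
  set r : ℝ := √(ε / 3 / C) with hr
  have hr0 : 0 < r := Real.sqrt_pos.2 (by positivity)
  -- Choose a truncation with small remainders, both for the kernel and for the limit.
  have ev1 : ∀ᶠ F in atTop, 2 * δ F / (ε / 3) ^ 2 < ε / 4 := by
    have : Tendsto (fun F => 2 * δ F / (ε / 3) ^ 2) atTop (𝓝 (2 * 0 / (ε / 3) ^ 2)) :=
      (hδlim.const_mul 2).div_const _
    exact this.eventually_lt_const (by simp; positivity)
  have ev2 : ∀ᶠ F in atTop, δ F / r ^ 2 < ε / 4 := by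
    have : Tendsto (fun F => δ F / r ^ 2) atTop (𝓝 (0 / r ^ 2)) := hδlim.div_const _
    exact this.eventually_lt_const (by simp; positivity)
  have ev3 : ∀ᶠ F in atTop, P' {ω | ε / 2 ≤ |∑ i ∈ F, lam * val i / (lam - val i) *
      (Z i ω ^ 2 - 1) - S ω|} ≤ ENNReal.ofReal ε := by
    have := tendstoInMeasure_of_tendsto_eLpNorm (p := 2) (by norm_num) (fun F =>
      (Finset.aemeasurable_fun_sum F fun i _ =>
        (((hZ i).aemeasurable.pow_const 2).sub_const 1).const_mul
          (lam * val i / (lam - val i))).aestronglyMeasurable) hSm.aestronglyMeasurable hS.2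
    rw [tendstoInMeasure_iff_norm] at this
    exact (this (ε / 2) (half_pos hε)).eventually_le_const (ENNReal.ofReal_pos.2 hε)
  have ev4 : ∀ᶠ F : Finset ι in atTop, |∑ i ∈ F, val i ^ 2 / (lam - val i) -
      ∑' i, val i ^ 2 / (lam - val i)| < ε / 2 :=
    Metric.tendsto_nhds.1 (h.summable_sq_div hval).hasSum (ε / 2) (half_pos hε)
  obtain ⟨F, ⟨e1, e2⟩, e3, e4⟩ := ((ev1.and ev2).and (ev3.and ev4)).exists
  obtain ⟨γ, a, η, hγ, ha, hη, hwhp⟩ := hbound F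
  refine ⟨_, _, h.tendstoInDistribution_truncStat hφ hU hind hZ hZind F, ?_, ?_⟩
  · have hε4 : 0 < ε / 4 := by positivity
    filter_upwards [hwhp (ε / 4) hε4, (hη.whp_lt (ε := ε / 3) (by positivity)) (ε / 4) hε4]
      with n hn1 hn2
    have hn3 := (measure_abs_ge_le (hγ n).1 (hγ n).2 (ε := ε / 3) (by positivity)).trans
      (ENNReal.ofReal_le_ofReal e1.le)
    have hn4 := (measure_abs_ge_le (ha n).1 (ha n).2 hr0).trans
      (ENNReal.ofReal_le_ofReal e2.le)
    have h12 := measure_le_add_of_imp (fun ω hω => hω) hε4.le hε4.le hn1 hn2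
    have h34 := measure_le_add_of_imp (fun ω hω => hω) hε4.le hε4.le hn3 hn4
    have := measure_le_add_of_imp (a := fun ω => ε ≤
      |maxEigenvalue (kernelMatrix K fun i : Fin n => U i ω) - ((n : ℝ) - 1) * lam -
        truncStat U lam φ val e F n ω|) (fun ω hω => by
      by_contra! hcon
      obtain ⟨⟨c1, c2⟩, c3, c4⟩ := hcon
      have c5 : a n ω ^ 2 < ε / 3 / C := by
        rw [← sq_abs, ← Real.sq_sqrt (show 0 ≤ ε / 3 / C by positivity)]
        exact pow_lt_pow_left₀ c4 (abs_nonneg _) two_ne_zero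
      rw [lt_div_iff₀ hC] at c5
      rw [mul_comm lam] at c1
      linarith [le_abs_self (η n ω)]) (by positivity) (by positivity) h12 h34
    refine this.trans (ENNReal.ofReal_le_ofReal (by linarith))
  · refine (measure_mono fun ω hω => ?_).trans e3
    -- Centring the squares leaves `lam * val k / (lam - val k) - val k`, the deterministic term.
    have hid : ∑ k ∈ F, (lam * (val k / (lam - val k)) * Z k ω ^ 2 - val k) =
        ∑ i ∈ F, lam * val i / (lam - val i) * (Z i ω ^ 2 - 1) +
          ∑ i ∈ F, val i ^ 2 / (lam - val i) := by
      rw [← Finset.sum_add_distrib]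
      refine Finset.sum_congr rfl fun i _ => ?_
      have : lam - val i ≠ 0 := by linarith [hm i]
      field_simp
      ring
    simp only [Set.mem_ofPred_eq, hid] at hω ⊢
    rw [abs_lt] at e4
    rw [le_abs] at hω ⊢
    rcases hω with hω | hω
    · right; linarith
    · left; linarith

end EigenExpansion

/-! ### The integral operator is symmetric and compact -/

section Operator

variable {K : I → I → ℝ} {L : ℝ≥0}

theorem memLp_of_continuous {f : I → ℝ} (hf : Continuous f) : MemLp f 2 (volume : Measure I) := by
  obtain ⟨C, hC⟩ := exists_abs_le_of_continuous hf
  exact MemLp.of_bound hf.aestronglyMeasurable C (ae_of_all _ hC)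

theorem memLp_section (hK : Continuous (Function.uncurry K)) (x : I) :
    MemLp (K x) 2 (volume : Measure I) :=
  memLp_of_continuous (hK.comp (Continuous.prodMk_right x))

/-- The section `K x` of the kernel as an element of `L²[0,1]`. -/
noncomputable def kernelSection (hK : Continuous (Function.uncurry K)) (x : I) : L2 :=
  (memLp_section hK x).toLp (K x)

theorem inner_kernelSection (hK : Continuous (Function.uncurry K)) (x : I) (f : L2) :
    ⟪kernelSection hK x, f⟫ = ∫ y, K x y * f y := by
  rw [L2.inner_def]
  refine integral_congr_ae ?_
  filter_upwards [(memLp_section hK x).coeFn_toLp] with y hy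
  rw [RCLike.inner_apply, conj_trivial, kernelSection, hy, mul_comm]

theorem norm_L2_le_of_ae_abs_le {f : L2} {C : ℝ} (hC : 0 ≤ C) (h : ∀ᵐ x, |f x| ≤ C) :
    ‖f‖ ≤ C := by
  have h1 : measureUnivNNReal (volume : Measure I) = 1 := by simp [measureUnivNNReal]
  simpa [h1] using Lp.norm_le_of_ae_bound (f := f) hC h

theorem norm_kernelSection_le (hK : Continuous (Function.uncurry K)) (hb : ∀ x y, |K x y| ≤ 1)
    (x : I) : ‖kernelSection hK x‖ ≤ 1 := by
  refine norm_L2_le_of_ae_abs_le zero_le_one ?_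
  filter_upwards [(memLp_section hK x).coeFn_toLp] with y hy
  rw [kernelSection, hy]
  exact hb x y

theorem lipschitzWith_kernelSection (hlip : LipschitzWith L (Function.uncurry K)) :
    LipschitzWith L (kernelSection hlip.continuous) := by
  refine LipschitzWith.of_dist_le_mul fun x x' => ?_
  rw [dist_eq_norm]
  refine norm_L2_le_of_ae_abs_le (by positivity) ?_
  filter_upwards [(memLp_section hlip.continuous x).coeFn_toLp,
    (memLp_section hlip.continuous x').coeFn_toLp,
    Lp.coeFn_sub (kernelSection hlip.continuous x) (kernelSection hlip.continuous x')]
    with y h1 h2 h3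
  rw [h3, Pi.sub_apply, kernelSection, kernelSection, h1, h2]
  have := hlip.dist_le_mul (x, y) (x', y)
  simpa [Prod.dist_eq, Real.dist_eq] using this

theorem kernelOp_ae_eq (hK : Continuous (Function.uncurry K)) (f : L2) :
    kernelOp K hK f =ᵐ[volume] fun x => ⟪kernelSection hK x, f⟫ := by
  filter_upwards [(memLp_kernel_integral hK f).coeFn_toLp] with x hx
  rw [inner_kernelSection]
  exact hx

theorem norm_kernelOp_le (hK : Continuous (Function.uncurry K)) (hb : ∀ x y, |K x y| ≤ 1)
    (f : L2) : ‖kernelOp K hK f‖ ≤ ‖f‖ := by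
  refine norm_L2_le_of_ae_abs_le (norm_nonneg f) ?_
  filter_upwards [kernelOp_ae_eq hK f] with x hx
  rw [hx]
  calc |⟪kernelSection hK x, f⟫| ≤ ‖kernelSection hK x‖ * ‖f‖ := abs_real_inner_le_norm _ _
    _ ≤ 1 * ‖f‖ := by gcongr; exact norm_kernelSection_le hK hb x
    _ = ‖f‖ := one_mul _

theorem kernelOp_isSymmetric (hK : Continuous (Function.uncurry K))
    (hsymm : ∀ x y, K x y = K y x) : (kernelOp K hK).IsSymmetric := fun f g => by
  obtain ⟨C, hC⟩ := isCompact_univ.exists_bound_of_continuousOn hK.continuousOn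
  have h1 : ⟪kernelOp K hK f, g⟫ = ∫ x, ∫ y, g x * (K x y * f y) := by
    rw [L2.inner_def]
    refine integral_congr_ae ?_
    filter_upwards [kernelOp_ae_eq hK f] with x hx
    rw [RCLike.inner_apply, conj_trivial, hx, inner_kernelSection, integral_const_mul]
  have h2 : ⟪f, kernelOp K hK g⟫ = ∫ y, ∫ x, g x * (K x y * f y) := by
    rw [L2.inner_def]
    refine integral_congr_ae ?_
    filter_upwards [kernelOp_ae_eq hK g] with y hy
    rw [RCLike.inner_apply, conj_trivial, hy, inner_kernelSection, ← integral_mul_const]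
    refine integral_congr_ae (ae_of_all _ fun x => ?_)
    simp only [hsymm x y]
    ring
  rw [h1, h2]
  refine integral_integral_swap ?_
  have hi : ∀ f : L2, Integrable (fun x => f x) (volume : Measure I) := fun f =>
    (Lp.memLp f).integrable (by norm_num)
  refine (((hi g).mul_prod (hi f)).bdd_mul hK.aestronglyMeasurable
    (ae_of_all _ fun p => hC p (Set.mem_univ p))).congr (ae_of_all _ fun p => ?_)
  simp only [Function.uncurry]
  ring

/-- The integral operator as a bounded operator. -/
noncomputable def kernelCLM (hK : Continuous (Function.uncurry K)) (hb : ∀ x y, |K x y| ≤ 1) :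
    L2 →L[ℝ] L2 :=
  (kernelOp K hK).mkContinuous 1 fun f => by simpa using norm_kernelOp_le hK hb f

theorem isCompactOperator_kernelCLM (hlip : LipschitzWith L (Function.uncurry K))
    (hb : ∀ x y, |K x y| ≤ 1) : IsCompactOperator (kernelCLM hlip.continuous hb) := by
  set k := kernelSection hlip.continuous with hk
  have hbd : ∀ f : L2, ‖f‖ ≤ 1 → ∀ x, ⟪k x, f⟫ ∈ Set.Icc (-1 : ℝ) 1 := fun f hf x => by
    rw [Set.mem_Icc, ← abs_le]
    calc |⟪k x, f⟫| ≤ ‖k x‖ * ‖f‖ := abs_real_inner_le_norm _ _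
      _ ≤ 1 * 1 := by gcongr; exact norm_kernelSection_le hlip.continuous hb x
      _ = 1 := one_mul 1
  have hLip : ∀ f : L2, ‖f‖ ≤ 1 → LipschitzWith L fun x => ⟪k x, f⟫ := fun f hf =>
    LipschitzWith.of_dist_le_mul fun x x' => by
      rw [Real.dist_eq, ← inner_sub_left]
      calc |⟪k x - k x', f⟫| ≤ ‖k x - k x'‖ * ‖f‖ := abs_real_inner_le_norm _ _
        _ ≤ (L * dist x x') * 1 := by
          gcongr
          rw [← dist_eq_norm]
          exact (lipschitzWith_kernelSection hlip).dist_le_mul x x'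
        _ = L * dist x x' := mul_one _
  -- The image of the unit ball is uniformly bounded and equi-Lipschitz.
  set A : Set (BoundedContinuousFunction I ℝ) :=
    {g | ∃ f : L2, ‖f‖ ≤ 1 ∧ ∀ x, g x = ⟪k x, f⟫} with hA
  have hcpt : IsCompact (closure A) := by
    refine BoundedContinuousFunction.arzela_ascoli (Set.Icc (-1) 1) isCompact_Icc A ?_ ?_
    · rintro g x ⟨f, hf, hg⟩
      rw [hg]
      exact hbd f hf x
    · refine LipschitzWith.uniformEquicontinuous _ L (fun g => ?_) |>.equicontinuous
      obtain ⟨g, f, hf, hg⟩ := g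
      have : (g : I → ℝ) = fun x => ⟪k x, f⟫ := funext hg
      simp only [this]
      exact hLip f hf
  refine ⟨BoundedContinuousFunction.toLp 2 volume ℝ '' closure A,
    hcpt.image (ContinuousLinearMap.continuous _),
    mem_of_superset (Metric.closedBall_mem_nhds 0 one_pos) fun f hf => ?_⟩
  rw [mem_closedBall_zero_iff] at hf
  refine ⟨BoundedContinuousFunction.mkOfCompact ⟨fun x => ⟪k x, f⟫, (hLip f hf).continuous⟩,
    subset_closure ⟨f, hf, fun x => rfl⟩, ?_⟩
  refine Lp.ext ?_
  filter_upwards [BoundedContinuousFunction.coeFn_toLp (p := 2) (μ := (volume : Measure I)) ℝ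
    (BoundedContinuousFunction.mkOfCompact ⟨fun x => ⟪k x, f⟫, (hLip f hf).continuous⟩),
    kernelOp_ae_eq hlip.continuous f] with x h1 h2
  rw [h1]
  exact h2.symm

theorem abs_eigenvalue_le_one (hK : Continuous (Function.uncurry K)) (hb : ∀ x y, |K x y| ≤ 1)
    {μ : ℝ} (hμ : (kernelOp K hK).HasEigenvalue μ) : |μ| ≤ 1 := by
  obtain ⟨v, hv, hv0⟩ := hμ.exists_hasEigenvector
  have h1 := norm_kernelOp_le hK hb v
  rw [Module.End.mem_eigenspace_iff.1 hv, norm_smul, Real.norm_eq_abs] at h1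
  exact le_of_mul_le_mul_right (by simpa using h1) (norm_pos_iff.2 hv0)

end Operator

/-! ### Positive eigenvalues and the spectral gap of the integral operator -/

section Spectrum

variable {K : I → I → ℝ} {L : ℝ≥0}

theorem norm_sq_kernelOp (hK : Continuous (Function.uncurry K)) (f : L2) :
    ‖kernelOp K hK f‖ ^ 2 = ∫ x, ⟪kernelSection hK x, f⟫ ^ 2 := by
  rw [← real_inner_self_eq_norm_sq, L2.inner_def]
  refine integral_congr_ae ?_
  filter_upwards [kernelOp_ae_eq hK f] with x hx
  rw [RCLike.inner_apply, conj_trivial, hx, pow_two]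

theorem continuous_kernelSection (hlip : LipschitzWith L (Function.uncurry K)) :
    Continuous (kernelSection hlip.continuous) :=
  (lipschitzWith_kernelSection hlip).continuous

theorem continuous_inner_kernelSection (hlip : LipschitzWith L (Function.uncurry K)) (f : L2) :
    Continuous fun x => ⟪kernelSection hlip.continuous x, f⟫ :=
  (continuous_kernelSection hlip).inner continuous_const

/-- The eigenvalues of the integral operator along an orthonormal family of eigenvectors are
square summable, with sum at most `∫∫ K² ≤ 1`. -/
theorem sum_sq_eigenvalue_le_one (hlip : LipschitzWith L (Function.uncurry K))
    (hb : ∀ x y, |K x y| ≤ 1) {κ : Type*} {v : κ → L2} (hv : Orthonormal ℝ v) {c : κ → ℝ}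
    (hc : ∀ i, kernelOp K hlip.continuous (v i) = c i • v i) (F : Finset κ) :
    ∑ i ∈ F, c i ^ 2 ≤ 1 := by
  have h1 : ∀ i, c i ^ 2 = ∫ x, ⟪kernelSection hlip.continuous x, v i⟫ ^ 2 := fun i => by
    rw [← norm_sq_kernelOp, hc, norm_smul, hv.1, mul_one, Real.norm_eq_abs, sq_abs]
  have hi : ∀ i, Integrable fun x => ⟪kernelSection hlip.continuous x, v i⟫ ^ 2 := fun i =>
    integrable_of_continuous ((continuous_inner_kernelSection hlip (v i)).pow 2)
  simp only [h1]
  rw [← integral_finsetSum _ fun i _ => hi i]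
  calc ∫ x, ∑ i ∈ F, ⟪kernelSection hlip.continuous x, v i⟫ ^ 2 ≤ ∫ _ : I, (1 : ℝ) := by
        refine integral_mono (integrable_finsetSum _ fun i _ => hi i) (integrable_const 1)
          fun x => ?_
        have h2 := hv.sum_inner_products_le (kernelSection hlip.continuous x) (s := F)
        simp only [Real.norm_eq_abs, sq_abs, real_inner_comm _ (v _)] at h2
        have h3 := norm_kernelSection_le hlip.continuous hb x
        have h4 := norm_nonneg (kernelSection hlip.continuous x)
        exact h2.trans (by nlinarith)
    _ = 1 := by simp

theorem coe_kernelCLM (hK : Continuous (Function.uncurry K)) (hb : ∀ x y, |K x y| ≤ 1) :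
    (kernelCLM hK hb : Module.End ℝ L2) = kernelOp K hK :=
  LinearMap.mkContinuous_coe _ _ _

theorem finiteDimensional_eigenspace_kernelOp (hlip : LipschitzWith L (Function.uncurry K))
    (hb : ∀ x y, |K x y| ≤ 1) {μ : ℝ} (hμ : μ ≠ 0) :
    FiniteDimensional ℝ ((kernelOp K hlip.continuous).eigenspace μ) := by
  rw [← coe_kernelCLM hlip.continuous hb]
  exact ContinuousLinearMap.finite_dimensional_eigenspace (isCompactOperator_kernelCLM hlip hb) μ hμ

theorem orthogonal_iSup_eigenspace_kernelOp (hlip : LipschitzWith L (Function.uncurry K))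
    (hb : ∀ x y, |K x y| ≤ 1) (hsymm : ∀ x y, K x y = K y x) :
    (⨆ μ, (kernelOp K hlip.continuous).eigenspace μ)ᗮ = ⊥ := by
  have h := kernelOp_isSymmetric hlip.continuous hsymm
  rw [← coe_kernelCLM hlip.continuous hb] at h ⊢
  exact ContinuousLinearMap.orthogonalComplement_iSup_eigenspaces_eq_bot
    (isCompactOperator_kernelCLM hlip hb) h

theorem finite_setOf_hasEigenvalue_ge (hlip : LipschitzWith L (Function.uncurry K))
    (hb : ∀ x y, |K x y| ≤ 1) (hsymm : ∀ x y, K x y = K y x) {t : ℝ} (ht : 0 < t) :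
    {μ : ℝ | t ≤ μ ∧ (kernelOp K hlip.continuous).HasEigenvalue μ}.Finite := by
  set T := kernelOp K hlip.continuous with hT
  have hex : ∀ μ : {μ : ℝ | t ≤ μ ∧ T.HasEigenvalue μ}, ∃ v : T.eigenspace μ, ‖v‖ = 1 := fun μ => by
    obtain ⟨w, hw, hw0⟩ := μ.2.2.exists_hasEigenvector
    refine ⟨⟨‖w‖⁻¹ • w, Submodule.smul_mem _ _ hw⟩, ?_⟩
    rw [Submodule.coe_norm, norm_smul, norm_inv, norm_norm,
      inv_mul_cancel₀ (norm_ne_zero_iff.2 hw0)]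
  choose v hv using hex
  have horth : Orthonormal ℝ fun μ => (v μ : L2) := by
    refine ⟨fun μ => hv μ, fun μ ν hμν => ?_⟩
    exact (kernelOp_isSymmetric hlip.continuous hsymm).orthogonalFamily_eigenspaces
      (fun h => hμν (Subtype.ext h)) (v μ) (v ν)
  have hsum := sum_sq_eigenvalue_le_one hlip hb horth (c := fun μ => (μ : ℝ))
    fun μ => Module.End.mem_eigenspace_iff.1 (v μ).2
  by_contra hinf
  obtain ⟨N, hN⟩ := exists_nat_gt (1 / t ^ 2)
  have : Infinite {μ : ℝ | t ≤ μ ∧ T.HasEigenvalue μ} := Set.infinite_coe_iff.2 hinf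
  obtain ⟨F, hF⟩ := Infinite.exists_subset_card_eq {μ : ℝ | t ≤ μ ∧ T.HasEigenvalue μ} N
  have h1 : (F.card : ℝ) * t ^ 2 ≤ 1 := by
    rw [← nsmul_eq_mul]
    refine (Finset.card_nsmul_le_sum F _ _ fun μ _ => ?_).trans (hsum F)
    exact pow_le_pow_left₀ ht.le μ.2.1 2
  rw [hF] at h1
  rw [div_lt_iff₀ (by positivity)] at hN
  linarith

theorem finiteDimensional_iSup_eigenspace_ge (hlip : LipschitzWith L (Function.uncurry K))
    (hb : ∀ x y, |K x y| ≤ 1) (hsymm : ∀ x y, K x y = K y x) {t : ℝ} (ht : 0 < t) :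
    FiniteDimensional ℝ
      (⨆ μ ∈ Set.Ici t, (kernelOp K hlip.continuous).eigenspace μ : Submodule ℝ L2) := by
  set T := kernelOp K hlip.continuous with hT
  have hfin := finite_setOf_hasEigenvalue_ge hlip hb hsymm ht
  have : Finite {μ : ℝ | t ≤ μ ∧ T.HasEigenvalue μ} := hfin
  have : ∀ μ : {μ : ℝ | t ≤ μ ∧ T.HasEigenvalue μ}, FiniteDimensional ℝ (T.eigenspace (μ : ℝ)) :=
    fun μ => finiteDimensional_eigenspace_kernelOp hlip hb (ht.trans_le μ.2.1).ne'
  refine Submodule.finiteDimensional_of_le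
    (S₂ := ⨆ μ : {μ : ℝ | t ≤ μ ∧ T.HasEigenvalue μ}, T.eigenspace (μ : ℝ)) ?_
  refine iSup₂_le fun μ hμ => ?_
  by_cases h : T.HasEigenvalue μ
  · exact le_iSup (fun μ : {μ : ℝ | t ≤ μ ∧ T.HasEigenvalue μ} => T.eigenspace (μ : ℝ)) ⟨μ, hμ, h⟩
  · rw [Module.End.hasEigenvalue_iff, not_not] at h
    rw [h]
    exact bot_le

/-- The supremum that defines `posEigenvalue` is over a set bounded by `1`, as all eigenvalues are,
so each element of the set is a lower bound for it. -/
theorem le_posEigenvalue (hlip : LipschitzWith L (Function.uncurry K))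
    (hb : ∀ x y, |K x y| ≤ 1) {t : ℝ} (ht : 0 < t) {j : ℕ} (hj : 1 ≤ j)
    (h : j ≤ Module.finrank ℝ
      (⨆ μ ∈ Set.Ici t, (kernelOp K hlip.continuous).eigenspace μ : Submodule ℝ L2)) :
    t ≤ posEigenvalue (kernelOp K hlip.continuous) j := by
  refine le_csSup ⟨1, fun s hs => ?_⟩ ⟨ht, h⟩
  by_contra! h1
  have : (⨆ μ ∈ Set.Ici s, (kernelOp K hlip.continuous).eigenspace μ : Submodule ℝ L2) = ⊥ := by
    refine (eq_bot_iff.2 <| iSup₂_le fun μ hμ => ?_)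
    by_contra h2
    have h3 := abs_eigenvalue_le_one hlip.continuous hb
      (Module.End.hasEigenvalue_iff.2 (fun h4 => h2 h4.le))
    linarith [le_abs_self μ, Set.mem_Ici.1 hμ]
  have h5 := hs.2
  rw [this, finrank_bot] at h5
  omega

theorem eigenvalue_le_posEigenvalue_one (hlip : LipschitzWith L (Function.uncurry K))
    (hb : ∀ x y, |K x y| ≤ 1) (hsymm : ∀ x y, K x y = K y x) {μ : ℝ} (hμ0 : 0 < μ)
    (hμ : (kernelOp K hlip.continuous).HasEigenvalue μ) :
    μ ≤ posEigenvalue (kernelOp K hlip.continuous) 1 := by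
  have := finiteDimensional_iSup_eigenspace_ge hlip hb hsymm hμ0
  refine le_posEigenvalue hlip hb hμ0 le_rfl (Submodule.one_le_finrank_iff.2 fun h => ?_)
  refine Module.End.hasEigenvalue_iff.1 hμ (eq_bot_iff.2 (le_trans ?_ h.le))
  exact le_iSup₂_of_le μ (Set.mem_Ici.2 le_rfl) le_rfl

theorem posEigenvalue_nonneg (T : Module.End ℝ L2) (j : ℕ) : 0 ≤ posEigenvalue T j :=
  Real.sSup_nonneg fun _ h => h.1.le

/-- Two orthogonal eigenvectors with positive eigenvalues force the second positive eigenvalue to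
be at least the smaller of the two. -/
theorem le_posEigenvalue_two (hlip : LipschitzWith L (Function.uncurry K))
    (hb : ∀ x y, |K x y| ≤ 1) (hsymm : ∀ x y, K x y = K y x) {μ lam : ℝ} (hμ0 : 0 < μ)
    (hμ : μ ≤ lam) {f g : L2} (hf : f ∈ (kernelOp K hlip.continuous).eigenspace lam)
    (hg : g ∈ (kernelOp K hlip.continuous).eigenspace μ) (hf0 : f ≠ 0) (hg0 : g ≠ 0)
    (hfg : ⟪f, g⟫ = 0) : μ ≤ posEigenvalue (kernelOp K hlip.continuous) 2 := by
  have := finiteDimensional_iSup_eigenspace_ge hlip hb hsymm hμ0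
  refine le_posEigenvalue hlip hb hμ0 one_le_two ?_
  have hli : LinearIndependent ℝ ![f, g] := by
    refine linearIndependent_of_ne_zero_of_inner_eq_zero (𝕜 := ℝ) ?_ ?_
    · intro i
      fin_cases i
      · exact hf0
      · exact hg0
    · intro i j hij
      fin_cases i <;> fin_cases j <;> simp_all [real_inner_comm]
  have h2 := finrank_span_eq_card hli
  rw [Fintype.card_fin] at h2
  refine h2.symm.le.trans (Submodule.finrank_mono (Submodule.span_le.2 ?_))
  rintro _ ⟨i, rfl⟩
  fin_cases i
  · exact Submodule.mem_iSup_of_mem lam (Submodule.mem_iSup_of_mem (Set.mem_Ici.2 hμ) hf)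
  · exact Submodule.mem_iSup_of_mem μ (Submodule.mem_iSup_of_mem (Set.mem_Ici.2 le_rfl) hg)

end Spectrum

/-! ### The eigenfunction expansion of a Lipschitz kernel -/

section Spectrum

variable {K : I → I → ℝ} {L : ℝ≥0}

theorem OtherEig.val_ne_zero {T : Module.End ℝ L2} (i : OtherEig T) : i.val ≠ 0 := i.1.2.2.1

theorem orthonormal_sigma_eigenspace {E γ : Type*} [NormedAddCommGroup E] [InnerProductSpace ℝ E]
    {T : Module.End ℝ E} (hT : T.IsSymmetric) {f : γ → ℝ} (hf : Function.Injective f)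
    [∀ i, FiniteDimensional ℝ (T.eigenspace (f i))] :
    Orthonormal ℝ fun a : Σ i, Fin (Module.finrank ℝ (T.eigenspace (f i))) =>
      (stdOrthonormalBasis ℝ (T.eigenspace (f a.1)) a.2 : E) := by
  have h := (hT.orthogonalFamily_eigenspaces.comp hf).orthonormal_sigma_orthonormal
    (v_family := fun i => stdOrthonormalBasis ℝ (T.eigenspace (f i)))
    fun i => (stdOrthonormalBasis ℝ (T.eigenspace (f i))).orthonormal
  exact h

/-- An orthonormal family of eigenvectors for the eigenvalues other than `0` and the top one, which
together with the top eigenvector `φ` spans the orthogonal complement of the kernel. -/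
theorem exists_orthonormal_otherEig {T : Module.End ℝ L2} (hT : T.IsSymmetric)
    (hfin : ∀ μ ≠ 0, FiniteDimensional ℝ (T.eigenspace μ)) (horth : (⨆ μ, T.eigenspace μ)ᗮ = ⊥)
    {φ : L2} (hφ_norm : ‖φ‖ = 1) (hφ : T φ = posEigenvalue T 1 • φ)
    (hsimple : ∀ g ∈ T.eigenspace (posEigenvalue T 1), ⟪φ, g⟫ = 0 → g = 0) :
    ∃ v : OtherEig T → L2, Orthonormal ℝ v ∧
      (∀ i, T (v i) = i.val • v i) ∧ (∀ i, ⟪φ, v i⟫ = 0) ∧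
      ∀ g, ⟪φ, g⟫ = 0 → (∀ i, ⟪v i, g⟫ = 0) → T g = 0 := by
  set lam := posEigenvalue T 1 with hlam
  have hφmem : φ ∈ T.eigenspace lam := Module.End.mem_eigenspace_iff.2 hφ
  have : ∀ μ : {μ : ℝ // T.HasEigenvalue μ ∧ μ ≠ 0 ∧ μ ≠ lam},
      FiniteDimensional ℝ (T.eigenspace (μ : ℝ)) := fun μ => hfin μ μ.2.2.1
  set b := fun μ : {μ : ℝ // T.HasEigenvalue μ ∧ μ ≠ 0 ∧ μ ≠ lam} =>
    stdOrthonormalBasis ℝ (T.eigenspace (μ : ℝ)) with hbdef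
  refine ⟨fun i => (b i.1 i.2 : L2), orthonormal_sigma_eigenspace hT Subtype.val_injective,
    fun i => Module.End.mem_eigenspace_iff.1 (b i.1 i.2).2, fun i => ?_, fun g h1 h2 => ?_⟩
  · exact hT.orthogonalFamily_eigenspaces (Ne.symm i.1.2.2.2) ⟨φ, hφmem⟩ (b i.1 i.2)
  have hg : ∀ μ ≠ 0, ∀ w ∈ T.eigenspace μ, ⟪w, g⟫ = 0 := by
    intro μ hμ0 w hw
    by_cases hw0 : w = 0
    · rw [hw0, inner_zero_left]
    by_cases hμ : μ = lam
    · -- The top eigenspace is the line spanned by `φ`.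
      subst hμ
      have hw' := hsimple (w - ⟪φ, w⟫ • φ)
        (Submodule.sub_mem _ hw (Submodule.smul_mem _ _ hφmem)) (by
          rw [inner_sub_right, inner_smul_right, real_inner_self_eq_norm_sq, hφ_norm]
          ring)
      rw [sub_eq_zero.1 hw', inner_smul_left, h1, mul_zero]
    · have hev : T.HasEigenvalue μ := Module.End.hasEigenvalue_of_hasEigenvector ⟨hw, hw0⟩
      have h3 := (b ⟨μ, hev, hμ0, hμ⟩).sum_repr ⟨w, hw⟩
      have h4 := congrArg (Subtype.val : T.eigenspace μ → L2) h3
      rw [Submodule.coe_sum] at h4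
      simp only [Submodule.coe_smul] at h4
      rw [← h4, sum_inner]
      refine Finset.sum_eq_zero fun j _ => ?_
      rw [inner_smul_left]
      exact mul_eq_zero_of_right _ (h2 ⟨⟨μ, hev, hμ0, hμ⟩, j⟩)
  have hTg : T g ∈ (⨆ μ, T.eigenspace μ)ᗮ := by
    rw [← Submodule.iInf_orthogonal, Submodule.mem_iInf]
    intro μ w hw
    rw [← hT, Module.End.mem_eigenspace_iff.1 hw, inner_smul_left]
    by_cases hμ : μ = 0
    · simp [hμ]
    · rw [hg μ hμ w hw, mul_zero]
  rw [horth] at hTg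
  exact (Submodule.mem_bot ℝ).1 hTg

/-- Nonempty open subsets of the unit interval have positive measure, so that continuous
representatives are unique. -/
instance isOpenPosMeasure_unitInterval : (volume : Measure I).IsOpenPosMeasure where
  open_pos := by
    rintro _ ⟨V, hV, rfl⟩ ⟨x, hx⟩
    have hx1 : (x : ℝ) ∈ closure (Set.Ioo (0 : ℝ) 1) := by
      rw [closure_Ioo zero_ne_one]
      exact x.2
    have h1 : 0 < volume (V ∩ Set.Ioo (0 : ℝ) 1) :=
      (hV.inter isOpen_Ioo).measure_pos volume (mem_closure_iff.1 hx1 V hV hx)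
    have h2 : volume (Subtype.val ⁻¹' V : Set I) = volume (V ∩ Set.Icc (0 : ℝ) 1) := by
      rw [Measure.Subtype.volume_def, comap_subtype_coe_apply measurableSet_Icc,
        Subtype.image_preimage_coe, Set.inter_comm]
    rw [h2]
    exact (h1.trans_le (measure_mono (Set.inter_subset_inter_right _ Set.Ioo_subset_Icc_self))).ne'

/-- If `T g = 0` for all `g` orthogonal to `φ` and the `v i`, then the sections of the kernel are
the sums of their Fourier series along this orthonormal system. -/
theorem hasSum_kernelSection (hlip : LipschitzWith L (Function.uncurry K)) {κ : Type*} {φ : L2}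
    {v : κ → L2} (hφ_norm : ‖φ‖ = 1) (hv : Orthonormal ℝ v) (hφv : ∀ i, ⟪φ, v i⟫ = 0)
    (hker : ∀ g, ⟪φ, g⟫ = 0 → (∀ i, ⟪v i, g⟫ = 0) → kernelOp K hlip.continuous g = 0) (x : I) :
    HasSum (fun i => ⟪v i, kernelSection hlip.continuous x⟫ • v i)
      (kernelSection hlip.continuous x - ⟪φ, kernelSection hlip.continuous x⟫ • φ) := by
  classical
  have hsecker : ∀ g : L2, kernelOp K hlip.continuous g = 0 →
      ⟪kernelSection hlip.continuous x, g⟫ = 0 := fun g hg => by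
    have h1 := kernelOp_ae_eq hlip.continuous g
    rw [hg] at h1
    have h2 : (fun x => ⟪kernelSection hlip.continuous x, g⟫) =ᵐ[volume] fun _ => 0 :=
      h1.symm.trans (Lp.coeFn_zero ℝ 2 volume)
    exact congrFun ((continuous_inner_kernelSection hlip g).ae_eq_iff_eq volume
      continuous_const |>.1 h2) x
  set k := kernelSection hlip.continuous x with hk
  have hsum : Summable fun i => ⟪v i, k⟫ • v i := by
    have := (hv.orthogonalFamily.summable_iff_norm_sq_summable fun i => ⟪v i, k⟫).2
      (hv.inner_products_summable k)
    simpa using this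
  obtain ⟨S, hS⟩ := hsum
  have hφS : ⟪φ, S⟫ = 0 := by
    have h1 := hS.mapL (innerSL ℝ φ)
    simp only [innerSL_apply_apply, inner_smul_right, hφv, mul_zero] at h1
    exact h1.unique hasSum_zero
  have hvS : ∀ j, ⟪v j, S⟫ = ⟪v j, k⟫ := fun j => by
    have h1 := hS.mapL (innerSL ℝ (v j))
    simp only [innerSL_apply_apply, inner_smul_right] at h1
    refine h1.unique ?_
    convert! hasSum_ite_eq j ⟪v j, k⟫ using 2 with i
    rw [orthonormal_iff_ite.1 hv]
    by_cases hij : i = j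
    · simp [hij]
    · simp [hij, Ne.symm hij]
  set g := k - ⟪φ, k⟫ • φ - S with hg
  have hφg : ⟪φ, g⟫ = 0 := by
    rw [hg, inner_sub_right, inner_sub_right, inner_smul_right, real_inner_self_eq_norm_sq,
      hφ_norm, hφS]
    ring
  have hvg : ∀ i, ⟪v i, g⟫ = 0 := fun i => by
    rw [hg, inner_sub_right, inner_sub_right, inner_smul_right, real_inner_comm φ, hφv, hvS]
    ring
  have hSg : ⟪g, S⟫ = 0 := by
    have h1 := hS.mapL (innerSL ℝ g)
    simp only [innerSL_apply_apply, inner_smul_right, real_inner_comm (v _) g, hvg, mul_zero] at h1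
    exact h1.unique hasSum_zero
  have hgg : ⟪g, g⟫ = 0 := by
    have h1 := hsecker g (hker g hφg hvg)
    have h2 : ⟪g, g⟫ = ⟪g, k⟫ - ⟪φ, k⟫ * ⟪g, φ⟫ - ⟪g, S⟫ := by
      conv_lhs => rw [hg]
      rw [← hg, hg, inner_sub_right, inner_sub_right, inner_smul_right]
    rw [h2, hSg, real_inner_comm, h1, real_inner_comm, real_inner_comm φ g, hφg]
    ring
  rw [sub_eq_zero.1 (inner_self_eq_zero.1 hgg)]
  exact hS

end Spectrum

/-! ### Continuous eigenfunctions and the mean-square remainder -/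

section Expansion

variable {K : I → I → ℝ} {L : ℝ≥0}

theorem inner_L2_eq_integral {f g : L2} {f' g' : I → ℝ} (hf : f =ᵐ[volume] f')
    (hg : g =ᵐ[volume] g') : ⟪f, g⟫ = ∫ x, f' x * g' x := by
  rw [L2.inner_def]
  refine integral_congr_ae ?_
  filter_upwards [hf, hg] with x h1 h2
  rw [RCLike.inner_apply, conj_trivial, h1, h2, mul_comm]

/-- Integrating an eigenvector against the sections of the kernel gives a continuous
representative. -/
theorem ae_eq_continuous_representative (hK : Continuous (Function.uncurry K)) {f : L2} {c : ℝ}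
    (hc : c ≠ 0) (hf : kernelOp K hK f = c • f) :
    f =ᵐ[volume] fun x => c⁻¹ * ⟪kernelSection hK x, f⟫ := by
  have h := kernelOp_ae_eq hK f
  rw [hf] at h
  filter_upwards [h, Lp.coeFn_smul c f] with x h1 h2
  rw [← h1, h2, Pi.smul_apply, smul_eq_mul, inv_mul_cancel_left₀ hc]

theorem integral_kernel_mul_of_ae_eq (hK : Continuous (Function.uncurry K)) {f : L2}
    {f' : I → ℝ} (hf : f =ᵐ[volume] f') (x : I) :
    ∫ y, K x y * f' y = ⟪kernelSection hK x, f⟫ := by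
  rw [inner_kernelSection]
  refine integral_congr_ae ?_
  filter_upwards [hf] with y hy
  rw [hy]

/-- A residual orthogonal to what has been subtracted is no longer than the original vector. -/
theorem norm_sub_le_of_inner_eq_zero {E : Type*} [NormedAddCommGroup E] [InnerProductSpace ℝ E]
    {k p : E} (h : ⟪k - p, p⟫ = 0) : ‖k - p‖ ≤ ‖k‖ := by
  have h1 : ‖k‖ ^ 2 = ‖k - p‖ ^ 2 + ‖p‖ ^ 2 := by
    have := norm_add_sq_real (k - p) p
    rw [sub_add_cancel, h] at this
    linarith
  exact (sq_le_sq₀ (norm_nonneg _) (norm_nonneg _)).1 (by nlinarith [sq_nonneg ‖p‖])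

theorem norm_kernelSection_sub_le (hK : Continuous (Function.uncurry K))
    (hb : ∀ x y, |K x y| ≤ 1) {κ : Type*} {φ : L2} {v : κ → L2} (hφ_norm : ‖φ‖ = 1)
    (hv : Orthonormal ℝ v) (hφv : ∀ i, ⟪φ, v i⟫ = 0) (F : Finset κ) (x : I) :
    ‖kernelSection hK x - ⟪φ, kernelSection hK x⟫ • φ -
      ∑ i ∈ F, ⟪v i, kernelSection hK x⟫ • v i‖ ≤ 1 := by
  classical
  set k := kernelSection hK x with hk
  refine le_trans ?_ (norm_kernelSection_le hK hb x)
  rw [sub_sub]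
  refine norm_sub_le_of_inner_eq_zero ?_
  have hφS : ⟪φ, ∑ i ∈ F, ⟪v i, k⟫ • v i⟫ = 0 := by
    rw [inner_sum]
    exact Finset.sum_eq_zero fun i _ => by rw [inner_smul_right, hφv, mul_zero]
  have hvS : ∀ j ∈ F, ⟪v j, ∑ i ∈ F, ⟪v i, k⟫ • v i⟫ = ⟪v j, k⟫ := fun j hj =>
    hv.inner_right_sum _ hj
  have h1 : ⟪k - (⟪φ, k⟫ • φ + ∑ i ∈ F, ⟪v i, k⟫ • v i), φ⟫ = 0 := by
    rw [real_inner_comm, inner_sub_right, inner_add_right, hφS, inner_smul_right,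
      real_inner_self_eq_norm_sq, hφ_norm]
    ring
  have h2 : ∀ j ∈ F, ⟪k - (⟪φ, k⟫ • φ + ∑ i ∈ F, ⟪v i, k⟫ • v i), v j⟫ = 0 := fun j hj => by
    rw [real_inner_comm, inner_sub_right, inner_add_right, hvS j hj, inner_smul_right,
      real_inner_comm φ, hφv]
    ring
  rw [inner_add_right, inner_smul_right, h1, inner_sum,
    Finset.sum_eq_zero fun j hj => by rw [inner_smul_right, h2 j hj, mul_zero]]
  ring

/-- The remainder kernel at `x` represents the difference of the kernel section at `x` and its
projection onto finitely many eigenvectors. -/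
theorem integral_remainder_sq (hK : Continuous (Function.uncurry K)) {κ : Type*} {lam : ℝ} {φ : L2}
    {c : κ → ℝ} {v : κ → L2} {φ' : I → ℝ} {e : κ → I → ℝ} (hφ : φ =ᵐ[volume] φ')
    (hv : ∀ i, v i =ᵐ[volume] e i) {x : I} (hphi : ⟪φ, kernelSection hK x⟫ = lam * φ' x)
    (heig : ∀ i, ⟪v i, kernelSection hK x⟫ = c i * e i x) (F : Finset κ) :
    ∫ y, remainder K lam φ' c e F x y ^ 2 =
      ‖kernelSection hK x - ⟪φ, kernelSection hK x⟫ • φ -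
        ∑ i ∈ F, ⟪v i, kernelSection hK x⟫ • v i‖ ^ 2 := by
  rw [hphi, Finset.sum_congr rfl fun i _ => by rw [heig i]]
  have hv' : ∀ᵐ y, ∀ i ∈ F, ((c i * e i x) • v i : L2) y = c i * (e i x * e i y) := by
    refine (Finset.eventually_all F).2 fun i _ => ?_
    filter_upwards [Lp.coeFn_smul (c i * e i x) (v i), hv i] with y h1 h2
    rw [h1, Pi.smul_apply, h2, smul_eq_mul, mul_assoc]
  have h : (kernelSection hK x - (lam * φ' x) • φ - ∑ i ∈ F, (c i * e i x) • v i : L2)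
      =ᵐ[volume] remainder K lam φ' c e F x := by
    filter_upwards [Lp.coeFn_sub (kernelSection hK x - (lam * φ' x) • φ)
        (∑ i ∈ F, (c i * e i x) • v i),
      Lp.coeFn_sub (kernelSection hK x) ((lam * φ' x) • φ), Lp.coeFn_smul (lam * φ' x) φ,
      Lp.coeFn_finsetSum F fun i => (c i * e i x) • v i, hv', hφ,
      (memLp_section hK x).coeFn_toLp] with y h1 h2 h3 h4 h5 h6 h7
    rw [h1, Pi.sub_apply, h2, Pi.sub_apply, h3, Pi.smul_apply, h4, Finset.sum_apply,
      Finset.sum_congr rfl h5, h6, smul_eq_mul, kernelSection, h7, remainder, mul_assoc]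
  rw [← real_inner_self_eq_norm_sq, inner_L2_eq_integral h h]
  simp only [pow_two]

/-- The remainders of the Fourier series of the kernel sections tend to zero in mean square; the
bound by `1` on their norms allows dominated convergence. -/
theorem tendsto_integral_norm_sq (hlip : LipschitzWith L (Function.uncurry K))
    (hb : ∀ x y, |K x y| ≤ 1) {κ : Type*} [Countable κ] {φ : L2} {v : κ → L2}
    (hφ_norm : ‖φ‖ = 1) (hv : Orthonormal ℝ v) (hφv : ∀ i, ⟪φ, v i⟫ = 0)
    (hker : ∀ g, ⟪φ, g⟫ = 0 → (∀ i, ⟪v i, g⟫ = 0) → kernelOp K hlip.continuous g = 0) :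
    Tendsto (fun F : Finset κ => ∫ x, ‖kernelSection hlip.continuous x -
      ⟪φ, kernelSection hlip.continuous x⟫ • φ -
        ∑ i ∈ F, ⟪v i, kernelSection hlip.continuous x⟫ • v i‖ ^ 2) atTop (𝓝 0) := by
  have hkc := continuous_kernelSection hlip
  have hin : ∀ f : L2, Continuous fun x => ⟪f, kernelSection hlip.continuous x⟫ • f := fun f =>
    Continuous.smul (f := fun x => ⟪f, kernelSection hlip.continuous x⟫)
      (continuous_const.inner hkc) continuous_const
  have hcont : ∀ F : Finset κ, Continuous fun x => ‖kernelSection hlip.continuous x -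
      ⟪φ, kernelSection hlip.continuous x⟫ • φ -
        ∑ i ∈ F, ⟪v i, kernelSection hlip.continuous x⟫ • v i‖ ^ 2 := fun F =>
    ((hkc.sub (hin φ)).sub (continuous_finsetSum F fun i _ => hin (v i))).norm.pow 2
  rw [← integral_zero I ℝ (μ := volume)]
  refine tendsto_integral_filter_of_dominated_convergence (fun _ => 1)
    (Eventually.of_forall fun F => (hcont F).aestronglyMeasurable)
    (Eventually.of_forall fun F => ae_of_all _ fun x => ?_) (integrable_const 1)
    (ae_of_all _ fun x => ?_)
  · rw [Real.norm_eq_abs, abs_of_nonneg (sq_nonneg _)]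
    exact pow_le_one₀ (norm_nonneg _)
      (norm_kernelSection_sub_le hlip.continuous hb hφ_norm hv hφv F x)
  · have h1 := (tendsto_const_nhds (x := kernelSection hlip.continuous x -
      ⟪φ, kernelSection hlip.continuous x⟫ • φ)).sub
        (hasSum_kernelSection hlip hφ_norm hv hφv hker x)
    rw [sub_self] at h1
    simpa using h1.norm.pow 2

/-- Continuous representatives of an orthonormal system of eigenvectors that exhausts the orthogonal
complement of the kernel of the integral operator give an eigenfunction expansion. -/
theorem eigenExpansion_of_orthonormal (hlip : LipschitzWith L (Function.uncurry K))
    (hb : ∀ x y, |K x y| ≤ 1) (hsymm : ∀ x y, K x y = K y x) {κ : Type*} [Countable κ]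
    {lam m : ℝ} {φ : L2} {c : κ → ℝ} {v : κ → L2} (hm : 0 ≤ m) (hmlam : m < lam)
    (hcm : ∀ i, c i ≤ m) (hc : ∀ i, c i ≠ 0) (hφ_norm : ‖φ‖ = 1)
    (hφ : kernelOp K hlip.continuous φ = lam • φ) (hv : Orthonormal ℝ v)
    (hTv : ∀ i, kernelOp K hlip.continuous (v i) = c i • v i) (hφv : ∀ i, ⟪φ, v i⟫ = 0)
    (hker : ∀ g, ⟪φ, g⟫ = 0 → (∀ i, ⟪v i, g⟫ = 0) → kernelOp K hlip.continuous g = 0) :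
    EigenExpansion K lam (fun x => lam⁻¹ * ⟪kernelSection hlip.continuous x, φ⟫) c
      fun i x => (c i)⁻¹ * ⟪kernelSection hlip.continuous x, v i⟫ := by
  have hlam0 : 0 < lam := hm.trans_lt hmlam
  have hφae := ae_eq_continuous_representative hlip.continuous hlam0.ne' hφ
  have hvae := fun i => ae_eq_continuous_representative hlip.continuous (hc i) (hTv i)
  have hphi : ∀ x, ⟪φ, kernelSection hlip.continuous x⟫ =
      lam * (lam⁻¹ * ⟪kernelSection hlip.continuous x, φ⟫) := fun x => by
    rw [real_inner_comm, mul_inv_cancel_left₀ hlam0.ne']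
  have heig : ∀ i x, ⟪v i, kernelSection hlip.continuous x⟫ =
      c i * ((c i)⁻¹ * ⟪kernelSection hlip.continuous x, v i⟫) := fun i x => by
    rw [real_inner_comm, mul_inv_cancel_left₀ (hc i)]
  exact
    { continuous_kernel := hlip.continuous
      symm := hsymm
      continuous_phi := continuous_const.mul (continuous_inner_kernelSection hlip φ)
      continuous_eig := fun i => continuous_const.mul (continuous_inner_kernelSection hlip (v i))
      lam_pos := hlam0
      gap := ⟨m, hm, hmlam, hcm⟩
      integral_phi := fun x => by
        rw [integral_kernel_mul_of_ae_eq hlip.continuous hφae, mul_inv_cancel_left₀ hlam0.ne']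
      integral_eig := fun i x => by
        rw [integral_kernel_mul_of_ae_eq hlip.continuous (hvae i), mul_inv_cancel_left₀ (hc i)]
      integral_phi_sq := by
        simp only [pow_two]
        rw [← inner_L2_eq_integral hφae hφae, real_inner_self_eq_norm_sq, hφ_norm, one_pow]
      integral_phi_mul := fun i => by rw [← inner_L2_eq_integral hφae (hvae i), hφv]
      integral_mul := fun i j hij => by
        rw [← inner_L2_eq_integral (hvae i) (hvae j), hv.2 hij]
      integral_sq := fun i => by
        simp only [pow_two]
        rw [← inner_L2_eq_integral (hvae i) (hvae i), real_inner_self_eq_norm_sq, hv.1, one_pow]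
      tendsto_remainder := by
        simp only [integral_remainder_sq hlip.continuous hφae hvae (hphi _) fun i => heig i _]
        exact tendsto_integral_norm_sq hlip hb hφ_norm hv hφv hker }

/-- A Lipschitz kernel whose two largest positive eigenvalues differ has an eigenfunction
expansion, with square summable eigenvalues. -/
theorem exists_eigenExpansion (hlip : LipschitzWith L (Function.uncurry K))
    (hb : ∀ x y, |K x y| ≤ 1) (hsymm : ∀ x y, K x y = K y x) {T : Module.End ℝ L2}
    (hT : T = kernelOp K hlip.continuous) (hgap : posEigenvalue T 2 < posEigenvalue T 1)
    {φ : L2} (hφ_norm : ‖φ‖ = 1) (hφ : T φ = posEigenvalue T 1 • φ) :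
    ∃ (φ' : I → ℝ) (e : OtherEig T → I → ℝ),
      EigenExpansion K (posEigenvalue T 1) φ' OtherEig.val e ∧
      φ =ᵐ[volume] φ' ∧ Summable fun i : OtherEig T => i.val ^ 2 := by
  have hφ0 : φ ≠ 0 := norm_ne_zero_iff.1 (by rw [hφ_norm]; exact one_ne_zero)
  have hlam2 := posEigenvalue_nonneg T 2
  have hφmem := Module.End.mem_eigenspace_iff.2 hφ
  have hone : ∀ μ : ℝ, 0 < μ → T.HasEigenvalue μ → μ ≤ posEigenvalue T 1 := by
    rw [hT]
    exact fun μ hμ0 => eigenvalue_le_posEigenvalue_one hlip hb hsymm hμ0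
  have htwo : ∀ μ : ℝ, 0 < μ → μ ≤ posEigenvalue T 1 → ∀ g ∈ T.eigenspace μ, g ≠ 0 →
      ⟪φ, g⟫ = 0 → μ ≤ posEigenvalue T 2 := by
    rw [hT] at hφmem ⊢
    exact fun μ hμ0 hμ g hg hg0 => le_posEigenvalue_two hlip hb hsymm hμ0 hμ hφmem hg hφ0 hg0
  have hsym : T.IsSymmetric := hT ▸ kernelOp_isSymmetric hlip.continuous hsymm
  have hfin : ∀ μ ≠ 0, FiniteDimensional ℝ (T.eigenspace μ) := by
    rw [hT]
    exact fun μ hμ => finiteDimensional_eigenspace_kernelOp hlip hb hμ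
  have horth : (⨆ μ, T.eigenspace μ)ᗮ = ⊥ := by
    rw [hT]
    exact orthogonal_iSup_eigenspace_kernelOp hlip hb hsymm
  obtain ⟨v, hv, hTv, hφv, hker⟩ := exists_orthonormal_otherEig hsym hfin horth hφ_norm hφ
    fun g hg hφg => by
      by_contra hg0
      exact absurd hgap (not_lt.2 (htwo _ (hlam2.trans_lt hgap) le_rfl g hg hg0 hφg))
  have hTv' : ∀ i, kernelOp K hlip.continuous (v i) = i.val • v i := fun i => by rw [← hT, hTv]
  have hφ' : kernelOp K hlip.continuous φ = posEigenvalue T 1 • φ := by rw [← hT, hφ]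
  have hsum : Summable fun i : OtherEig T => i.val ^ 2 :=
    summable_of_sum_le (fun i => sq_nonneg _) (sum_sq_eigenvalue_le_one hlip hb hv hTv')
  have hcount : Countable (OtherEig T) := by
    have h1 := hsum.countable_support
    have h2 : Function.support (fun i : OtherEig T => i.val ^ 2) = Set.univ :=
      Set.eq_univ_of_forall fun i => pow_ne_zero 2 i.val_ne_zero
    rw [h2] at h1
    exact Set.countable_univ_iff.1 h1
  refine ⟨_, _, eigenExpansion_of_orthonormal hlip hb hsymm hlam2 hgap (fun i => ?_)
    (fun i => i.val_ne_zero) hφ_norm hφ' hv hTv' hφv (by rwa [← hT]),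
    ae_eq_continuous_representative hlip.continuous (hlam2.trans_lt hgap).ne' hφ', hsum⟩
  by_cases hi : 0 < i.val
  · exact htwo i.val hi (hone i.val hi i.1.2.1) (v i) (Module.End.mem_eigenspace_iff.2 (hTv i))
      (hv.ne_zero i) (hφv i)
  · exact (not_lt.1 hi).trans hlam2

end Expansion

/-- A constant normalised eigenfunction has square `1` at every point, not only almost everywhere,
once its continuous representative is taken. -/
theorem EigenExpansion.sq_eq_one_of_isAEConst {ι : Type*} {K : I → I → ℝ} {lam : ℝ} {φ : L2}
    {φ' : I → ℝ} {val : ι → ℝ} {e : ι → I → ℝ} (h : EigenExpansion K lam φ' val e)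
    (hφ : φ =ᵐ[volume] φ') (hconst : IsAEConst φ) (x : I) : φ' x ^ 2 = 1 := by
  obtain ⟨c, hc⟩ := hconst
  have h1 : φ' =ᵐ[volume] fun _ => c := by
    filter_upwards [hφ, hc] with y h2 h3
    rw [← h2, h3]
  -- Continuous functions that agree almost everywhere are equal.
  have h2 : φ' = fun _ => c := (h.continuous_phi.ae_eq_iff_eq volume continuous_const).1 h1
  have h3 := h.integral_phi_sq
  rw [h2] at h3 ⊢
  simpa using h3

end RandomKernel

theorem theorem2p3
    {Ω : Type*} [MeasurableSpace Ω] (P : Measure Ω) [IsProbabilityMeasure P]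
    (K : I → I → ℝ) (L : ℝ≥0)
    (hlip : LipschitzWith L (Function.uncurry K))
    (hbound : ∀ x y, |K x y| ≤ 1)
    (hsymm : ∀ x y, K x y = K y x)
    (T : Module.End ℝ RandomKernel.L2)
    (hT : T = RandomKernel.kernelOp K hlip.continuous)
    (hgap : RandomKernel.posEigenvalue T 2 < RandomKernel.posEigenvalue T 1)
    (lam : ℝ) (hlam : lam = RandomKernel.posEigenvalue T 1)
    (φ : RandomKernel.L2) (hφ_norm : ‖φ‖ = 1) (hφ : T φ = lam • φ)
    (U : ℕ → Ω → I) (hU : ∀ i, HasLaw (U i) (volume : Measure I) P) (hUind : iIndepFun U P)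
    (lamn : ℕ → Ω → ℝ)
    (hlamn : ∀ n ω, lamn n ω =
      RandomKernel.maxEigenvalue (RandomKernel.kernelMatrix K fun i : Fin n => U i ω)) :
    (¬ RandomKernel.IsAEConst φ →
      TendstoInDistribution (fun (n : ℕ) ω => √(n : ℝ) * (lamn n ω / n - lam)) atTop
        (id : ℝ → ℝ) (fun _ => P)
        (gaussianReal 0 (lam ^ 2 * Var[fun x : I => φ x ^ 2; volume]).toNNReal)) ∧
    (RandomKernel.IsAEConst φ →
      Summable (fun i : RandomKernel.OtherEig T => i.val ^ 2 / (lam - i.val)) ∧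
      ∀ (Ω' : Type*) [MeasurableSpace Ω'] (P' : Measure Ω') [IsProbabilityMeasure P']
        (Z : RandomKernel.OtherEig T → Ω' → ℝ),
        (∀ i, HasLaw (Z i) (gaussianReal 0 1) P') → iIndepFun Z P' →
        ∃ S : Ω' → ℝ,
          RandomKernel.HasL2Sum P'
            (fun i ω => lam * i.val / (lam - i.val) * (Z i ω ^ 2 - 1)) S ∧
          TendstoInDistribution (fun (n : ℕ) ω => lamn n ω - ((n : ℝ) - 1) * lam) atTop
            (fun ω => S ω + ∑' i : RandomKernel.OtherEig T, i.val ^ 2 / (lam - i.val))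
            (fun _ => P) P') := by
  subst hlam
  obtain ⟨φ', e, hexp, hφφ', hsum⟩ := RandomKernel.exists_eigenExpansion hlip hbound hsymm hT hgap
    hφ_norm hφ
  have hlamn' : ∀ n, lamn n = fun ω =>
      RandomKernel.maxEigenvalue (RandomKernel.kernelMatrix K fun i : Fin n => U i ω) :=
    fun n => funext (hlamn n)
  obtain rfl : lamn = fun n ω =>
      RandomKernel.maxEigenvalue (RandomKernel.kernelMatrix K fun i : Fin n => U i ω) :=
    funext hlamn'
  refine ⟨fun _ => ?_, fun hconst => ⟨hexp.summable_sq_div hsum, ?_⟩⟩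
  · have hvar : Var[fun x : I => φ x ^ 2; volume] = Var[fun x : I => φ' x ^ 2; volume] := by
      refine variance_congr ?_
      filter_upwards [hφφ'] with x hx
      rw [hx]
    rw [hvar]
    exact hexp.tendstoInDistribution_of_general hU hUind
  · intro Ω' _ P' _ Z hZ hZind
    exact hexp.tendstoInDistribution_of_sq_eq_one hsum
      (hexp.sq_eq_one_of_isAEConst hφφ' hconst) hU hUind hZ hZind
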